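/- **Setting.** A finite-horizon tabular cost-accumulating MDP $M$ has a horizon $H$, finitely many states and actions (for each time and state a non-empty set of available actions), an initial state $s_0$, and for each time $h$, state $s$ and action $a$ a transition distribution $P_h(\cdot\mid s,a)$, an expected reward $r_h(s,a)$ and a finitely supported distribution $C_h(s,a)$ of cost vectors in $\mathbb{Q}^m$; all data are rational. A policy $\pi$ maps each history (the past states, actions and observed cost vectors) to a distribution over available actions. Let $\overline\Pi$ be the class of all policies or the class of all deterministic policies, and let $V^\pi_M$ be the expected total reward of $\pi$. A cost criterion is *shortly recursive* (SR) if it is computed backwards from $C_{H+1}=0$ by $C_h^\pi(\tau)=c_h(s,a)+f_{s'}\,g(P_h(s'\mid s,a))\,C^\pi_{h+1}(\tau,a,s')$ (and likewise aggregated by $(f,g)$ over random actions and random costs), where $f$ is associative, non-decreasing and $1$-Lipschitz in each argument, $0$ is neutral for $f$ on the cost values considered, $g$ maps $[0,1]$ into $[0,1]$ with $g(0)=0$ and $g(1)=1$, and the combination $x\mapsto f_{s'}\,g(P(s'))x_{s'}$ is $1$-Lipschitz in the sup norm. The expectation criterion is $(f,g)=(x+y,\;p)$; the worst-case criterion, for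 nonnegative costs, is $(f,g)=(\max(x,y),\;[p>0])$. For the problem of maximizing $V^\pi_M$ over $\pi\in\overline\Pi$ subject to given constraints, let $V^*$ be the supremum of the values of the feasible policies. A *polynomial-time $\epsilon$-approximation* is an algorithm that, given $M$, the constraint parameters and $\epsilon$, either correctly reports that the instance is infeasible or outputs a description of a policy $\pi\in\overline\Pi$ with $V^\pi_M\ge V^*-\epsilon$ that satisfies the constraints relaxed by $\epsilon$; the description is evaluated on histories by a second algorithm, which outputs the action probabilities. Both run in time polynomial in the bit size of their input, in $1/\epsilon$ and in any integer bound on $\|c_{\max}-c_{\min}\|_\infty$ (so in polynomial time when the costs are polynomially bounded). A *polynomial-time $(\epsilon,\epsilon)$-bicriteria* for SR criteria $C_1,\dots,C_m$ is a polynomial-time $\epsilon$-approximation for the constraints $C^\pi_{M,i}\le B_i$, $i\le m$, relaxed to $C^\pi_{M,i}\le B_i+\epsilon$. **Theorem (Implications).** Fix a constant $m$, one of the kinds "expectation", "almost-sure", "chance" for each $i\le m$, a class $\overline\Pi$ (deterministic or stochastic), and a set $E$ of positive rational accuracies (for instance a single $\epsilon$, or all positive rationals). Let $C_i$ be the expectation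 criterion if the $i$-th kind is "expectation" or "chance", and the worst-case criterion if it is "almost-sure". Suppose that there is a polynomial-time $(\epsilon,\epsilon)$-bicriteria, $\epsilon\in E$, over $\overline\Pi$ for the criteria $C_1,\dots,C_m$. Then there is a polynomial-time $\epsilon$-approximation, $\epsilon\in E$, over $\overline\Pi$ for the problem of maximizing $V^\pi_M$ subject to the $m$ constraints which, according to the kind of $i$, are $$\mathbb{E}^\pi_M\Big[\sum_{h=1}^H c_{h,i}\Big]\le B_i,\qquad \mathbb{P}^\pi_M\Big[\sum_{h=1}^H c_{h,i}\le B_i\Big]=1,\qquad \mathbb{P}^\pi_M\Big[\sum_{h=1}^H c_{h,i}> B_i\Big]\le\delta_i .$$ That is, on every feasible instance a policy $\pi\in\overline\Pi$ is computed in polynomial time with $V^\pi_M\ge V^*-\epsilon$ and, according to the kind of $i$, $$\mathbb{E}^\pi_M\Big[\sum_{h=1}^H c_{h,i}\Big]\le B_i+\epsilon,\qquad \mathbb{P}^\pi_M\Big[\sum_{h=1}^H c_{h,i}\le B_i+\epsilon\Big]=1,\qquad \mathbb{P}^\pi_M\Big[\sum_{h=1}^H c_{h,i}> B_i+\epsilon\Big]\le\delta_i+\epsilon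 .$$ In particular this covers chance constraints, deterministic policies under several expectation constraints, and constraints of different kinds, whenever the number of constraints is constant. -/

import Mathlib

namespace CRL

/-! ### Programs, their step count, and the data they work on -/

/-- Data: binary trees whose leaves carry rational numbers. -/
inductive Data : Type
  | num : ℚ → Data
  | pair : Data → Data → Data

namespace Data

/-- Bit size: a number is charged its binary length (numerator and denominator), a pair the
sizes of its two components. -/
def size : Data → ℕ
  | num q => 1 + q.num.natAbs.size + q.den.size
  | pair a b => 1 + a.size + b.size

/-- A datum is positive if it is a positive number (the test used by programs). -/
def Pos : Data → Prop
  | num q => 0 < q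
  | pair _ _ => False

/-- Lists as data: `num 0` is the empty list, `pair` is cons. -/
def ofList : List Data → Data
  | [] => num 0
  | x :: l => pair x (ofList l)

/-- A rational vector as data: the list of its entries. -/
def ofVec {n : ℕ} (v : Fin n → ℚ) : Data :=
  ofList (List.ofFn fun i => num (v i))

end Data

/-- The elementary operations of programs. -/
inductive Op : Type
  | id | fst | snd | isPair | add | sub | mul | div | floor
  | const : ℚ → Op

/-- The result of an elementary operation; a number `0` where the operation does not apply. -/
def Op.apply : Op → Data → Data
  | .id, x => x
  | .fst, .pair a _ => a
  | .snd, .pair _ b => b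
  | .isPair, .pair _ _ => .num 1
  | .add, .pair (.num a) (.num b) => .num (a + b)
  | .sub, .pair (.num a) (.num b) => .num (a - b)
  | .mul, .pair (.num a) (.num b) => .num (a * b)
  | .div, .pair (.num a) (.num b) => .num (a / b)
  | .floor, .num a => .num ⌊a⌋
  | .const q, _ => .num q
  | _, _ => .num 0

/-- Programs: elementary operations, pairing, composition, branching and unbounded loops. -/
inductive Prog : Type
  | op : Op → Prog
  | pair : Prog → Prog → Prog
  | comp : Prog → Prog → Prog
  | ite : Prog → Prog → Prog → Prog
  | while : Prog → Prog → Prog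

/-- `Run P x y t`: on input `x` the program `P` halts with output `y` after `t` elementary bit
operations (logarithmic cost: an elementary operation is charged the bit size of the whole
datum that it is applied to, plus one). `comp P Q` runs `P` first; `ite C P Q` runs `P` if the
output of `C` is positive and `Q` otherwise; `while C P` runs `P` as long as the output of `C`
is positive. -/
inductive Run : Prog → Data → Data → ℕ → Prop
  | op (o : Op) (x : Data) : Run (.op o) x (o.apply x) (1 + x.size)
  | pair {P Q : Prog} {x a b : Data} {s t : ℕ} :
      Run P x a s → Run Q x b t → Run (.pair P Q) x (.pair a b) (1 + s + t)
  | comp {P Q : Prog} {x y z : Data} {s t : ℕ} :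
      Run P x y s → Run Q y z t → Run (.comp P Q) x z (1 + s + t)
  | ite_pos {C P Q : Prog} {x v y : Data} {s t : ℕ} :
      Run C x v s → v.Pos → Run P x y t → Run (.ite C P Q) x y (1 + s + t)
  | ite_neg {C P Q : Prog} {x v y : Data} {s t : ℕ} :
      Run C x v s → ¬ v.Pos → Run Q x y t → Run (.ite C P Q) x y (1 + s + t)
  | while_stop {C P : Prog} {x v : Data} {s : ℕ} :
      Run C x v s → ¬ v.Pos → Run (.while C P) x x (1 + s)
  | while_step {C P : Prog} {x v y z : Data} {s t u : ℕ} :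
      Run C x v s → v.Pos → Run P x y t → Run (.while C P) y z u →
        Run (.while C P) x z (1 + s + t + u)

/-! ### Cost-accumulating Markov decision processes -/

/-- A finite rational probability vector as a probability mass function. -/
noncomputable def pmfOfRat {n : ℕ} (p : Fin n → ℚ) (h0 : ∀ i, 0 ≤ p i) (h1 : ∑ i, p i = 1) :
    PMF (Fin n) :=
  PMF.ofFintype (fun i => ENNReal.ofReal (p i)) (by
    rw [← ENNReal.ofReal_sum_of_nonneg (fun i _ => by exact_mod_cast h0 i)]
    have h : (∑ i, (p i : ℝ)) = 1 := by exact_mod_cast h1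
    rw [h, ENNReal.ofReal_one])

/-- A finite-horizon tabular cost-accumulating MDP with `m` cost coordinates and rational data.
Times are `h = 0, …, H - 1`; the tables at later times are padding that is never used. The cost
distribution at `(h, s, a)` has the finitely many distinct outcomes `costVal h s a k`, taken with
probability `costProb h s a k`. `rew` is the expected immediate reward. -/
structure CaMDP (m : ℕ) where
  /-- the horizon -/
  H : ℕ
  /-- the number of states -/
  nS : ℕ
  /-- the number of actions -/
  nA : ℕ
  /-- the initial state -/
  s₀ : Fin nS
  /-- the available actions -/
  avail : ℕ → Fin nS → Finset (Fin nA)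
  avail_nonempty : ∀ h s, (avail h s).Nonempty
  /-- the transition probabilities -/
  trans : ℕ → Fin nS → Fin nA → Fin nS → ℚ
  trans_nonneg : ∀ h s a s', 0 ≤ trans h s a s'
  trans_sum : ∀ h s a, ∑ s', trans h s a s' = 1
  /-- the expected rewards -/
  rew : ℕ → Fin nS → Fin nA → ℚ
  /-- the number of outcomes of the cost -/
  nC : ℕ → Fin nS → Fin nA → ℕ
  /-- the cost vectors of the outcomes -/
  costVal : (h : ℕ) → (s : Fin nS) → (a : Fin nA) → Fin (nC h s a) → Fin m → ℚ
  costVal_injective : ∀ h s a, Function.Injective (costVal h s a)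
  /-- the probabilities of the outcomes -/
  costProb : (h : ℕ) → (s : Fin nS) → (a : Fin nA) → Fin (nC h s a) → ℚ
  costProb_nonneg : ∀ h s a k, 0 ≤ costProb h s a k
  costProb_sum : ∀ h s a, ∑ k, costProb h s a k = 1

/-- One step of a history: the action, the observed cost vector and the next state. -/
structure Step (m nS nA : ℕ) where
  /-- the action -/
  act : Fin nA
  /-- the observed cost vector -/
  cost : Fin m → ℚ
  /-- the next state -/
  next : Fin nS

/-- The two goal classes of policies. -/
inductive PolicyClass : Type
  | deterministic
  | stochastic

namespace CaMDP

variable {m : ℕ} (M : CaMDP m)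

/-- Histories, the most recent step first. The initial state is the fixed state `s₀`, and the
time of a history is its length. -/
abbrev Hist : Type := List (Step m M.nS M.nA)

/-- The current state after a history. -/
def cur : M.Hist → Fin M.nS
  | [] => M.s₀
  | x :: _ => x.next

/-- The histories that the environment can produce. -/
def IsHist : M.Hist → Prop
  | [] => True
  | x :: τ =>
      IsHist τ ∧ τ.length < M.H ∧ x.act ∈ M.avail τ.length (M.cur τ) ∧
      (∃ k, 0 < M.costProb τ.length (M.cur τ) x.act k ∧
        x.cost = M.costVal τ.length (M.cur τ) x.act k) ∧
      0 < M.trans τ.length (M.cur τ) x.act x.next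

/-- History-dependent randomized decision rules. -/
abbrev Policy : Type := M.Hist → PMF (Fin M.nA)

/-- Membership in the goal class: only available actions are chosen, and for the deterministic
class a single one. -/
def InClass (cls : PolicyClass) (π : M.Policy) : Prop :=
  (∀ τ : M.Hist, τ.length < M.H → ∀ a ∈ (π τ).support, a ∈ M.avail τ.length (M.cur τ)) ∧
  match cls with
  | .stochastic => True
  | .deterministic => ∀ τ : M.Hist, ∃ a, π τ = PMF.pure a

/-- The law of the next state. -/
noncomputable def transPMF (h : ℕ) (s : Fin M.nS) (a : Fin M.nA) : PMF (Fin M.nS) :=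
  pmfOfRat (M.trans h s a) (M.trans_nonneg h s a) (M.trans_sum h s a)

/-- The law of the (index of the) immediate cost vector. -/
noncomputable def costPMF (h : ℕ) (s : Fin M.nS) (a : Fin M.nA) : PMF (Fin (M.nC h s a)) :=
  pmfOfRat (M.costProb h s a) (M.costProb_nonneg h s a) (M.costProb_sum h s a)

/-- The law of the history reached from `τ` after `n` further interactions with `π`. -/
noncomputable def lawFrom (π : M.Policy) : ℕ → M.Hist → PMF M.Hist
  | 0, τ => PMF.pure τ
  | n + 1, τ =>
      (π τ).bind fun a =>
      (M.costPMF τ.length (M.cur τ) a).bind fun k =>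
      (M.transPMF τ.length (M.cur τ) a).bind fun s' =>
        lawFrom π n (⟨a, M.costVal τ.length (M.cur τ) a k, s'⟩ :: τ)

/-- The law over complete histories induced by the policy. -/
noncomputable def law (π : M.Policy) : PMF M.Hist := M.lawFrom π M.H []

/-- Probability of an event under the law induced by the policy. -/
noncomputable def prob (π : M.Policy) (E : Set M.Hist) : ℝ :=
  ((M.law π).toOuterMeasure E).toReal

/-- Expectation under the law induced by the policy (which has finite support). -/
noncomputable def expect (π : M.Policy) (X : M.Hist → ℝ) : ℝ :=
  ∑' τ, (M.law π τ).toReal * X τ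

/-- The sum of the expected immediate rewards along a history. -/
def totalReward : M.Hist → ℚ
  | [] => 0
  | x :: τ => totalReward τ + M.rew τ.length (M.cur τ) x.act

/-- The sum of the `i`-th costs along a history. -/
def totalCost (i : Fin m) (τ : M.Hist) : ℚ := (τ.map fun x => x.cost i).sum

/-- The value of a policy. -/
noncomputable def value (π : M.Policy) : ℝ := M.expect π fun τ => (M.totalReward τ : ℝ)

/-- The optimal value over the feasible policies of the class (`⊥` if there are none). -/
noncomputable def optValue (cls : PolicyClass) (feasible : M.Policy → Prop) : EReal :=
  ⨆ π ∈ {π : M.Policy | M.InClass cls π ∧ feasible π}, ((M.value π : ℝ) : EReal)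

/-- `R` bounds `c_max - c_min` in every cost coordinate. -/
def CostRangeLE (R : ℕ) : Prop :=
  ∀ i : Fin m, ∀ h < M.H, ∀ s a k, ∀ h' < M.H, ∀ s' a' k',
    M.costVal h s a k i - M.costVal h' s' a' k' i ≤ (R : ℚ)

/-- The input representation of the process: the list of states, the list of actions, the initial
state, and for each time, state and action the availability, the expected reward, the cost
distribution (a list of probabilities and cost vectors) and the transition probabilities. -/
def code : Data :=
  .pair (.ofVec fun s : Fin M.nS => ((s : ℕ) : ℚ)) <|
  .pair (.ofVec fun a : Fin M.nA => ((a : ℕ) : ℚ)) <|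
  .pair (.num ((M.s₀ : ℕ) : ℚ)) <|
  .ofList <| (List.range M.H).map fun h =>
  .ofList <| List.ofFn fun s : Fin M.nS =>
  .ofList <| List.ofFn fun a : Fin M.nA =>
    .pair (.num (if a ∈ M.avail h s then 1 else 0)) <|
    .pair (.num (M.rew h s a)) <|
    .pair (.ofList <| List.ofFn fun k : Fin (M.nC h s a) =>
      .pair (.num (M.costProb h s a k)) (.ofVec (M.costVal h s a k))) <|
    .ofVec (M.trans h s a)

/-- Histories as data: the list of their steps, the most recent one first. -/
def histCode (τ : M.Hist) : Data :=
  .ofList <| τ.map fun x =>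
    .pair (.num ((x.act : ℕ) : ℚ)) (.pair (.ofVec x.cost) (.num ((x.next : ℕ) : ℚ)))

/-- The evaluator `ev` computes `π` from its description `w`: on `w` and a history `τ`, it outputs
the vector of action probabilities of `π` at `τ`, in time at most `T` of the size of `τ`. -/
def Evaluates (ev : Prog) (w : Data) (T : ℕ → ℕ) (π : M.Policy) : Prop :=
  ∀ τ : M.Hist, M.IsHist τ → τ.length < M.H →
    ∃ (q : Fin M.nA → ℚ) (t : ℕ),
      Run ev (.pair w (M.histCode τ)) (.ofVec q) t ∧ t ≤ T (M.histCode τ).size ∧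
      ∀ a, (π τ a).toReal = (q a : ℝ)

end CaMDP

/-! ### Shortly recursive cost criteria -/

/-- The finite extension of a binary function with neutral element `0`. -/
def fold (f : ℝ → ℝ → ℝ) {n : ℕ} (x : Fin n → ℝ) : ℝ := (List.ofFn x).foldr f 0

/-- The pair `(f, g)` that defines a shortly recursive criterion. `dom` is the set of
cost values on which `0` is neutral for `f`: all reals for the sum, the nonnegative reals for the
maximum. The normalization `g 1 = 1` makes the recursion below, which also covers randomized
actions and costs, agree with the recursion for deterministic ones. -/
structure SR where
  /-- the aggregation function -/
  f : ℝ → ℝ → ℝ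
  /-- the weight function -/
  g : ℝ → ℝ
  /-- the admissible cost values -/
  dom : AddSubmonoid ℝ
  assoc : ∀ x y z, f (f x y) z = f x (f y z)
  mono : ∀ x x' y y', x ≤ x' → y ≤ y' → f x y ≤ f x' y'
  short_left : ∀ x x' y, |f x y - f x' y| ≤ |x - x'|
  short_right : ∀ x y y', |f x y - f x y'| ≤ |y - y'|
  f_mem : ∀ x ∈ dom, ∀ y ∈ dom, f x y ∈ dom
  zero_left : ∀ x ∈ dom, f 0 x = x
  zero_right : ∀ x ∈ dom, f x 0 = x
  g_mem : ∀ p ∈ Set.Icc (0 : ℝ) 1, g p ∈ Set.Icc (0 : ℝ) 1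
  g_zero : g 0 = 0
  g_one : g 1 = 1
  short_fold : ∀ (n : ℕ) (p x y : Fin n → ℝ) (d : ℝ), (∀ i, 0 ≤ p i) → ∑ i, p i = 1 →
    (∀ i, |x i - y i| ≤ d) →
    |fold f (fun i => g (p i) * x i) - fold f (fun i => g (p i) * y i)| ≤ d

/-- The cost-to-go of `π` in coordinate `i` from the history `τ` on, with `n` steps to go. -/
noncomputable def SR.costFrom (C : SR) {m : ℕ} (M : CaMDP m) (i : Fin m) (π : M.Policy) :
    ℕ → M.Hist → ℝ
  | 0, _ => 0
  | n + 1, τ =>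
      fold C.f fun a => C.g (π τ a).toReal *
        fold C.f fun k => C.g (M.costProb τ.length (M.cur τ) a k : ℝ) *
          ((M.costVal τ.length (M.cur τ) a k i : ℝ) +
            fold C.f fun s' => C.g (M.trans τ.length (M.cur τ) a s' : ℝ) *
              SR.costFrom C M i π n (⟨a, M.costVal τ.length (M.cur τ) a k, s'⟩ :: τ))

/-- The cost of a policy under a shortly recursive criterion applied to the `i`-th cost. -/
noncomputable def SR.cost (C : SR) {m : ℕ} (M : CaMDP m) (i : Fin m) (π : M.Policy) : ℝ :=
  C.costFrom M i π M.H []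

theorem fold_add {n : ℕ} (x : Fin n → ℝ) : fold (fun a b => a + b) x = ∑ i, x i := by
  rw [← List.sum_ofFn]
  rfl

theorem fold_max_le {n : ℕ} (x y : Fin n → ℝ) (d : ℝ) (hd : 0 ≤ d) (h : ∀ i, x i ≤ y i + d) :
    fold max x ≤ fold max y + d := by
  unfold fold
  induction n with
  | zero => simpa using hd
  | succ n ih =>
    rw [List.ofFn_succ, List.ofFn_succ, List.foldr_cons, List.foldr_cons]
    have h1 := ih (fun i => x i.succ) (fun i => y i.succ) (fun i => h i.succ)
    refine max_le ((h 0).trans ?_) (h1.trans ?_)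
    · gcongr
      exact le_max_left _ _
    · gcongr
      exact le_max_right _ _

/-- The expectation criterion: `f x y = x + y` and `g p = p`. -/
def SR.sum : SR where
  f x y := x + y
  g p := p
  dom := ⊤
  assoc := add_assoc
  mono _ _ _ _ h h' := add_le_add h h'
  short_left x x' y := by simp
  short_right x y y' := by simp
  f_mem _ _ _ _ := trivial
  zero_left x _ := zero_add x
  zero_right x _ := add_zero x
  g_mem _ h := h
  g_zero := rfl
  g_one := rfl
  short_fold n p x y d hp h1 h := by
    rw [fold_add, fold_add, ← Finset.sum_sub_distrib]
    calc |∑ i, (p i * x i - p i * y i)| ≤ ∑ i, |p i * x i - p i * y i| :=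
          Finset.abs_sum_le_sum_abs _ _
      _ ≤ ∑ i, p i * d := by
          refine Finset.sum_le_sum fun i _ => ?_
          rw [← mul_sub, abs_mul, abs_of_nonneg (hp i)]
          exact mul_le_mul_of_nonneg_left (h i) (hp i)
      _ = d := by rw [← Finset.sum_mul, h1, one_mul]

/-- The worst-case criterion: `f x y = max x y` and `g p = [p > 0]`. -/
noncomputable def SR.max : SR where
  f x y := Max.max x y
  g p := if 0 < p then 1 else 0
  dom := AddSubmonoid.nonneg ℝ
  assoc := max_assoc
  mono _ _ _ _ h h' := max_le_max h h'
  short_left x x' y := abs_max_sub_max_le_abs x x' y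
  short_right x y y' := by
    rw [max_comm x y, max_comm x y']
    exact abs_max_sub_max_le_abs y y' x
  f_mem x hx y _ := le_trans (show (0 : ℝ) ≤ x from hx) (le_max_left x y)
  zero_left x hx := max_eq_right hx
  zero_right x hx := max_eq_left hx
  g_mem p _ := by split_ifs <;> simp
  g_zero := by simp
  g_one := by simp
  short_fold n p x y d _ h1 h := by
    have hd : 0 ≤ d := by
      rcases n with _ | n
      · simp at h1
      · exact (abs_nonneg _).trans (h 0)
    have key : ∀ u v : Fin n → ℝ, (∀ i, |u i - v i| ≤ d) → ∀ i,
        (if 0 < p i then (1 : ℝ) else 0) * u i ≤ (if 0 < p i then (1 : ℝ) else 0) * v i + d := by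
      intro u v huv i
      have := (abs_le.1 (huv i)).2
      split_ifs <;> linarith
    have h2 := fold_max_le _ _ d hd (key x y h)
    have h3 := fold_max_le _ _ d hd (key y x fun i => by rw [abs_sub_comm]; exact h i)
    exact abs_le.2 ⟨by linarith, by linarith⟩

/-! ### Constraints and polynomial-time approximation -/

/-- The three kinds of constraints. -/
inductive ConstraintKind : Type
  | expectation
  | almostSure
  | chance

namespace ConstraintKind

/-- The constraint of the given kind on the accumulated `i`-th cost, with budget `B` and, for a
chance constraint, tolerance `δ`. -/
def Holds (K : ConstraintKind) {m : ℕ} (M : CaMDP m) (i : Fin m) (B δ : ℚ) (π : M.Policy) : Prop :=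
  match K with
  | .expectation => M.expect π (fun τ => (M.totalCost i τ : ℝ)) ≤ (B : ℝ)
  | .almostSure => M.prob π {τ | M.totalCost i τ ≤ B} = 1
  | .chance => M.prob π {τ | B < M.totalCost i τ} ≤ (δ : ℝ)

/-- The shortly recursive criterion that models a kind of constraint. The probability in a chance
constraint is the expected cost of a process with indicator costs. -/
noncomputable def sr : ConstraintKind → SR
  | .expectation => SR.sum
  | .almostSure => SR.max
  | .chance => SR.sum

end ConstraintKind

/-- Polynomial-time approximability of a family of constrained problems: maximize the value over
the policies `π` of the class `cls` with `Sat M θ 0 π`. The instances are the processes `M` with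
`Adm M`, together with parameters `θ` and an accuracy `ε ∈ E`, and `Sat M θ ε` is
the constraint relaxed by `ε`.

There is an algorithm `alg` that, on each instance, either correctly reports that it is infeasible
(output `0`) or outputs a description `w` of a policy of the class which satisfies the
relaxed constraint and has value at least `V* - ε`; the policy is evaluated on histories,
from `w`, by the program `ev`. Both programs run in time polynomial in the size of their
input, `1 / ε` and the bound `R` on the range of the costs. -/
def PolyTimeApprox (cls : PolicyClass) {m : ℕ} {Θ : Type} (code : Θ → Data)
    (Adm : CaMDP m → Prop) (Sat : (M : CaMDP m) → Θ → ℚ → M.Policy → Prop) (E : Set ℚ) : Prop :=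
  ∃ (alg ev : Prog) (p : Polynomial ℕ),
    ∀ (M : CaMDP m) (θ : Θ) (ε : ℚ) (R : ℕ), Adm M → ε ∈ E → M.CostRangeLE R →
      let x : Data := .pair M.code (.pair (code θ) (.num ε))
      let N : ℕ := x.size + ⌈1 / ε⌉₊ + R
      ∃ (out : Data) (t : ℕ), Run alg x out t ∧ t ≤ p.eval N ∧
        ((out = .num 0 ∧ ¬ ∃ π : M.Policy, M.InClass cls π ∧ Sat M θ 0 π) ∨
          ∃ w : Data, out = .pair (.num 1) w ∧
            ∃ π : M.Policy, M.InClass cls π ∧ M.Evaluates ev w (fun n => p.eval (N + n)) π ∧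
              Sat M θ ε π ∧
              M.optValue cls (Sat M θ 0) ≤ ((M.value π + (ε : ℝ) : ℝ) : EReal))

/-- A polynomial-time `(ε, ε)`-bicriteria, `ε ∈ E`, for the CMDPs whose `i`-th cost criterion
is the shortly recursive criterion `C i`, with budget vector `B`. -/
def PolyTimeBicriteria (cls : PolicyClass) {m : ℕ} (C : Fin m → SR) (E : Set ℚ) : Prop :=
  PolyTimeApprox cls (m := m) (Θ := Fin m → ℚ) Data.ofVec
    (fun M => ∀ h < M.H, ∀ s a k i, (M.costVal h s a k i : ℝ) ∈ (C i).dom)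
    (fun M B ε π => ∀ i, (C i).cost M i π ≤ (B i : ℝ) + (ε : ℝ)) E

/-- Polynomial-time approximability under the combination `K` of constraints, with budgets
`θ.1` and tolerances `θ.2` (which matter for chance constraints only). -/
def PolyTimeConstrained (cls : PolicyClass) {m : ℕ} (K : Fin m → ConstraintKind) (E : Set ℚ) :
    Prop :=
  PolyTimeApprox cls (m := m) (Θ := (Fin m → ℚ) × (Fin m → ℚ))
    (fun θ => .pair (.ofVec θ.1) (.ofVec θ.2)) (fun _ => True)
    (fun M θ ε π => ∀ i, (K i).Holds M i (θ.1 i + ε) (θ.2 i + ε) π) E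

end CRL

/-!
The theorem is a reduction that calls the given bicriteria once. From a process `M` with the three
kinds of constraints on accumulated costs one computes a process whose costs, aggregated by the
sum or by the maximum, express these constraints up to `ε`.

A constraint on the distribution of an accumulated cost is not a function of the expected costs,
so the reduced process carries the accumulated cost in its state. Every cost is rounded
down to a multiple of `ε / (2 (H + 1))` above a common lower bound of the costs; the counters of
these multiples take polynomially many values when the range of the costs is polynomial, and the
rounded total differs from the true one by at most `ε / 2`. In addition the state carries
the index of the last cost outcome, so that the histories of the reduced process determine those
of `M` and conversely: policies are transported along `Labelling.lift` and `Labelling.lower`, in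
both directions, with the same value (`Labelling.Agree.value_eq`). This is what
preserves the class of deterministic policies.

The costs of the reduced process are deterministic given label, state and action:
* for an expectation constraint, the expected cost;
* for a chance constraint, the expected increment of the indicator that the rounded total is over
  budget; these increments telescope to the probability of that event;
* for an almost-sure constraint, the amounts by which the rounded total can be over budget after the
  step, doubled and summed over the cost outcomes. Doubling leaves room for the rounding: a
  policy of worst-case cost at most `ε` is over budget by at most `ε / 2` in the rounded total. The
  sum serves as well as a maximum, since a feasible policy has all penalties equal to `0`.

An almost-sure budget below `H` times the lower bound of the costs is infeasible for a trivial
reason and excluded at the start (`Input.Plausible`); otherwise the penalties are of polynomial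
size.

The other half of the proof is that this reduction, and the translation of histories used by the
evaluator of the policy, are computed by programs in polynomial time. Functions between types with a
representation as data are shown to be polynomial-time (`PT`) by closure properties: composition,
arithmetic, branching, and loops over lists. The one step that is polynomial in the value and not
in the bit size of a number is the tabulation of the counters (`exists_prog_range`).
-/

namespace CRL

/-! ### Bit sizes -/

theorem poly_eval_mono (p : Polynomial ℕ) {a b : ℕ} (h : a ≤ b) : p.eval a ≤ p.eval b := by
  rw [Polynomial.eval_eq_sum_range, Polynomial.eval_eq_sum_range]
  gcongr

theorem natSize_mul_le (a b : ℕ) : (a * b).size ≤ a.size + b.size := by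
  rw [Nat.size_le, pow_add]
  exact Nat.mul_lt_mul'' (Nat.lt_size_self a) (Nat.lt_size_self b)

theorem natSize_add_le (a b : ℕ) : (a + b).size ≤ max a.size b.size + 1 := by
  rw [Nat.size_le, pow_succ, mul_two]
  exact add_lt_add
    ((Nat.lt_size_self a).trans_le (Nat.pow_le_pow_right two_pos (le_max_left _ _)))
    ((Nat.lt_size_self b).trans_le (Nat.pow_le_pow_right two_pos (le_max_right _ _)))

theorem natSize_le_self (a : ℕ) : a.size ≤ a := by
  rw [Nat.size_le]
  exact Nat.lt_two_pow_self

theorem num_divInt_size_le (a : ℤ) {b : ℤ} (hb : b ≠ 0) :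
    (Rat.divInt a b).num.natAbs.size ≤ a.natAbs.size := by
  apply Nat.size_le_size
  rcases eq_or_ne a 0 with rfl | ha
  · simp
  · exact Nat.le_of_dvd (Int.natAbs_pos.2 ha) (Int.natAbs_dvd_natAbs.2 (Rat.num_dvd a hb))

theorem den_divInt_size_le (a : ℤ) {b : ℤ} (hb : b ≠ 0) :
    (Rat.divInt a b).den.size ≤ b.natAbs.size := by
  apply Nat.size_le_size
  refine Nat.le_of_dvd (Int.natAbs_pos.2 hb) ?_
  have h := Int.natAbs_dvd_natAbs.2 (Rat.den_dvd a b)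
  simpa using h

theorem den_ne_zero_int (q : ℚ) : (q.den : ℤ) ≠ 0 := by exact_mod_cast q.den_ne_zero

theorem num_add_size_le (a b : ℚ) : (a + b).num.natAbs.size ≤
    max (a.num.natAbs.size + b.den.size) (b.num.natAbs.size + a.den.size) + 1 := by
  have h : a + b = Rat.divInt (a.num * b.den + b.num * a.den) (a.den * b.den) := by
    conv_lhs => rw [← Rat.num_divInt_den a, ← Rat.num_divInt_den b]
    rw [Rat.divInt_add_divInt _ _ (den_ne_zero_int a) (den_ne_zero_int b)]
  rw [h]
  refine (num_divInt_size_le _ (mul_ne_zero (den_ne_zero_int a) (den_ne_zero_int b))).trans ?_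
  refine (Nat.size_le_size (Int.natAbs_add_le _ _)).trans ?_
  refine (natSize_add_le _ _).trans ?_
  rw [Int.natAbs_mul, Int.natAbs_mul, Int.natAbs_natCast, Int.natAbs_natCast]
  gcongr <;> exact natSize_mul_le _ _

theorem den_add_size_le (a b : ℚ) : (a + b).den.size ≤ a.den.size + b.den.size :=
  (Nat.size_le_size (Nat.le_of_dvd (Nat.mul_pos a.den_pos b.den_pos) (Rat.add_den_dvd a b))).trans
    (natSize_mul_le _ _)

theorem size_add_le (a b : ℚ) :
    (Data.num (a + b)).size ≤ 2 * (Data.num a).size + 2 * (Data.num b).size := by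
  have h1 := num_add_size_le a b
  have h2 := den_add_size_le a b
  simp only [Data.size]
  omega

theorem size_neg (a : ℚ) : (Data.num (-a)).size = (Data.num a).size := by
  simp [Data.size]

theorem size_mul_le (a b : ℚ) :
    (Data.num (a * b)).size ≤ (Data.num a).size + (Data.num b).size := by
  have h : a * b = Rat.divInt (a.num * b.num) (a.den * b.den) := by
    conv_lhs => rw [← Rat.num_divInt_den a, ← Rat.num_divInt_den b]
    rw [Rat.divInt_mul_divInt]
  have hb := mul_ne_zero (den_ne_zero_int a) (den_ne_zero_int b)
  have h1 := num_divInt_size_le (a.num * b.num) hb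
  have h2 := den_divInt_size_le (a.num * b.num) hb
  rw [← h] at h1 h2
  rw [Int.natAbs_mul] at h1 h2
  have h3 := natSize_mul_le a.num.natAbs b.num.natAbs
  have h4 := natSize_mul_le a.den b.den
  simp only [Int.natAbs_natCast] at h2
  simp only [Data.size]
  omega

theorem size_inv_le (a : ℚ) : (Data.num a⁻¹).size ≤ (Data.num a).size + 1 := by
  rcases eq_or_ne a 0 with rfl | ha
  · simp
  have h : a⁻¹ = Rat.divInt a.den a.num := by
    conv_lhs => rw [← Rat.num_divInt_den a]
    rw [Rat.inv_divInt]
  have hb : a.num ≠ 0 := Rat.num_ne_zero.2 ha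
  have h1 := num_divInt_size_le a.den hb
  have h2 := den_divInt_size_le a.den hb
  rw [← h] at h1 h2
  simp only [Int.natAbs_natCast] at h1
  simp only [Data.size]
  omega

theorem size_floor_le (a : ℚ) : (Data.num (⌊a⌋ : ℚ)).size ≤ (Data.num a).size + 1 := by
  have h1 : ⌊a⌋.natAbs ≤ a.num.natAbs := by
    rw [Rat.floor_def']
    exact Int.natAbs_ediv_le_natAbs _ _
  have h2 := Nat.size_le_size h1
  simp only [Data.size, Rat.num_intCast, Rat.den_intCast, Nat.size_one]
  omega

namespace Data

theorem one_le_size (x : Data) : 1 ≤ x.size := by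
  cases x <;> simp only [Data.size] <;> omega

end Data

/-- An elementary operation at most doubles the size of its argument, up to a constant. -/
theorem Op.size_apply_le (o : Op) : ∃ c, ∀ x : Data, (o.apply x).size ≤ 2 * x.size + c := by
  have h0 : (Data.num 0).size = 2 := by simp [Data.size]
  have h1 : (Data.num 1).size = 3 := by simp [Data.size]
  rcases o with _ | _ | _ | _ | _ | _ | _ | _ | _ | q
  case const => exact ⟨(Data.num q).size, fun x => by simp only [Op.apply]; omega⟩
  all_goals refine ⟨4, fun x => ?_⟩
  · simp only [Op.apply]; omega
  · rcases x with q | ⟨a, b⟩ <;> simp only [Op.apply, Data.size] at * <;> omega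
  · rcases x with q | ⟨a, b⟩ <;> simp only [Op.apply, Data.size] at * <;> omega
  · rcases x with q | ⟨a, b⟩ <;> simp only [Op.apply] <;> omega
  · rcases x with q | ⟨a | _, b | _⟩ <;> simp only [Op.apply]
    case pair.num.num =>
      have := size_add_le a b
      simp only [Data.size] at this ⊢
      omega
    all_goals omega
  · rcases x with q | ⟨a | _, b | _⟩ <;> simp only [Op.apply]
    case pair.num.num =>
      have := size_add_le a (-b)
      rw [size_neg, ← sub_eq_add_neg] at this
      simp only [Data.size] at this ⊢
      omega
    all_goals omega
  · rcases x with q | ⟨a | _, b | _⟩ <;> simp only [Op.apply]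
    case pair.num.num =>
      have := size_mul_le a b
      simp only [Data.size] at this ⊢
      omega
    all_goals omega
  · rcases x with q | ⟨a | _, b | _⟩ <;> simp only [Op.apply]
    case pair.num.num =>
      have := size_mul_le a b⁻¹
      have h := size_inv_le b
      rw [← div_eq_mul_inv] at this
      simp only [Data.size] at this h ⊢
      omega
    all_goals omega
  · rcases x with q | ⟨a, b⟩ <;> simp only [Op.apply]
    · have := size_floor_le q
      omega
    · omega

/-! ### Encodings and polynomial-time functions -/

/-- A type whose elements are represented as data. -/
class Enc (α : Type) where
  /-- the representation -/
  enc : α → Data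

instance : Enc ℚ := ⟨Data.num⟩
instance : Enc ℕ := ⟨fun n => Data.num n⟩
instance {α β : Type} [Enc α] [Enc β] : Enc (α × β) := ⟨fun x => .pair (Enc.enc x.1) (Enc.enc x.2)⟩
instance {α : Type} [Enc α] : Enc (List α) := ⟨fun l => .ofList (l.map Enc.enc)⟩

open Enc

theorem enc_mk {α β : Type} [Enc α] [Enc β] (a : α) (b : β) :
    enc (a, b) = .pair (enc a) (enc b) := rfl

theorem enc_nil {α : Type} [Enc α] : enc ([] : List α) = .num 0 := rfl

theorem enc_cons {α : Type} [Enc α] (a : α) (l : List α) :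
    enc (a :: l) = .pair (enc a) (enc l) := rfl

/-- `f` is computed by a program in time polynomial in the bit size of the argument. The bound on
the size of the value makes the notion compose. -/
@[fun_prop]
def PT {α β : Type} [Enc α] [Enc β] (f : α → β) : Prop :=
  ∃ (P : Prog) (p : Polynomial ℕ), ∀ a, ∃ t, Run P (enc a) (enc (f a)) t ∧
    t ≤ p.eval (enc a).size ∧ (enc (f a)).size ≤ p.eval (enc a).size

section Basic

variable {α β γ : Type} [Enc α] [Enc β] [Enc γ]

/-- An elementary operation is computable in polynomial time under any encodings it respects. -/
theorem PT.of_op (o : Op) (f : α → β) (h : ∀ a, o.apply (enc a) = enc (f a)) : PT f := by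
  obtain ⟨c, hc⟩ := o.size_apply_le
  refine ⟨.op o, 2 * .X + 1 + .C c, fun a => ⟨1 + (enc a).size, ?_, ?_, ?_⟩⟩
  · rw [← h]
    exact .op o _
  · simp
    omega
  · have := hc (enc a)
    rw [← h]
    simp
    omega

@[fun_prop]
theorem PT.id : PT (fun a : α => a) := .of_op .id _ fun _ => rfl

theorem Prog.exists_const (d : Data) : ∃ (P : Prog) (c : ℕ), ∀ x, ∃ t, Run P x d t ∧
    t ≤ c * (x.size + 1) := by
  induction d with
  | num q => exact ⟨.op (.const q), 1, fun x => ⟨_, .op _ x, by omega⟩⟩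
  | pair a b iha ihb =>
    obtain ⟨P, c, hP⟩ := iha
    obtain ⟨Q, d, hQ⟩ := ihb
    refine ⟨.pair P Q, 1 + c + d, fun x => ?_⟩
    obtain ⟨s, hs, hs'⟩ := hP x
    obtain ⟨t, ht, ht'⟩ := hQ x
    refine ⟨_, .pair hs ht, ?_⟩
    ring_nf at *
    omega

@[fun_prop]
theorem PT.const (b : β) : PT (fun _ : α => b) := by
  obtain ⟨P, c, hP⟩ := Prog.exists_const (enc b)
  refine ⟨P, .C c * (.X + 1) + .C (enc b).size, fun a => ?_⟩
  obtain ⟨t, ht, ht'⟩ := hP (enc a)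
  exact ⟨t, ht, by simp; omega, by simp⟩

@[fun_prop]
theorem PT.comp {g : β → γ} {f : α → β} (hg : PT g) (hf : PT f) : PT (fun a => g (f a)) := by
  obtain ⟨P, p, hP⟩ := hf
  obtain ⟨Q, q, hQ⟩ := hg
  refine ⟨.comp P Q, 1 + p + q.comp p, fun a => ?_⟩
  obtain ⟨s, hs, hs', hs''⟩ := hP a
  obtain ⟨t, ht, ht', ht''⟩ := hQ (f a)
  have h := poly_eval_mono q hs''
  exact ⟨_, .comp hs ht, by simp; omega, by simp; omega⟩

@[fun_prop]
theorem PT.prodMk {f : α → β} {g : α → γ} (hf : PT f) (hg : PT g) :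
    PT (fun a => (f a, g a)) := by
  obtain ⟨P, p, hP⟩ := hf
  obtain ⟨Q, q, hQ⟩ := hg
  refine ⟨.pair P Q, 1 + p + q, fun a => ?_⟩
  obtain ⟨s, hs, hs', hs''⟩ := hP a
  obtain ⟨t, ht, ht', ht''⟩ := hQ a
  refine ⟨_, .pair hs ht, by simp; omega, ?_⟩
  rw [enc_mk, Data.size]
  simp
  omega

@[fun_prop]
theorem PT.fst {f : α → β × γ} (hf : PT f) : PT (fun a => (f a).1) :=
  .comp (.of_op .fst Prod.fst fun _ => rfl) hf

@[fun_prop]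
theorem PT.snd {f : α → β × γ} (hf : PT f) : PT (fun a => (f a).2) :=
  .comp (.of_op .snd Prod.snd fun _ => rfl) hf

@[fun_prop]
theorem PT.add {f g : α → ℚ} (hf : PT f) (hg : PT g) : PT (fun a => f a + g a) :=
  .comp (g := fun x : ℚ × ℚ => x.1 + x.2) (.of_op .add _ fun _ => rfl) (.prodMk hf hg)

@[fun_prop]
theorem PT.sub {f g : α → ℚ} (hf : PT f) (hg : PT g) : PT (fun a => f a - g a) :=
  .comp (g := fun x : ℚ × ℚ => x.1 - x.2) (.of_op .sub _ fun _ => rfl) (.prodMk hf hg)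

@[fun_prop]
theorem PT.mul {f g : α → ℚ} (hf : PT f) (hg : PT g) : PT (fun a => f a * g a) :=
  .comp (g := fun x : ℚ × ℚ => x.1 * x.2) (.of_op .mul _ fun _ => rfl) (.prodMk hf hg)

@[fun_prop]
theorem PT.div {f g : α → ℚ} (hf : PT f) (hg : PT g) : PT (fun a => f a / g a) :=
  .comp (g := fun x : ℚ × ℚ => x.1 / x.2) (.of_op .div _ fun _ => rfl) (.prodMk hf hg)

@[fun_prop]
theorem PT.neg {f : α → ℚ} (hf : PT f) : PT (fun a => -f a) := by
  simpa using PT.sub (PT.const (α := α) (0 : ℚ)) hf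

@[fun_prop]
theorem PT.natCast {f : α → ℕ} (hf : PT f) : PT (fun a => (f a : ℚ)) :=
  .comp (g := fun n : ℕ => (n : ℚ)) (.of_op .id _ fun _ => rfl) hf

@[fun_prop]
theorem PT.natAdd {f g : α → ℕ} (hf : PT f) (hg : PT g) : PT (fun a => f a + g a) :=
  .comp (g := fun x : ℕ × ℕ => x.1 + x.2)
    (.of_op .add _ fun x => by simp [enc, Op.apply]) (.prodMk hf hg)

@[fun_prop]
theorem PT.natMul {f g : α → ℕ} (hf : PT f) (hg : PT g) : PT (fun a => f a * g a) :=
  .comp (g := fun x : ℕ × ℕ => x.1 * x.2)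
    (.of_op .mul _ fun x => by simp [enc, Op.apply]) (.prodMk hf hg)

/-- The condition `c` is decidable in polynomial time. -/
def PTPred (c : α → Prop) : Prop := ∃ f : α → ℚ, PT f ∧ ∀ a, c a ↔ 0 < f a

theorem PT.ite {c : α → Prop} [∀ a, Decidable (c a)] {f g : α → β} (hc : PTPred c) (hf : PT f)
    (hg : PT g) : PT (fun a => if c a then f a else g a) := by
  obtain ⟨e, he, hce⟩ := hc
  obtain ⟨C, r, hC⟩ := he
  obtain ⟨P, p, hP⟩ := hf
  obtain ⟨Q, q, hQ⟩ := hg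
  refine ⟨.ite C P Q, 1 + r + p + q, fun a => ?_⟩
  obtain ⟨u, hu, hu', hu''⟩ := hC a
  obtain ⟨s, hs, hs', hs''⟩ := hP a
  obtain ⟨t, ht, ht', ht''⟩ := hQ a
  by_cases h : c a
  · simp only [if_pos h]
    exact ⟨_, .ite_pos hu ((hce a).1 h) hs, by simp; omega, by simp; omega⟩
  · simp only [if_neg h]
    exact ⟨_, .ite_neg hu (fun h' => h ((hce a).2 h')) ht, by simp; omega, by simp; omega⟩

theorem PTPred.lt {f g : α → ℚ} (hf : PT f) (hg : PT g) : PTPred (fun a => f a < g a) :=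
  ⟨_, .sub hg hf, fun a => by simp⟩

theorem PTPred.not {c : α → Prop} (hc : PTPred c) : PTPred (fun a => ¬ c a) := by
  classical
  refine ⟨fun a => if c a then 0 else 1, .ite hc (.const _) (.const _), fun a => ?_⟩
  by_cases h : c a <;> simp [h]

theorem PTPred.and {c d : α → Prop} (hc : PTPred c) (hd : PTPred d) :
    PTPred (fun a => c a ∧ d a) := by
  classical
  refine ⟨fun a => if c a then (if d a then 1 else 0) else 0,
    .ite hc (.ite hd (.const _) (.const _)) (.const _), fun a => ?_⟩
  by_cases h : c a <;> by_cases h' : d a <;> simp [h, h']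

theorem PTPred.le {f g : α → ℚ} (hf : PT f) (hg : PT g) : PTPred (fun a => f a ≤ g a) := by
  simpa using (PTPred.lt hg hf).not

theorem PTPred.eq {f g : α → ℚ} (hf : PT f) (hg : PT g) : PTPred (fun a => f a = g a) := by
  simpa [le_antisymm_iff] using (PTPred.le hf hg).and (.le hg hf)

theorem PTPred.natEq {f g : α → ℕ} (hf : PT f) (hg : PT g) : PTPred (fun a => f a = g a) := by
  simpa using PTPred.eq hf.natCast hg.natCast

theorem PTPred.const (c : Prop) : PTPred (fun _ : α => c) := by
  classical
  exact ⟨fun _ => if c then 1 else 0, .const _, fun a => by by_cases h : c <;> simp [h]⟩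

theorem PTPred.forall_fin {m : ℕ} {c : Fin m → α → Prop} (hc : ∀ i, PTPred (c i)) :
    PTPred (fun a => ∀ i, c i a) := by
  induction m with
  | zero => simpa using PTPred.const (α := α) True
  | succ m ih =>
    simp only [Fin.forall_fin_succ]
    exact (hc 0).and (ih fun i => hc i.succ)

@[fun_prop]
theorem PT.natMin {f g : α → ℕ} (hf : PT f) (hg : PT g) : PT (fun a => min (f a) (g a)) := by
  have h := PT.ite (PTPred.le hf.natCast hg.natCast) hf hg
  simpa only [min_def, Nat.cast_le] using h

@[fun_prop]
theorem PT.max {f g : α → ℚ} (hf : PT f) (hg : PT g) : PT (fun a => max (f a) (g a)) := by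
  have h := PT.ite (PTPred.le hf hg) hg hf
  simpa only [max_def] using h

@[fun_prop]
theorem PT.abs {f : α → ℚ} (hf : PT f) : PT (fun a => |f a|) := by
  simpa only [abs_eq_max_neg] using PT.max hf hf.neg

theorem PT.floor_cast {f : α → ℚ} (hf : PT f) : PT (fun a => (⌊f a⌋ : ℚ)) :=
  .comp (g := fun x : ℚ => (⌊x⌋ : ℚ)) (.of_op .floor _ fun _ => rfl) hf

/-- A natural-number valued function has the same representation as its rational version. -/
theorem PT.of_natCast {f : α → ℕ} (hf : PT (fun a => (f a : ℚ))) : PT f := hf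

@[fun_prop]
theorem PT.natFloor {f : α → ℚ} (hf : PT f) : PT (fun a => ⌊f a⌋₊) := by
  refine .of_natCast ?_
  have h : (fun a => ((⌊f a⌋₊ : ℕ) : ℚ)) = fun a => Max.max (⌊f a⌋ : ℚ) 0 := by
    funext a
    rcases le_total 0 (f a) with h | h
    · rw [← natCast_floor_eq_intCast_floor h, max_eq_left (Nat.cast_nonneg _)]
    · rw [Nat.floor_of_nonpos h, Nat.cast_zero, max_eq_right]
      exact_mod_cast Int.floor_nonpos h
  rw [h]
  exact .max hf.floor_cast (.const 0)

@[fun_prop]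
theorem PT.cons {f : α → β} {g : α → List β} (hf : PT f) (hg : PT g) :
    PT (fun a => f a :: g a) :=
  .comp (g := fun x : β × List β => x.1 :: x.2) (.of_op .id _ fun _ => rfl) (.prodMk hf hg)

@[fun_prop]
theorem PT.tail {f : α → List β} (hf : PT f) : PT (fun a => (f a).tail) :=
  .comp (g := List.tail) (.of_op .snd _ fun l => by cases l <;> rfl) hf

/-- The first entry of a list is computable when the default value is represented by `0`, the
result of a projection that does not apply. -/
theorem PT.headD {f : α → List β} (hf : PT f) (d : β) (hd : enc d = .num 0) :
    PT (fun a => (f a).headD d) :=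
  .comp (g := fun l => List.headD l d)
    (.of_op .fst _ fun l => by
      cases l
      · exact hd.symm
      · rfl) hf

theorem PT.getD {f : α → List β} (hf : PT f) (i : ℕ) (d : β) (hd : enc d = .num 0) :
    PT (fun a => (f a).getD i d) := by
  induction i generalizing f with
  | zero =>
    have h := PT.headD hf d hd
    refine (congrArg PT (funext fun a => ?_)).mp h
    cases f a <;> rfl
  | succ i ih =>
    refine (congrArg PT (funext fun a => ?_)).mp (ih hf.tail)
    cases f a <;> simp

@[fun_prop]
theorem PT.getD_rat {f : α → List ℚ} (hf : PT f) (i : ℕ) : PT (fun a => (f a).getD i 0) :=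
  hf.getD i 0 rfl

@[fun_prop]
theorem PT.getD_nat {f : α → List ℕ} (hf : PT f) (i : ℕ) : PT (fun a => (f a).getD i 0) :=
  hf.getD i 0 rfl

theorem PT.ofFn {m : ℕ} {f : Fin m → α → β} (hf : ∀ i, PT (f i)) :
    PT (fun a => List.ofFn fun i => f i a) := by
  induction m with
  | zero => simpa using PT.const (α := α) ([] : List β)
  | succ m ih =>
    simp only [List.ofFn_succ]
    exact (hf 0).cons (ih fun i => hf i.succ)

end Basic

/-! ### Loops over lists -/

/-- `P` halts on `x` with output `y` within time `t`. -/
def RunLe (P : Prog) (x y : Data) (t : ℕ) : Prop := ∃ s ≤ t, Run P x y s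

theorem RunLe.op {o : Op} {x y : Data} (h : o.apply x = y) : RunLe (.op o) x y (1 + x.size) :=
  ⟨_, le_rfl, h ▸ .op o x⟩

theorem RunLe.pair {P Q : Prog} {x a b : Data} {s t : ℕ} (hP : RunLe P x a s)
    (hQ : RunLe Q x b t) : RunLe (.pair P Q) x (.pair a b) (1 + s + t) := by
  obtain ⟨s', hs, hP⟩ := hP
  obtain ⟨t', ht, hQ⟩ := hQ
  exact ⟨_, by omega, .pair hP hQ⟩

theorem RunLe.comp {P Q : Prog} {x y z : Data} {s t : ℕ} (hP : RunLe P x y s)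
    (hQ : RunLe Q y z t) : RunLe (.comp P Q) x z (1 + s + t) := by
  obtain ⟨s', hs, hP⟩ := hP
  obtain ⟨t', ht, hQ⟩ := hQ
  exact ⟨_, by omega, .comp hP hQ⟩

theorem RunLe.ite_pos {C P Q : Prog} {x v y : Data} {s t : ℕ} (hC : RunLe C x v s)
    (hv : v.Pos) (hP : RunLe P x y t) : RunLe (.ite C P Q) x y (1 + s + t) := by
  obtain ⟨s', hs, hC⟩ := hC
  obtain ⟨t', ht, hP⟩ := hP
  exact ⟨_, by omega, .ite_pos hC hv hP⟩

theorem RunLe.ite_neg {C P Q : Prog} {x v y : Data} {s t : ℕ} (hC : RunLe C x v s)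
    (hv : ¬ v.Pos) (hQ : RunLe Q x y t) : RunLe (.ite C P Q) x y (1 + s + t) := by
  obtain ⟨s', hs, hC⟩ := hC
  obtain ⟨t', ht, hQ⟩ := hQ
  exact ⟨_, by omega, .ite_neg hC hv hQ⟩

theorem RunLe.mono {P : Prog} {x y : Data} {s t : ℕ} (hP : RunLe P x y s) (h : s ≤ t) :
    RunLe P x y t := by
  obtain ⟨s', hs, hP⟩ := hP
  exact ⟨s', hs.trans h, hP⟩

/-- A loop that passes through the states `st 0, …, st k`, each test and each pass taking time at
most `B`. -/
theorem RunLe.while {C P : Prog} {B : ℕ} (k : ℕ) (st : ℕ → Data)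
    (hc : ∀ i < k, ∃ v, RunLe C (st i) v B ∧ v.Pos)
    (hb : ∀ i < k, RunLe P (st i) (st (i + 1)) B)
    (he : ∃ v, RunLe C (st k) v B ∧ ¬ v.Pos) :
    RunLe (.while C P) (st 0) (st k) ((k + 1) * (2 * B + 1)) := by
  induction k generalizing st with
  | zero =>
    obtain ⟨v, ⟨s, hs, hC⟩, hv⟩ := he
    exact ⟨_, by omega, Run.while_stop hC hv⟩
  | succ k ih =>
    obtain ⟨v, ⟨s, hs, hC⟩, hv⟩ := hc 0 k.succ_pos
    obtain ⟨t, ht, hP⟩ := hb 0 k.succ_pos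
    obtain ⟨u, hu, hW⟩ := ih (fun i => st (i + 1)) (fun i hi => hc (i + 1) (by omega))
      (fun i hi => hb (i + 1) (by omega)) he
    refine ⟨_, ?_, .while_step hC hv hP hW⟩
    rw [add_mul (k + 1) 1]
    omega

section Lists

variable {α β γ : Type} [Enc α] [Enc β] [Enc γ]

theorem length_le_size (l : List α) : l.length + 1 ≤ (enc l).size := by
  induction l with
  | nil => exact Data.one_le_size _
  | cons a l ih =>
    rw [enc_cons, Data.size, List.length_cons]
    omega

theorem size_drop_le (l : List α) (i : ℕ) : (enc (l.drop i)).size ≤ (enc l).size := by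
  induction i generalizing l with
  | zero => rfl
  | succ i ih =>
    cases l with
    | nil => rfl
    | cons a l =>
      refine (ih l).trans ?_
      rw [enc_cons, Data.size]
      omega

theorem size_append (l l' : List α) :
    (enc (l ++ l')).size + 2 = (enc l).size + (enc l').size := by
  induction l with
  | nil =>
    simp [enc_nil, Data.size]
    omega
  | cons a l ih =>
    rw [List.cons_append, enc_cons, enc_cons, Data.size, Data.size]
    omega

theorem size_le_of_mem {l : List α} {a : α} (h : a ∈ l) : (enc a).size + 1 ≤ (enc l).size := by
  induction l with
  | nil => simp at h
  | cons b l ih =>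
    rw [enc_cons, Data.size]
    have := Data.one_le_size (enc l)
    rcases List.mem_cons.1 h with rfl | h
    · omega
    · have := ih h
      omega

/-- A list of at most `k` entries, each of size at most `B`. -/
theorem size_list_le {l : List α} {k B : ℕ} (hk : l.length ≤ k)
    (hB : ∀ a ∈ l, (enc a).size ≤ B) : (enc l).size ≤ 2 + k * (B + 1) := by
  induction l generalizing k with
  | nil => simp [enc_nil, Data.size]
  | cons a l ih =>
    obtain ⟨k, rfl⟩ : ∃ j, k = j + 1 := ⟨k - 1, by simp at hk; omega⟩
    have h1 := ih (k := k) (by simpa using hk) fun b hb => hB b (.tail _ hb)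
    have h2 := hB a (.head _)
    rw [enc_cons, Data.size, add_mul]
    omega

theorem size_reverse (l : List α) : (enc l.reverse).size = (enc l).size := by
  induction l with
  | nil => rfl
  | cons a l ih =>
    have := size_append l.reverse [a]
    rw [List.reverse_cons, enc_cons, Data.size]
    rw [enc_cons, enc_nil, Data.size, Data.size] at this
    simp at this
    omega

theorem PT.exists_runLe {f : α → β} (hf : PT f) : ∃ (P : Prog) (p : Polynomial ℕ),
    ∀ a, RunLe P (enc a) (enc (f a)) (p.eval (enc a).size) ∧
      (enc (f a)).size ≤ p.eval (enc a).size := by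
  obtain ⟨P, p, hP⟩ := hf
  refine ⟨P, p, fun a => ?_⟩
  obtain ⟨t, ht, ht', hs⟩ := hP a
  exact ⟨⟨t, ht', ht⟩, hs⟩

/-- Loops over a list run in polynomial time if the accumulated values stay of polynomial size. -/
theorem PT.foldl {l : α → List β} {init : α → γ} {step : α → γ → β → γ} (hl : PT l)
    (hi : PT init) (hs : PT fun x : α × γ × β => step x.1 x.2.1 x.2.2) (q : Polynomial ℕ)
    (hq : ∀ a i, (enc (((l a).take i).foldl (step a) (init a))).size ≤ q.eval (enc a).size) :
    PT fun a => (l a).foldl (step a) (init a) := by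
  obtain ⟨PL, pl, hPL⟩ := hl.exists_runLe
  obtain ⟨PI, pi, hPI⟩ := hi.exists_runLe
  obtain ⟨PS, ps, hPS⟩ := hs.exists_runLe
  -- The state of the loop is the argument, the rest of the list, and the accumulated value.
  let rest : Prog := .comp (.op .snd) (.op .fst)
  let acc : Prog := .comp (.op .snd) (.op .snd)
  let body : Prog := .pair (.op .fst) (.pair (.comp rest (.op .snd))
    (.comp (.pair (.op .fst) (.pair acc (.comp rest (.op .fst)))) PS))
  let S : Polynomial ℕ := 2 + .X + pl + q
  let B : Polynomial ℕ := 50 * (1 + S) + ps.comp S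
  refine ⟨.comp (.pair (.op .id) (.pair PL PI))
    (.comp (.while (.comp rest (.op .isPair)) body) acc),
    20 * (1 + S) + pl + pi + (pl + 1) * (2 * B + 1), fun a => ?_⟩
  let st : ℕ → Data := fun i => .pair (enc a) (.pair (enc ((l a).drop i))
    (enc (((l a).take i).foldl (step a) (init a))))
  obtain ⟨hl, hls⟩ := hPL a
  obtain ⟨hi, his⟩ := hPI a
  have hq := hq a
  set n := (enc a).size with hn
  have hSe : S.eval n = 2 + n + pl.eval n + q.eval n := by simp [S]
  have hst : ∀ i, (st i).size ≤ S.eval n := fun i => by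
    have h1 := size_drop_le (l a) i
    have h2 := hq i
    simp only [st, Data.size]
    omega
  have hBe : B.eval n = 50 * (1 + S.eval n) + ps.eval (S.eval n) := by simp [B]
  have hlen : (l a).length ≤ pl.eval n := by
    have := length_le_size (l a)
    omega
  have htest : ∀ i, RunLe (.comp rest (.op .isPair)) (st i)
      (Op.apply .isPair (enc ((l a).drop i))) (B.eval n) := fun i => by
    have h := hst i
    refine (RunLe.comp (.comp (.op rfl) (.op rfl)) (.op rfl)).mono ?_
    simp only [st, Data.size, Op.apply] at h ⊢
    omega
  have hW := RunLe.while (C := .comp rest (.op .isPair)) (P := body) (B := B.eval n)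
    (l a).length st (fun i hi => ⟨_, htest i, ?_⟩) (fun i hi => ?_) ⟨_, htest _, ?_⟩
  · have hrun : RunLe (.comp (.pair (.op .id) (.pair PL PI))
        (.comp (.while (.comp rest (.op .isPair)) body) acc)) (enc a)
        (enc ((l a).foldl (step a) (init a))) _ :=
      .comp (.pair (.op rfl) (.pair hl hi)) (.comp hW (.comp (.op rfl) (.op ?_)))
    · obtain ⟨t, ht, hr⟩ := hrun
      refine ⟨t, hr, ht.trans ?_, ?_⟩
      · have h := hst (l a).length
        have h2 := Nat.mul_le_mul_right (2 * B.eval n + 1) (Nat.add_le_add_right hlen 1)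
        simp only [st, Data.size, Op.apply] at h h2 ⊢
        simp at h ⊢
        omega
      · have h := hq (l a).length
        rw [List.take_length] at h
        simp
        omega
    · simp [st, Op.apply]
  · have hd : (l a).drop i = (l a)[i] :: (l a).drop (i + 1) := List.drop_eq_getElem_cons hi
    rw [hd]
    exact one_pos
  · have hd : (l a).drop i = (l a)[i] :: (l a).drop (i + 1) := List.drop_eq_getElem_cons hi
    obtain ⟨hS, -⟩ := hPS (a, ((l a).take i).foldl (step a) (init a), (l a)[i])
    have hn : st (i + 1) = .pair (enc a) (.pair (enc ((l a).drop (i + 1)))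
        (enc (step a (((l a).take i).foldl (step a) (init a)) (l a)[i]))) := by
      simp only [st, List.take_succ_eq_append_getElem hi, List.foldl_append, List.foldl_cons,
        List.foldl_nil]
    have h := hst i
    simp only [st, hd] at h
    rw [hn]
    simp only [st, hd]
    refine (RunLe.pair (.op rfl) (.pair (.comp (.comp (.op rfl) (.op rfl)) (.op rfl))
      (.comp (.pair (.op rfl) (.pair (.comp (.op rfl) (.op rfl))
        (.comp (.comp (.op rfl) (.op rfl)) (.op rfl)))) hS))).mono ?_
    have hmono := poly_eval_mono ps (a := (enc (a, ((l a).take i).foldl (step a) (init a),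
      (l a)[i])).size) (b := S.eval n) (by
        simp only [enc_mk, enc_cons, Data.size] at h ⊢
        omega)
    simp only [enc_cons, Data.size, Op.apply] at h hmono ⊢
    omega
  · rw [List.drop_length]
    exact lt_irrefl _

end Lists

/-! ### Polynomial-time list functions -/

/-- The entries of a list, each with the list of the entries that follow it. -/
def suffixes {α : Type} : List α → List (α × List α)
  | [] => []
  | a :: l => (a, l) :: suffixes l

/-- The entry with index `n` as a list of at most one element. -/
def pick {α : Type} (l : List α) (n : ℕ) : List α :=
  l.zipIdx.flatMap fun x => if x.2 = n then [x.1] else []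

theorem foldl_cons_eq {β γ : Type} (f : β → γ) (l : List β) (acc : List γ) :
    l.foldl (fun acc e => f e :: acc) acc = (l.map f).reverse ++ acc := by
  induction l generalizing acc with
  | nil => rfl
  | cons a l ih => simp [ih]

theorem pick_eq {α : Type} (l : List α) (n : ℕ) : pick l n = l[n]?.toList := by
  have key : ∀ (l : List α) (k : ℕ), ((l.zipIdx k).flatMap fun x =>
      if x.2 = k + n then [x.1] else []) = l[n]?.toList := by
    induction n with
    | zero =>
      intro l k
      cases l with
      | nil => simp
      | cons a l =>
        have h : ∀ (l : List α) (j : ℕ), k < j → ((l.zipIdx j).flatMap fun x =>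
            if x.2 = k then [x.1] else []) = [] := by
          intro l
          induction l with
          | nil => simp
          | cons b l ih => intro j hj; simp [hj.ne', ih (j + 1) (by omega)]
        simp [h l (k + 1) (by omega)]
    | succ n ih =>
      intro l k
      cases l with
      | nil => simp
      | cons a l => simpa [add_assoc, add_comm 1] using ih l (k + 1)
  simpa [pick] using key l 0

section Lists

variable {α β γ : Type} [Enc α] [Enc β] [Enc γ]

theorem PT.exists_size_le {f : α → β} (hf : PT f) :
    ∃ q : Polynomial ℕ, ∀ a, (enc (f a)).size ≤ q.eval (enc a).size := by
  obtain ⟨P, p, hP⟩ := hf.exists_runLe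
  exact ⟨p, fun a => (hP a).2⟩

theorem size_take_le (l : List α) (i : ℕ) : (enc (l.take i)).size ≤ (enc l).size := by
  have h := size_append (l.take i) (l.drop i)
  rw [List.take_append_drop] at h
  have := length_le_size (l.drop i)
  have : 2 ≤ (enc (l.drop i)).size := by
    cases l.drop i with
    | nil => simp [enc_nil, Data.size]
    | cons a l =>
      have := Data.one_le_size (enc a)
      rw [enc_cons, Data.size]
      omega
  omega

theorem size_flatten_le (l : List (List α)) : (enc l.flatten).size ≤ (enc l).size := by
  induction l with
  | nil => rfl
  | cons a l ih =>
    have := size_append a l.flatten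
    rw [List.flatten_cons, enc_cons, Data.size]
    omega

theorem size_nat_le (n : ℕ) : (enc n).size ≤ n + 2 := by
  have := natSize_le_self n
  simp only [enc, Data.size, Rat.num_natCast, Int.natAbs_natCast, Rat.den_natCast, Nat.size_one]
  omega

theorem PT.reverseAux {f g : α → List β} (hf : PT f) (hg : PT g) :
    PT fun a => (f a).reverse ++ g a := by
  obtain ⟨p, hp⟩ := hf.exists_size_le
  obtain ⟨q, hq⟩ := hg.exists_size_le
  have h := PT.foldl (step := fun _ acc e => e :: acc) hf hg (by fun_prop) (p + q) fun a i => by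
    have h1 := foldl_cons_eq (fun e => e) ((f a).take i) (g a)
    have h2 := size_append ((f a).take i).reverse (g a)
    have h3 := size_take_le (f a) i
    have h4 := hp a
    have h5 := hq a
    rw [size_reverse] at h2
    simp only [List.map_id'] at h1
    rw [h1, Polynomial.eval_add]
    omega
  simpa only [foldl_cons_eq, List.map_id'] using h

@[fun_prop]
theorem PT.reverse {f : α → List β} (hf : PT f) : PT fun a => (f a).reverse := by
  simpa using hf.reverseAux (.const (α := α) ([] : List β))

@[fun_prop]
theorem PT.append {f g : α → List β} (hf : PT f) (hg : PT g) : PT fun a => f a ++ g a := by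
  simpa using hf.reverse.reverseAux hg

@[fun_prop]
theorem PT.map {l : α → List β} {f : α → β → γ} (hl : PT l)
    (hf : PT fun x : α × β => f x.1 x.2) : PT fun a => (l a).map (f a) := by
  obtain ⟨p, hp⟩ := hl.exists_size_le
  obtain ⟨q, hq⟩ := hf.exists_size_le
  have h := PT.foldl (step := fun a acc e => f a e :: acc) hl (.const []) (by fun_prop)
    (2 + p * (q.comp (1 + .X + p) + 1)) fun a i => by
      rw [foldl_cons_eq, List.append_nil, size_reverse]
      have h := hp a
      refine (size_list_le (k := p.eval (enc a).size)
        (B := q.eval (1 + (enc a).size + p.eval (enc a).size)) ?_ ?_).trans (by simp)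
      · have := length_le_size (l a)
        simp
        omega
      · intro c hc
        obtain ⟨b, hb, rfl⟩ := List.mem_map.1 hc
        refine (hq (a, b)).trans (poly_eval_mono q ?_)
        have := size_le_of_mem (List.mem_of_mem_take hb)
        simp only [enc_mk, Data.size]
        omega
  simp only [foldl_cons_eq, List.append_nil] at h
  simpa using h.reverse

@[fun_prop]
theorem PT.flatten {l : α → List (List β)} (hl : PT l) : PT fun a => (l a).flatten := by
  obtain ⟨p, hp⟩ := hl.exists_size_le
  have key : ∀ (l : List (List β)) (acc : List β),
      l.foldl (fun acc e => e.reverse ++ acc) acc = l.flatten.reverse ++ acc := by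
    intro l
    induction l with
    | nil => simp
    | cons a l ih => simp [ih]
  have h := PT.foldl (step := fun _ acc e => e.reverse ++ acc) hl (.const []) (by fun_prop) p
    fun a i => by
      rw [key, List.append_nil, size_reverse]
      exact ((size_flatten_le _).trans (size_take_le _ _)).trans (hp a)
  simp only [key, List.append_nil] at h
  simpa using h.reverse

@[fun_prop]
theorem PT.flatMap {l : α → List β} {f : α → β → List γ} (hl : PT l)
    (hf : PT fun x : α × β => f x.1 x.2) : PT fun a => (l a).flatMap (f a) := by
  simpa only [List.flatMap_def] using (hl.map hf).flatten

/-- Denominators multiply along a sum, so the bit sizes of the partial sums grow additively. -/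
theorem size_foldl_add_le (l : List ℚ) (q : ℚ) :
    max (l.foldl (· + ·) q).num.natAbs.size (l.foldl (· + ·) q).den.size ≤
      max q.num.natAbs.size q.den.size + (enc l).size := by
  induction l generalizing q with
  | nil => simp
  | cons x l ih =>
    refine (ih (q + x)).trans ?_
    have h1 := num_add_size_le q x
    have h2 := den_add_size_le q x
    simp only [enc, List.map_cons, Data.ofList, Data.size]
    omega

/-- A single addition may double the bit size, but the partial sums of a list stay of linear size. -/
@[fun_prop]
theorem PT.sum {l : α → List ℚ} (hl : PT l) : PT fun a => (l a).sum := by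
  obtain ⟨p, hp⟩ := hl.exists_size_le
  have h := PT.foldl (step := fun _ acc e => acc + e) hl (.const 0) (by fun_prop) (2 * p + 3)
    fun a i => by
      have h1 := size_foldl_add_le ((l a).take i) 0
      have h2 := size_take_le (l a) i
      have h3 := hp a
      simp only [Rat.num_zero, Rat.den_zero, Int.natAbs_zero, Nat.size_zero, Nat.size_one] at h1
      change Data.size (.num _) ≤ _
      simp only [Data.size]
      simp
      omega
  simpa only [← List.sum_eq_foldl] using h

@[fun_prop]
theorem PT.natSum {l : α → List ℕ} (hl : PT l) : PT fun a => (l a).sum := by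
  refine .of_natCast ?_
  simp only [Nat.cast_list_sum]
  exact .sum (.map hl (by fun_prop))

@[fun_prop]
theorem PT.length {l : α → List β} (hl : PT l) : PT fun a => (l a).length := by
  have h : PT fun a => ((l a).map fun _ => 1).sum := .natSum (.map hl (.const _))
  simpa using h

@[fun_prop]
theorem PT.zipIdx {l : α → List β} (hl : PT l) : PT fun a => (l a).zipIdx := by
  obtain ⟨p, hp⟩ := hl.exists_size_le
  have key : ∀ (l : List β) (n : ℕ) (acc : List (β × ℕ)),
      l.foldl (fun (acc : ℕ × List (β × ℕ)) e => (acc.1 + 1, (e, acc.1) :: acc.2)) (n, acc) =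
        (n + l.length, (l.zipIdx n).reverse ++ acc) := by
    intro l
    induction l with
    | nil => simp
    | cons a l ih =>
      intro n acc
      simp [ih, add_assoc, add_comm 1]
  have h := PT.foldl (step := fun _ (acc : ℕ × List (β × ℕ)) e => (acc.1 + 1, (e, acc.1) :: acc.2))
    hl (.const (0, [])) (by fun_prop) (5 + p + p * (2 * p + 3 + 1)) fun a i => by
      rw [key, List.append_nil, enc_mk, Data.size, size_reverse]
      have h1 := length_le_size (l a)
      have h2 := hp a
      have h3 : ((l a).take i).length ≤ (l a).length := by simp
      have h4 := size_nat_le (0 + ((l a).take i).length)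
      have h5 := size_list_le (l := ((l a).take i).zipIdx) (k := p.eval (enc a).size)
        (B := 2 * p.eval (enc a).size + 3) (by simp; omega) (fun x hx => by
          rw [List.mem_zipIdx_iff_getElem?] at hx
          have h6 := size_le_of_mem (List.mem_of_mem_take (List.mem_of_getElem? hx))
          have h7 := size_nat_le x.2
          have h8 : x.2 < ((l a).take i).length := (List.getElem?_eq_some_iff.1 hx).1
          rw [← Prod.mk.eta (p := x), enc_mk, Data.size]
          omega)
      simp only [Polynomial.eval_add, Polynomial.eval_mul, Polynomial.eval_ofNat,
        Polynomial.eval_one]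
      omega
  simp only [key, List.append_nil] at h
  simpa using h.snd.reverse

@[fun_prop]
theorem PT.suffixes {l : α → List β} (hl : PT l) : PT fun a => suffixes (l a) := by
  obtain ⟨p, hp⟩ := hl.exists_size_le
  let step : List β × List (β × List β) → β → List β × List (β × List β) :=
    fun acc e => (acc.1.tail, (e, acc.1.tail) :: acc.2)
  have key : ∀ (l : List β) (acc : List (β × List β)),
      l.foldl step (l, acc) = ([], (CRL.suffixes l).reverse ++ acc) := by
    intro l
    induction l with
    | nil => simp [CRL.suffixes]
    | cons a l ih =>
      intro acc
      simp [CRL.suffixes, step, ih]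
  have hsize : ∀ (B : ℕ) (l : List β) (c : List β) (acc : List (β × List β)),
      (∀ e ∈ l, (enc e).size ≤ B) → (enc c).size ≤ B →
      (enc (l.foldl step (c, acc))).size ≤ 1 + B + (enc acc).size + l.length * (2 * B + 2) := by
    intro B l
    induction l with
    | nil =>
      intro c acc _ hc
      simp only [List.foldl_nil, enc_mk, Data.size]
      omega
    | cons a l ih =>
      intro c acc h hc
      have h1 := size_drop_le c 1
      rw [List.drop_one] at h1
      refine (ih _ _ (fun e he => h e (.tail _ he)) (h1.trans hc)).trans ?_
      have h2 := h a (.head _)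
      dsimp only
      rw [enc_cons, enc_mk, Data.size, Data.size, List.length_cons, add_mul]
      omega
  have h := PT.foldl (step := fun _ => step) hl (.prodMk hl (.const [])) (by fun_prop)
    (3 + p + p * (2 * p + 2)) fun a i => by
      have h2 := hp a
      refine (hsize (p.eval (enc a).size) _ _ _ (fun e he => ?_) h2).trans ?_
      · have := size_le_of_mem (List.mem_of_mem_take he)
        omega
      · have h1 := length_le_size (l a)
        have h3 : ((l a).take i).length ≤ p.eval (enc a).size := by
          rw [List.length_take]
          omega
        have h4 := Nat.mul_le_mul_right (2 * p.eval (enc a).size + 2) h3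
        have h5 : (enc ([] : List (β × List β))).size = 2 := by simp [enc_nil, Data.size]
        simp only [Polynomial.eval_add, Polynomial.eval_mul, Polynomial.eval_ofNat]
        omega
  simp only [key, List.append_nil] at h
  simpa using h.snd.reverse

@[fun_prop]
theorem PT.pick {l : α → List β} {n : α → ℕ} (hl : PT l) (hn : PT n) :
    PT fun a => pick (l a) (n a) :=
  .flatMap hl.zipIdx (.ite (.natEq (by fun_prop) (by fun_prop)) (by fun_prop) (.const _))

end Lists

/-! ### The reduction on representations -/

/-- The data of a process at one time, state and action: availability, expected reward, the cost
distribution as a list of probabilities and cost vectors, and the transition probabilities. -/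
abbrev Entry : Type := ℚ × ℚ × List (ℚ × List ℚ) × List ℚ

/-- A represented process: states, actions, initial state, and the table of entries. -/
abbrev Raw : Type := List ℕ × List ℕ × ℕ × List (List (List Entry))

/-- An instance of the constrained problem: process, budgets and tolerances, accuracy. -/
abbrev Input : Type := Raw × (List ℚ × List ℚ) × ℚ

/-- A represented history, most recent step first: action, cost vector and next state. -/
abbrev RawHist : Type := List (ℕ × List ℚ × ℕ)

/-- The indices of a list. -/
def idx {α : Type} (l : List α) : List ℕ := l.zipIdx.map Prod.snd

namespace Input

/-- The horizon, as the number of rows of the table. -/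
def horizon (x : Input) : ℕ := x.1.2.2.2.length

/-- All cost vectors of the table. -/
def allCosts (x : Input) : List (List ℚ) :=
  x.1.2.2.2.flatMap fun R => R.flatMap fun A => A.flatMap fun e => e.2.2.1.map Prod.snd

/-- The `i`-th entry of some cost vector of the table (`0` if the table is empty). -/
def refCost (x : Input) (i : ℕ) : ℚ := (x.allCosts.headD []).getD i 0

/-- A bound on the distance of the `i`-th costs from the reference cost, and at most the number of
cost vectors times their range. -/
def spread (x : Input) (i : ℕ) : ℚ := (x.allCosts.map fun c => |c.getD i 0 - x.refCost i|).sum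

/-- A lower bound on the `i`-th costs. -/
def base (x : Input) (i : ℕ) : ℚ := x.refCost i - x.spread i

/-- The grid width of the rounding: `H` roundings lose at most half the accuracy. -/
def unit (x : Input) : ℚ := x.2.2 / (2 * ((x.horizon : ℚ) + 1))

/-- The rounded excess of a cost over the lower bound, in multiples of the grid width. -/
def incr (x : Input) (i : ℕ) (c : List ℚ) : ℕ := ⌊(c.getD i 0 - x.base i) / x.unit⌋₊

/-- The sum of the spreads over all coordinates. -/
def totalSpread (m : ℕ) (x : Input) : ℚ := (List.ofFn fun i : Fin m => x.spread i).sum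

/-- The largest value of the counters that accumulate the rounded costs. The counters are truncated
there, but within the horizon the truncation never takes effect. -/
def cap (m : ℕ) (x : Input) : ℕ := x.horizon * ⌊2 * x.totalSpread m / x.unit⌋₊

/-- The counters after a further cost vector. -/
def advance (m : ℕ) (x : Input) (n : List ℕ) (c : List ℚ) : List ℕ :=
  List.ofFn fun i : Fin m => min (x.cap m) (n.getD i 0 + x.incr i c)

/-- The rounded total cost over the whole horizon that a counter stands for. -/
def level (x : Input) (i : ℕ) (n : List ℕ) : ℚ :=
  x.horizon * x.base i + x.unit * (n.getD i 0 : ℕ)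

/-- The indicator of a rounded total cost over budget. -/
def exceeds (x : Input) (i : ℕ) (n : List ℕ) : ℚ :=
  if x.2.1.1.getD i 0 < x.level i n then 1 else 0

/-- Twice the amount by which the rounded total cost is over budget. -/
def penalty (x : Input) (i : ℕ) (n : List ℕ) : ℚ :=
  2 * max (x.level i n - x.2.1.1.getD i 0) 0

/-- The `i`-th cost of the reduced process at counters `n`, where `l` is the cost distribution of
the original process. -/
def newCost (m : ℕ) (x : Input) (i : ℕ) (κ : ConstraintKind) (n : List ℕ) (l : List (ℚ × List ℚ)) :
    ℚ :=
  match κ with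
  | .expectation => (l.map fun e => e.1 * e.2.getD i 0).sum
  | .almostSure =>
      (l.map fun e => if 0 < e.1 then x.penalty i (x.advance m n e.2) else 0).sum
  | .chance => (l.map fun e => e.1 * x.exceeds i (x.advance m n e.2)).sum - x.exceeds i n

/-- The vector of costs of the reduced process. -/
def newCosts {m : ℕ} (K : Fin m → ConstraintKind) (x : Input) (n : List ℕ)
    (l : List (ℚ × List ℚ)) : List ℚ :=
  List.ofFn fun i : Fin m => x.newCost m i (K i) n l

/-- The budgets of the reduced process. -/
def newBudgets {m : ℕ} (K : Fin m → ConstraintKind) (x : Input) : List ℚ :=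
  List.ofFn fun i : Fin m =>
    match K i with
    | .expectation => x.2.1.1.getD i 0
    | .almostSure => 0
    | .chance => x.2.1.2.getD i 0 - x.exceeds i []

/-- The almost-sure budgets are not excluded by the lower bounds on the costs. -/
def Plausible {m : ℕ} (K : Fin m → ConstraintKind) (x : Input) : Prop :=
  ∀ i : Fin m, K i = .almostSure → x.horizon * x.base i ≤ x.2.1.1.getD i 0

/-- The current state of a represented history. -/
def curState (x : Input) (σ : RawHist) : ℕ := ((σ.map fun s => s.2.2) ++ [x.1.2.2.1]).headD 0

/-- The entry of the table at a time, state and action, as a list of at most one element. -/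
def entryAt (x : Input) (h s a : ℕ) : List Entry :=
  (pick x.1.2.2.2 h).flatMap fun R => (pick R s).flatMap fun A => pick A a

/-- The index of the cost outcome observed in the step `s` after `σ`: as the outcomes are distinct,
the sum over the outcomes has at most one nonzero term. -/
def outcome (m : ℕ) (x : Input) (s : ℕ × List ℚ × ℕ) (σ : RawHist) : ℕ :=
  ((x.entryAt σ.length (x.curState σ) s.1).flatMap fun e => e.2.2.1.zipIdx.map fun q =>
    if ∀ i : Fin m, q.1.2.getD i 0 = s.2.1.getD i 0 then q.2 else 0).sum

/-- The index of the cost outcome observed in the last step. -/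
def lastOutcome (m : ℕ) (x : Input) (σ : RawHist) : ℕ :=
  ((suffixes σ).map fun p => x.outcome m p.1 p.2).headD 0

/-- The counters reached by a represented history. -/
def counts (m : ℕ) (x : Input) (σ : RawHist) : List ℕ :=
  List.ofFn fun i : Fin m => min (x.cap m) (σ.map fun s => x.incr i s.2.1).sum

end Input

/-- All vectors of length `m` with entries from `r`. -/
def vecs : ℕ → List ℕ → List (List ℕ)
  | 0, _ => [[]]
  | m + 1, r => r.flatMap fun v => (vecs m r).map fun n => v :: n

/-- An instance together with the list of possible values of the counters. -/
abbrev Inst : Type := Input × List ℕ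

namespace Inst

/-- The labels that the states of the reduced process carry: values of the counters, and the index
of the last cost outcome. -/
def labels (m : ℕ) (y : Inst) : List (List ℕ × ℕ) :=
  (idx ([] :: y.1.allCosts)).flatMap fun k => (vecs m y.2).map fun n => (n, k)

/-- The probability of passing from the counters `n` to the label `lab`, where `l` is the cost
distribution. -/
def labelProb (m : ℕ) (y : Inst) (n : List ℕ) (l : List (ℚ × List ℚ)) (lab : List ℕ × ℕ) : ℚ :=
  (l.zipIdx.map fun q => if q.2 = lab.2 ∧
    ∀ i : Fin m, lab.1.getD i 0 = (y.1.advance m n q.1.2).getD i 0 then q.1.1 else 0).sum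

/-- The entry of the reduced process at the label `lab`. -/
def newEntry {m : ℕ} (K : Fin m → ConstraintKind) (y : Inst) (lab : List ℕ × ℕ) (e : Entry) :
    Entry :=
  (e.1, e.2.1, [((1 : ℚ), y.1.newCosts K lab.1 e.2.2.1)], (y.labels m).flatMap fun lab' =>
    e.2.2.2.map fun q => y.labelProb m lab.1 e.2.2.1 lab' * q)

/-- The reduced process. -/
def newRaw {m : ℕ} (K : Fin m → ConstraintKind) (y : Inst) : Raw :=
  (idx ((y.labels m).flatMap fun _ => y.1.1.1), y.1.1.2.1, y.1.1.2.2.1,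
    y.1.1.2.2.2.map fun R => (y.labels m).flatMap fun lab => R.map fun A => A.map fun e =>
      y.newEntry K lab e)

/-- The instance of the bicriteria problem. -/
def reduce {m : ℕ} (K : Fin m → ConstraintKind) (y : Inst) : Raw × List ℚ × ℚ :=
  (y.newRaw K, y.1.newBudgets K, y.1.2.2)

/-- The position of a label, as a sum with at most one nonzero term. -/
def labelIndex (m : ℕ) (y : Inst) (n : List ℕ) (k : ℕ) : ℕ :=
  ((y.labels m).zipIdx.map fun q =>
    if q.1.2 = k ∧ ∀ i : Fin m, q.1.1.getD i 0 = n.getD i 0 then q.2 else 0).sum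

/-- The state of the reduced process after a history of the original one. -/
def stateIndex (m : ℕ) (y : Inst) (σ : RawHist) : ℕ :=
  y.1.curState σ + y.1.1.1.length * y.labelIndex m (y.1.counts m σ) (y.1.lastOutcome m σ)

/-- The history of the reduced process that corresponds to a history of the original one. -/
def translate {m : ℕ} (K : Fin m → ConstraintKind) (y : Inst) (τ : RawHist) : RawHist :=
  (suffixes τ).map fun p => (p.1.1,
    (y.1.entryAt p.2.length (y.1.curState p.2) p.1.1).flatMap fun e =>
      y.1.newCosts K (y.1.counts m p.2) e.2.2.1,
    y.stateIndex m (p.1 :: p.2))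

end Inst

/-! ### The reduction takes polynomial time -/

section PolyTime

variable {α β : Type} [Enc α] [Enc β]

@[fun_prop]
theorem PT.idx {l : α → List β} (hl : PT l) : PT fun a => idx (l a) := by
  unfold CRL.idx
  fun_prop

@[fun_prop]
theorem PT.horizon {x : α → Input} (hx : PT x) : PT fun a => (x a).horizon := by
  unfold Input.horizon
  fun_prop

@[fun_prop]
theorem PT.allCosts {x : α → Input} (hx : PT x) : PT fun a => (x a).allCosts := by
  unfold Input.allCosts
  fun_prop

@[fun_prop]
theorem PT.refCost {x : α → Input} (hx : PT x) (i : ℕ) : PT fun a => (x a).refCost i :=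
  .getD_rat (.headD hx.allCosts [] rfl) i

@[fun_prop]
theorem PT.spread {x : α → Input} (hx : PT x) (i : ℕ) : PT fun a => (x a).spread i := by
  unfold Input.spread
  fun_prop

@[fun_prop]
theorem PT.base {x : α → Input} (hx : PT x) (i : ℕ) : PT fun a => (x a).base i := by
  unfold Input.base
  fun_prop

@[fun_prop]
theorem PT.unit {x : α → Input} (hx : PT x) : PT fun a => (x a).unit := by
  unfold Input.unit
  fun_prop

@[fun_prop]
theorem PT.incr {x : α → Input} {c : α → List ℚ} (hx : PT x) (hc : PT c) (i : ℕ) :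
    PT fun a => (x a).incr i (c a) := by
  unfold Input.incr
  fun_prop

@[fun_prop]
theorem PT.totalSpread {x : α → Input} (hx : PT x) (m : ℕ) : PT fun a => (x a).totalSpread m :=
  .sum (.ofFn fun i => hx.spread i)

@[fun_prop]
theorem PT.cap {x : α → Input} (hx : PT x) (m : ℕ) : PT fun a => (x a).cap m := by
  unfold Input.cap
  fun_prop

@[fun_prop]
theorem PT.advance {x : α → Input} {n : α → List ℕ} {c : α → List ℚ} (hx : PT x) (hn : PT n)
    (hc : PT c) (m : ℕ) : PT fun a => (x a).advance m (n a) (c a) :=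
  .ofFn fun i => by fun_prop

@[fun_prop]
theorem PT.level {x : α → Input} {n : α → List ℕ} (hx : PT x) (hn : PT n) (i : ℕ) :
    PT fun a => (x a).level i (n a) := by
  unfold Input.level
  fun_prop

@[fun_prop]
theorem PT.exceeds {x : α → Input} {n : α → List ℕ} (hx : PT x) (hn : PT n) (i : ℕ) :
    PT fun a => (x a).exceeds i (n a) :=
  .ite (.lt (by fun_prop) (by fun_prop)) (.const _) (.const _)

@[fun_prop]
theorem PT.penalty {x : α → Input} {n : α → List ℕ} (hx : PT x) (hn : PT n) (i : ℕ) :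
    PT fun a => (x a).penalty i (n a) := by
  unfold Input.penalty
  fun_prop

@[fun_prop]
theorem PT.newCost {x : α → Input} {n : α → List ℕ} {l : α → List (ℚ × List ℚ)} (hx : PT x)
    (hn : PT n) (hl : PT l) (m i : ℕ) (κ : ConstraintKind) :
    PT fun a => (x a).newCost m i κ (n a) (l a) := by
  cases κ
  · simp only [Input.newCost]
    fun_prop
  · exact .sum (.map hl (.ite (.lt (.const _) (by fun_prop)) (by fun_prop) (.const _)))
  · simp only [Input.newCost]
    fun_prop

@[fun_prop]
theorem PT.newCosts {m : ℕ} (K : Fin m → ConstraintKind) {x : α → Input} {n : α → List ℕ}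
    {l : α → List (ℚ × List ℚ)} (hx : PT x) (hn : PT n) (hl : PT l) :
    PT fun a => (x a).newCosts K (n a) (l a) :=
  .ofFn fun i => by fun_prop

@[fun_prop]
theorem PT.newBudgets {m : ℕ} (K : Fin m → ConstraintKind) {x : α → Input} (hx : PT x) :
    PT fun a => (x a).newBudgets K :=
  .ofFn fun i => by cases K i <;> dsimp only <;> fun_prop

theorem PTPred.plausible {m : ℕ} (K : Fin m → ConstraintKind) {x : α → Input} (hx : PT x) :
    PTPred fun a => (x a).Plausible K := by
  refine .forall_fin fun i => ?_
  by_cases h : K i = .almostSure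
  · simp only [h, forall_const]
    exact .le (by fun_prop) (by fun_prop)
  · simp only [h, false_imp_iff]
    exact .const _

@[fun_prop]
theorem PT.curState {x : α → Input} {σ : α → RawHist} (hx : PT x) (hσ : PT σ) :
    PT fun a => (x a).curState (σ a) :=
  .headD (by fun_prop) 0 rfl

@[fun_prop]
theorem PT.entryAt {x : α → Input} {h s b : α → ℕ} (hx : PT x) (hh : PT h) (hs : PT s)
    (hb : PT b) : PT fun a => (x a).entryAt (h a) (s a) (b a) := by
  unfold Input.entryAt
  fun_prop

@[fun_prop]
theorem PT.outcome {x : α → Input} {s : α → ℕ × List ℚ × ℕ} {σ : α → RawHist} (hx : PT x)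
    (hs : PT s) (hσ : PT σ) (m : ℕ) : PT fun a => (x a).outcome m (s a) (σ a) :=
  .natSum (.flatMap (by fun_prop) (.map (by fun_prop)
    (.ite (.forall_fin fun i => .eq (by fun_prop) (by fun_prop)) (by fun_prop) (.const _))))

@[fun_prop]
theorem PT.lastOutcome {x : α → Input} {σ : α → RawHist} (hx : PT x) (hσ : PT σ) (m : ℕ) :
    PT fun a => (x a).lastOutcome m (σ a) :=
  .headD (.map (by fun_prop) (by fun_prop)) 0 rfl

@[fun_prop]
theorem PT.counts {x : α → Input} {σ : α → RawHist} (hx : PT x) (hσ : PT σ) (m : ℕ) :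
    PT fun a => (x a).counts m (σ a) :=
  .ofFn fun i => by fun_prop

@[fun_prop]
theorem PT.vecs {r : α → List ℕ} (hr : PT r) (m : ℕ) : PT fun a => vecs m (r a) := by
  induction m with
  | zero => exact .const _
  | succ m ih =>
    unfold CRL.vecs
    exact .flatMap hr (.map (.comp (g := fun a => CRL.vecs m (r a)) ih (by fun_prop))
      (by fun_prop))

@[fun_prop]
theorem PT.labels {y : α → Inst} (hy : PT y) (m : ℕ) : PT fun a => (y a).labels m := by
  unfold Inst.labels
  fun_prop

@[fun_prop]
theorem PT.labelProb {y : α → Inst} {n : α → List ℕ} {l : α → List (ℚ × List ℚ)}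
    {lab : α → List ℕ × ℕ} (hy : PT y) (hn : PT n) (hl : PT l) (hlab : PT lab) (m : ℕ) :
    PT fun a => (y a).labelProb m (n a) (l a) (lab a) :=
  .sum (.map (by fun_prop) (.ite (.and (.natEq (by fun_prop) (by fun_prop))
    (.forall_fin fun i => .natEq (by fun_prop) (by fun_prop))) (by fun_prop) (.const _)))

@[fun_prop]
theorem PT.newEntry {m : ℕ} (K : Fin m → ConstraintKind) {y : α → Inst} {lab : α → List ℕ × ℕ}
    {e : α → Entry} (hy : PT y) (hlab : PT lab) (he : PT e) :
    PT fun a => (y a).newEntry K (lab a) (e a) := by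
  unfold Inst.newEntry
  fun_prop

@[fun_prop]
theorem PT.newRaw {m : ℕ} (K : Fin m → ConstraintKind) {y : α → Inst} (hy : PT y) :
    PT fun a => (y a).newRaw K := by
  unfold Inst.newRaw
  fun_prop

@[fun_prop]
theorem PT.reduce {m : ℕ} (K : Fin m → ConstraintKind) {y : α → Inst} (hy : PT y) :
    PT fun a => (y a).reduce K := by
  unfold Inst.reduce
  fun_prop

@[fun_prop]
theorem PT.labelIndex {y : α → Inst} {n : α → List ℕ} {k : α → ℕ} (hy : PT y) (hn : PT n)
    (hk : PT k) (m : ℕ) : PT fun a => (y a).labelIndex m (n a) (k a) :=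
  .natSum (.map (by fun_prop) (.ite (.and (.natEq (by fun_prop) (by fun_prop))
    (.forall_fin fun i => .natEq (by fun_prop) (by fun_prop))) (by fun_prop) (.const _)))

@[fun_prop]
theorem PT.stateIndex {y : α → Inst} {σ : α → RawHist} (hy : PT y) (hσ : PT σ) (m : ℕ) :
    PT fun a => (y a).stateIndex m (σ a) := by
  unfold Inst.stateIndex
  fun_prop

@[fun_prop]
theorem PT.translate {m : ℕ} (K : Fin m → ConstraintKind) {y : α → Inst} {τ : α → RawHist}
    (hy : PT y) (hτ : PT τ) : PT fun a => (y a).translate K (τ a) := by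
  unfold Inst.translate
  fun_prop

end PolyTime

/-! ### Expectations by backward recursion -/

theorem pmfOfRat_toReal {n : ℕ} (p : Fin n → ℚ) (h0 : ∀ i, 0 ≤ p i) (h1 : ∑ i, p i = 1)
    (i : Fin n) : (pmfOfRat p h0 h1 i).toReal = p i := by
  simp only [pmfOfRat, PMF.ofFintype_apply]
  exact ENNReal.toReal_ofReal (by exact_mod_cast h0 i)

theorem pmfOfRat_support {n : ℕ} (p : Fin n → ℚ) (h0 : ∀ i, 0 ≤ p i) (h1 : ∑ i, p i = 1)
    (i : Fin n) : i ∈ (pmfOfRat p h0 h1).support ↔ 0 < p i := by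
  simp [pmfOfRat]

theorem tsum_bind_toReal {ι β : Type} [Fintype ι] (p : PMF ι) (f : ι → PMF β)
    (hf : ∀ i, (f i).support.Finite) (X : β → ℝ) :
    ∑' b, ((p.bind f) b).toReal * X b = ∑ i, (p i).toReal * ∑' b, (f i b).toReal * X b := by
  have hsum : ∀ i, Summable fun b => (p i).toReal * ((f i b).toReal * X b) := fun i =>
    summable_of_hasFiniteSupport ((hf i).subset fun b hb => by
      rw [PMF.mem_support_iff]
      rintro h
      simp [h] at hb)
  simp only [← tsum_mul_left]
  rw [← Summable.tsum_finsetSum fun i _ => hsum i]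
  refine tsum_congr fun b => ?_
  rw [PMF.bind_apply, tsum_fintype, ENNReal.toReal_sum fun i _ =>
    ENNReal.mul_ne_top (p.apply_ne_top i) ((f i).apply_ne_top b), Finset.sum_mul]
  simp only [ENNReal.toReal_mul, mul_assoc]

theorem finite_support_bind {ι β : Type} [Finite ι] (p : PMF ι) (f : ι → PMF β)
    (hf : ∀ i, (f i).support.Finite) : (p.bind f).support.Finite := by
  rw [PMF.support_bind]
  exact Set.toFinite _ |>.biUnion fun i _ => hf i

namespace CaMDP

variable {m : ℕ} (M : CaMDP m)

theorem finite_support_lawFrom (π : M.Policy) (n : ℕ) (τ : M.Hist) :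
    (M.lawFrom π n τ).support.Finite := by
  induction n generalizing τ with
  | zero => simp [lawFrom]
  | succ n ih =>
    exact finite_support_bind _ _ fun a => finite_support_bind _ _ fun k =>
      finite_support_bind _ _ fun s' => ih _

/-- The expectation of `X` at the history reached after `n` further interactions. -/
noncomputable def expectFrom (π : M.Policy) (X : M.Hist → ℝ) : ℕ → M.Hist → ℝ
  | 0, τ => X τ
  | n + 1, τ =>
      ∑ a, (π τ a).toReal * ∑ k, (M.costProb τ.length (M.cur τ) a k : ℝ) *
        ∑ s', (M.trans τ.length (M.cur τ) a s' : ℝ) *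
          expectFrom π X n (⟨a, M.costVal τ.length (M.cur τ) a k, s'⟩ :: τ)

theorem tsum_lawFrom (π : M.Policy) (X : M.Hist → ℝ) (n : ℕ) (τ : M.Hist) :
    ∑' σ, (M.lawFrom π n τ σ).toReal * X σ = M.expectFrom π X n τ := by
  induction n generalizing τ with
  | zero =>
    rw [tsum_eq_single τ]
    · simp [lawFrom, expectFrom]
    · intro σ hσ
      simp [lawFrom, hσ]
  | succ n ih =>
    rw [lawFrom, tsum_bind_toReal _ _ fun a => finite_support_bind _ _ fun k =>
      finite_support_bind _ _ fun s' => M.finite_support_lawFrom π n _]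
    refine Finset.sum_congr rfl fun a _ => ?_
    rw [tsum_bind_toReal _ _ fun k =>
      finite_support_bind _ _ fun s' => M.finite_support_lawFrom π n _]
    congr 1
    refine Finset.sum_congr rfl fun k _ => ?_
    rw [tsum_bind_toReal _ _ fun s' => M.finite_support_lawFrom π n _, costPMF, pmfOfRat_toReal]
    congr 1
    refine Finset.sum_congr rfl fun s' _ => ?_
    rw [ih, transPMF, pmfOfRat_toReal]

theorem expect_eq_expectFrom (π : M.Policy) (X : M.Hist → ℝ) :
    M.expect π X = M.expectFrom π X M.H [] :=
  M.tsum_lawFrom π X M.H []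

open Classical in
theorem prob_eq_expectFrom (π : M.Policy) (E : Set M.Hist) :
    M.prob π E = M.expectFrom π (fun τ => if τ ∈ E then 1 else 0) M.H [] := by
  rw [← expect_eq_expectFrom, prob, expect, PMF.toOuterMeasure_apply, ENNReal.tsum_toReal_eq]
  · refine tsum_congr fun τ => ?_
    by_cases h : τ ∈ E <;> simp [h]
  · intro τ
    by_cases h : τ ∈ E <;> simp [h, PMF.apply_ne_top]

theorem prob_eq_one_iff (π : M.Policy) (E : Set M.Hist) :
    M.prob π E = 1 ↔ ∀ σ ∈ (M.lawFrom π M.H []).support, σ ∈ E := by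
  rw [prob, ENNReal.toReal_eq_one_iff, PMF.toOuterMeasure_apply_eq_one_iff]
  rfl

theorem mem_support_lawFrom_succ (π : M.Policy) (n : ℕ) (τ σ : M.Hist) :
    σ ∈ (M.lawFrom π (n + 1) τ).support ↔
      ∃ a, 0 < (π τ a).toReal ∧ ∃ k, 0 < M.costProb τ.length (M.cur τ) a k ∧
        ∃ s', 0 < M.trans τ.length (M.cur τ) a s' ∧
          σ ∈ (M.lawFrom π n (⟨a, M.costVal τ.length (M.cur τ) a k, s'⟩ :: τ)).support := by
  have h : ∀ a, 0 < (π τ a).toReal ↔ a ∈ (π τ).support := fun a => by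
    rw [ENNReal.toReal_pos_iff, PMF.mem_support_iff, pos_iff_ne_zero]
    exact and_iff_left (PMF.apply_lt_top _ _)
  simp only [lawFrom, PMF.mem_support_bind_iff, costPMF, transPMF, pmfOfRat_support, h]

theorem exists_mem_support_lawFrom (π : M.Policy) (n : ℕ) (τ : M.Hist) :
    ∃ σ, σ ∈ (M.lawFrom π n τ).support :=
  (M.lawFrom π n τ).support_nonempty

theorem policy_sum_toReal (π : M.Policy) (τ : M.Hist) : ∑ a, (π τ a).toReal = 1 := by
  have h := (π τ).tsum_coe
  rw [tsum_fintype] at h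
  rw [← ENNReal.toReal_sum fun a _ => (π τ).apply_ne_top a, h, ENNReal.toReal_one]

theorem costProb_sum_real (h s a) : ∑ k, (M.costProb h s a k : ℝ) = 1 := by
  exact_mod_cast M.costProb_sum h s a

theorem trans_sum_real (h s a) : ∑ s', (M.trans h s a s' : ℝ) = 1 := by
  exact_mod_cast M.trans_sum h s a

theorem exists_trans_pos (h s a) : ∃ s', 0 < M.trans h s a s' := by
  by_contra hc
  push Not at hc
  have h1 := M.trans_sum h s a
  have h2 : ∑ s', M.trans h s a s' ≤ 0 := Finset.sum_nonpos fun s' _ => hc s'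
  linarith

/-- The histories of length at most the horizon whose costs are possible outcomes, whatever their
probabilities. -/
def Valid : M.Hist → Prop
  | [] => True
  | x :: τ => Valid τ ∧ τ.length < M.H ∧ ∃ k, x.cost = M.costVal τ.length (M.cur τ) x.act k

theorem Valid.of_isHist {τ : M.Hist} (h : M.IsHist τ) : M.Valid τ := by
  induction τ with
  | nil => trivial
  | cons x τ ih =>
    obtain ⟨h1, h2, -, ⟨k, -, hk⟩, -⟩ := h
    exact ⟨ih h1, h2, k, hk⟩

variable {M} in
theorem Valid.cons {τ : M.Hist} (h : M.Valid τ) (hl : τ.length < M.H) (a k s') :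
    M.Valid (⟨a, M.costVal τ.length (M.cur τ) a k, s'⟩ :: τ) :=
  ⟨h, hl, k, rfl⟩

theorem expectFrom_mono {π : M.Policy} {X Y : M.Hist → ℝ} (n : ℕ) {τ : M.Hist} (hτ : M.Valid τ)
    (hn : τ.length + n = M.H) (h : ∀ σ, M.Valid σ → σ.length = M.H → X σ ≤ Y σ) :
    M.expectFrom π X n τ ≤ M.expectFrom π Y n τ := by
  induction n generalizing τ with
  | zero => exact h τ hτ hn
  | succ n ih =>
    refine Finset.sum_le_sum fun a _ => mul_le_mul_of_nonneg_left ?_ ENNReal.toReal_nonneg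
    refine Finset.sum_le_sum fun k _ => mul_le_mul_of_nonneg_left ?_
      (by exact_mod_cast M.costProb_nonneg _ _ _ _)
    refine Finset.sum_le_sum fun s' _ => mul_le_mul_of_nonneg_left ?_
      (by exact_mod_cast M.trans_nonneg _ _ _ _)
    exact ih (hτ.cons (by omega) a k s') (by simp; omega)

theorem valid_of_mem_support {π : M.Policy} (n : ℕ) {τ σ : M.Hist} (hτ : M.Valid τ)
    (hn : τ.length + n = M.H) (h : σ ∈ (M.lawFrom π n τ).support) :
    M.Valid σ ∧ σ.length = M.H := by
  induction n generalizing τ with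
  | zero =>
    simp only [lawFrom, PMF.support_pure, Set.mem_singleton_iff] at h
    exact h ▸ ⟨hτ, hn⟩
  | succ n ih =>
    obtain ⟨a, -, k, -, s', -, h⟩ := (M.mem_support_lawFrom_succ π n τ σ).1 h
    exact ih (hτ.cons (by omega) a k s') (by simp; omega) h

end CaMDP

/-! ### Labelled processes -/

/-- Labels that are updated along the interaction with `M`, by a rule from which the observed cost
outcome can be recovered, together with costs that depend on the label. -/
structure Labelling {m : ℕ} (M : CaMDP m) where
  /-- the number of labels -/
  J : ℕ
  /-- the initial label -/
  init : Fin J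
  /-- the label after a cost outcome -/
  next : (h : ℕ) → Fin J → (s : Fin M.nS) → (a : Fin M.nA) → Fin (M.nC h s a) → Fin J
  /-- the new cost vector -/
  cost : ℕ → Fin J → Fin M.nS → Fin M.nA → Fin m → ℚ
  inj : ∀ h < M.H, ∀ j s a, Function.Injective (next h j s a)

namespace Labelling

variable {m : ℕ} {M : CaMDP m} (L : Labelling M)

/-- The state with a given label and a given original state. -/
def state (j : Fin L.J) (s : Fin M.nS) : Fin (L.J * M.nS) := finProdFinEquiv (j, s)

/-- The label of a state. -/
def lab (x : Fin (L.J * M.nS)) : Fin L.J := (finProdFinEquiv.symm x).1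

/-- The original state. -/
def st (x : Fin (L.J * M.nS)) : Fin M.nS := (finProdFinEquiv.symm x).2

@[simp] theorem lab_state (j s) : L.lab (L.state j s) = j := by simp [lab, state]

@[simp] theorem st_state (j s) : L.st (L.state j s) = s := by simp [st, state]

theorem sum_states {R : Type} [AddCommMonoid R] (G : Fin (L.J * M.nS) → R) :
    ∑ x, G x = ∑ j, ∑ s, G (L.state j s) := by
  rw [← finProdFinEquiv.sum_comp, Fintype.sum_prod_type]
  rfl

/-- The transition probabilities of the labelled process: the cost outcome, which determines the
next label, and the next state are drawn independently. -/
def trans (h : ℕ) (x : Fin (L.J * M.nS)) (a : Fin M.nA) (y : Fin (L.J * M.nS)) : ℚ :=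
  (∑ k, if L.next h (L.lab x) (L.st x) a k = L.lab y then M.costProb h (L.st x) a k else 0) *
    M.trans h (L.st x) a (L.st y)

theorem sum_trans_mul (h x a) (G : Fin (L.J * M.nS) → ℝ) :
    ∑ y, (L.trans h x a y : ℝ) * G y = ∑ k, (M.costProb h (L.st x) a k : ℝ) *
      ∑ s', (M.trans h (L.st x) a s' : ℝ) * G (L.state (L.next h (L.lab x) (L.st x) a k) s') := by
  rw [sum_states]
  simp only [trans, lab_state, st_state, Rat.cast_mul, Rat.cast_sum, Finset.sum_mul]
  calc _ = ∑ k, ∑ j, ∑ s', (((if L.next h (L.lab x) (L.st x) a k = j then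
          M.costProb h (L.st x) a k else 0 : ℚ) : ℝ) * (M.trans h (L.st x) a s' : ℝ)) *
            G (L.state j s') :=
        (Finset.sum_congr rfl fun j _ => Finset.sum_comm).trans Finset.sum_comm
    _ = _ := by
        refine Finset.sum_congr rfl fun k _ => ?_
        rw [Finset.sum_eq_single (L.next h (L.lab x) (L.st x) a k)]
        · rw [Finset.mul_sum]
          simp [mul_assoc]
        · intro j _ hj
          simp [hj.symm]
        · simp

theorem sum_trans_state (h j s a) (G : Fin (L.J * M.nS) → ℝ) :
    ∑ y, (L.trans h (L.state j s) a y : ℝ) * G y = ∑ k, (M.costProb h s a k : ℝ) *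
      ∑ s', (M.trans h s a s' : ℝ) * G (L.state (L.next h j s a k) s') := by
  have key : ∀ x j s, L.lab x = j → L.st x = s → ∑ y, (L.trans h x a y : ℝ) * G y =
      ∑ k, (M.costProb h s a k : ℝ) *
        ∑ s', (M.trans h s a s' : ℝ) * G (L.state (L.next h j s a k) s') := by
    rintro x _ _ rfl rfl
    exact L.sum_trans_mul h x a G
  exact key _ j s (L.lab_state j s) (L.st_state j s)

/-- The labelled process. Its costs are deterministic. -/
def mdp : CaMDP m where
  H := M.H
  nS := L.J * M.nS
  nA := M.nA
  s₀ := L.state L.init M.s₀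
  avail h x := M.avail h (L.st x)
  avail_nonempty h x := M.avail_nonempty h (L.st x)
  trans := L.trans
  trans_nonneg h x a y := by
    refine mul_nonneg (Finset.sum_nonneg fun k _ => ?_) (M.trans_nonneg _ _ _ _)
    split_ifs
    · exact M.costProb_nonneg _ _ _ _
    · exact le_rfl
  trans_sum h x a := by
    have h1 := L.sum_trans_mul h x a fun _ => 1
    simp only [mul_one, M.trans_sum_real, M.costProb_sum_real] at h1
    exact_mod_cast h1
  rew h x a := M.rew h (L.st x) a
  nC _ _ _ := 1
  costVal h x a _ := L.cost h (L.lab x) (L.st x) a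
  costVal_injective _ _ _ _ _ _ := Subsingleton.elim _ _
  costProb _ _ _ _ := 1
  costProb_nonneg _ _ _ _ := zero_le_one
  costProb_sum _ _ _ := by simp

open Classical in
/-- The label after the observed cost vector `c`. -/
noncomputable def update (h : ℕ) (j : Fin L.J) (s : Fin M.nS) (a : Fin M.nA) (c : Fin m → ℚ) :
    Fin L.J :=
  if hk : ∃ k, M.costVal h s a k = c then L.next h j s a hk.choose else j

open Classical in
/-- The cost vector that leads from the label `j` to the label `j'`. -/
noncomputable def decode (h : ℕ) (j : Fin L.J) (s : Fin M.nS) (a : Fin M.nA) (j' : Fin L.J) :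
    Fin m → ℚ :=
  if hk : ∃ k, L.next h j s a k = j' then M.costVal h s a hk.choose else 0

theorem update_costVal (h j s a k) : L.update h j s a (M.costVal h s a k) = L.next h j s a k := by
  have hk : ∃ k', M.costVal h s a k' = M.costVal h s a k := ⟨k, rfl⟩
  rw [update, dif_pos hk, M.costVal_injective h s a hk.choose_spec]

theorem decode_next {h} (hh : h < M.H) (j s a k) :
    L.decode h j s a (L.next h j s a k) = M.costVal h s a k := by
  have hk : ∃ k', L.next h j s a k' = L.next h j s a k := ⟨k, rfl⟩
  rw [decode, dif_pos hk, L.inj h hh j s a hk.choose_spec]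

/-- The label after a history. -/
noncomputable def label : M.Hist → Fin L.J
  | [] => L.init
  | x :: τ => L.update τ.length (label τ) (M.cur τ) x.act x.cost

/-- The history of the labelled process that corresponds to a history of `M`. -/
noncomputable def lift : M.Hist → L.mdp.Hist
  | [] => []
  | x :: τ => ⟨x.act, L.cost τ.length (L.label τ) (M.cur τ) x.act,
      L.state (L.label (x :: τ)) x.next⟩ :: lift τ

/-- The history of `M` that corresponds to a history of the labelled process. -/
noncomputable def lower : L.mdp.Hist → M.Hist
  | [] => []
  | x :: τ => ⟨x.act, L.decode τ.length (L.lab (L.mdp.cur τ)) (L.st (L.mdp.cur τ)) x.act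
      (L.lab x.next), L.st x.next⟩ :: lower τ

@[simp] theorem length_lift (τ : M.Hist) : (L.lift τ).length = τ.length := by
  induction τ with
  | nil => rfl
  | cons x τ ih => simp [lift, ih]

@[simp] theorem length_lower (τ : L.mdp.Hist) : (L.lower τ).length = τ.length := by
  induction τ with
  | nil => rfl
  | cons x τ ih => simp [lower, ih]

theorem cur_lift (τ : M.Hist) : L.mdp.cur (L.lift τ) = L.state (L.label τ) (M.cur τ) := by
  cases τ <;> rfl

theorem cur_lower (τ : L.mdp.Hist) : M.cur (L.lower τ) = L.st (L.mdp.cur τ) := by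
  cases τ
  · exact (L.st_state _ _).symm
  · rfl

/-- Nothing is lost by lifting: the new label determines the observed cost outcome, and distinct
outcomes have distinct cost vectors. -/
theorem lower_lift {τ : M.Hist} (h : M.Valid τ) : L.lower (L.lift τ) = τ := by
  induction τ with
  | nil => rfl
  | cons x τ ih =>
    obtain ⟨h1, h2, k, hk⟩ := h
    have hx : L.decode τ.length (L.label τ) (M.cur τ) x.act
        (L.update τ.length (L.label τ) (M.cur τ) x.act x.cost) = x.cost := by
      rw [hk, update_costVal, L.decode_next h2]
    simp only [lift, lower, ih h1, cur_lift, length_lift, lab_state, st_state, label, hx]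

theorem label_cons (τ : M.Hist) (a k s') :
    L.label (⟨a, M.costVal τ.length (M.cur τ) a k, s'⟩ :: τ) =
      L.next τ.length (L.label τ) (M.cur τ) a k :=
  L.update_costVal _ _ _ _ _

/-- The cost vector incurred in the labelled process by the action `a` after `τ`. -/
def stepCost (τ : L.mdp.Hist) (a : Fin M.nA) : Fin m → ℚ :=
  L.cost τ.length (L.lab (L.mdp.cur τ)) (L.st (L.mdp.cur τ)) a

theorem stepCost_lift (τ : M.Hist) (a : Fin M.nA) :
    L.stepCost (L.lift τ) a = L.cost τ.length (L.label τ) (M.cur τ) a := by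
  rw [stepCost, length_lift, cur_lift, lab_state, st_state]

theorem expectFrom_mdp_succ (π : L.mdp.Policy) (X : L.mdp.Hist → ℝ) (n : ℕ) (τ : L.mdp.Hist) :
    L.mdp.expectFrom π X (n + 1) τ = ∑ a, (π τ a).toReal *
      ∑ y, (L.trans τ.length (L.mdp.cur τ) a y : ℝ) *
        L.mdp.expectFrom π X n (⟨a, L.stepCost τ a, y⟩ :: τ) := by
  refine Finset.sum_congr rfl fun a _ => congrArg _ ?_
  refine (Fin.sum_univ_one _).trans ?_
  exact (congrArg (· * _) Rat.cast_one).trans (one_mul _)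

/-- A transition of the labelled process averages over the cost outcomes of `M`. -/
theorem sum_trans_lift (τ : M.Hist) (a : Fin M.nA) (G : L.mdp.Hist → ℝ) :
    ∑ y, (L.trans (L.lift τ).length (L.mdp.cur (L.lift τ)) a y : ℝ) *
        G (⟨a, L.stepCost (L.lift τ) a, y⟩ :: L.lift τ) =
      ∑ k, (M.costProb τ.length (M.cur τ) a k : ℝ) *
        ∑ s', (M.trans τ.length (M.cur τ) a s' : ℝ) *
          G (L.lift (⟨a, M.costVal τ.length (M.cur τ) a k, s'⟩ :: τ)) := by
  rw [stepCost_lift, length_lift, cur_lift]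
  refine (L.sum_trans_state τ.length (L.label τ) (M.cur τ) a _).trans ?_
  simp only [lift, label_cons]

theorem inClass_comp_lift {cls : PolicyClass} {π : L.mdp.Policy} (h : L.mdp.InClass cls π) :
    M.InClass cls (fun τ => π (L.lift τ)) := by
  refine ⟨fun τ hτ a ha => ?_, ?_⟩
  · have h1 := h.1 (L.lift τ) (by rw [length_lift]; exact hτ) a ha
    rw [length_lift, cur_lift] at h1
    change a ∈ M.avail _ (L.st _) at h1
    rwa [st_state] at h1
  · cases cls
    · exact fun τ => h.2 (L.lift τ)
    · trivial

theorem inClass_comp_lower {cls : PolicyClass} {π : M.Policy} (h : M.InClass cls π) :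
    L.mdp.InClass cls (fun τ => π (L.lower τ)) := by
  refine ⟨fun τ hτ a ha => ?_, ?_⟩
  · have h1 := h.1 (L.lower τ) (by rw [length_lower]; exact hτ) a ha
    rwa [length_lower, cur_lower] at h1
  · cases cls
    · exact fun τ => h.2 (L.lower τ)
    · trivial

/-- The policies `π'` of the labelled process and `π` of `M` make the same decisions. -/
def Agree (π' : L.mdp.Policy) (π : M.Policy) : Prop := ∀ τ, M.Valid τ → π' (L.lift τ) = π τ

theorem agree_comp_lift (π : L.mdp.Policy) : L.Agree π (fun τ => π (L.lift τ)) := fun _ _ => rfl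

theorem agree_comp_lower (π : M.Policy) : L.Agree (fun τ => π (L.lower τ)) π := fun τ hτ => by
  dsimp only
  rw [L.lower_lift hτ]

theorem totalReward_lift (τ : M.Hist) : L.mdp.totalReward (L.lift τ) = M.totalReward τ := by
  induction τ with
  | nil => rfl
  | cons x τ ih =>
    rw [lift, CaMDP.totalReward, CaMDP.totalReward, ih, length_lift, cur_lift]
    simp [mdp]

variable {L}

theorem Agree.value_eq {π' : L.mdp.Policy} {π : M.Policy} (hπ : L.Agree π' π) :
    L.mdp.value π' = M.value π := by
  have key : ∀ n (τ : M.Hist), M.Valid τ → τ.length + n = M.H →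
      L.mdp.expectFrom π' (fun τ => (L.mdp.totalReward τ : ℝ)) n (L.lift τ) =
        M.expectFrom π (fun τ => (M.totalReward τ : ℝ)) n τ := by
    intro n
    induction n with
    | zero =>
      intro τ _ _
      simp only [CaMDP.expectFrom, totalReward_lift]
    | succ n ih =>
      intro τ hτ hn
      rw [expectFrom_mdp_succ, CaMDP.expectFrom, hπ τ hτ]
      refine Finset.sum_congr rfl fun a _ => congrArg _ ?_
      refine (L.sum_trans_lift τ a _).trans ?_
      refine Finset.sum_congr rfl fun k _ => ?_
      congr 1
      refine Finset.sum_congr rfl fun s' _ => ?_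
      rw [ih _ (hτ.cons (by omega) a k s') (by simp; omega)]
  rw [CaMDP.value, CaMDP.value, CaMDP.expect_eq_expectFrom, CaMDP.expect_eq_expectFrom]
  exact key M.H [] trivial (by simp)

end Labelling

/-! ### Cost criteria of a labelled process -/

theorem fold_max_le_iff {n : ℕ} (x : Fin n → ℝ) (d : ℝ) :
    fold max x ≤ d ↔ 0 ≤ d ∧ ∀ i, x i ≤ d := by
  unfold fold
  induction n with
  | zero => simp
  | succ n ih =>
    rw [List.ofFn_succ, List.foldr_cons, max_le_iff, ih, Fin.forall_fin_succ]
    tauto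

namespace Labelling

variable {m : ℕ} {M : CaMDP m} (L : Labelling M)

theorem lift_cons (τ : M.Hist) (a k s') :
    L.lift (⟨a, M.costVal τ.length (M.cur τ) a k, s'⟩ :: τ) =
      ⟨a, L.stepCost (L.lift τ) a, L.state (L.next τ.length (L.label τ) (M.cur τ) a k) s'⟩ ::
        L.lift τ := by
  rw [stepCost_lift, lift, label_cons]

theorem trans_lift_pos_iff (τ : M.Hist) (a : Fin M.nA) (y : Fin (L.J * M.nS)) :
    0 < L.trans (L.lift τ).length (L.mdp.cur (L.lift τ)) a y ↔
      ∃ k s', 0 < M.costProb τ.length (M.cur τ) a k ∧ 0 < M.trans τ.length (M.cur τ) a s' ∧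
        y = L.state (L.next τ.length (L.label τ) (M.cur τ) a k) s' := by
  have key : ∀ x h j s, L.lab x = j → L.st x = s → (0 < L.trans h x a y ↔
      ∃ k s', 0 < M.costProb h s a k ∧ 0 < M.trans h s a s' ∧
        y = L.state (L.next h j s a k) s') := by
    rintro x h _ _ rfl rfl
    have hy : y = L.state (L.lab y) (L.st y) := (finProdFinEquiv.apply_symm_apply y).symm
    have h0 : ∀ k, 0 ≤ if L.next h (L.lab x) (L.st x) a k = L.lab y then
        M.costProb h (L.st x) a k else 0 := fun k => by
      split_ifs
      · exact M.costProb_nonneg _ _ _ _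
      · exact le_rfl
    constructor
    · intro hpos
      have hs : 0 < M.trans h (L.st x) a (L.st y) :=
        (M.trans_nonneg _ _ _ _).lt_of_ne fun h1 => by simp [trans, ← h1] at hpos
      have hk : ∃ k, 0 < if L.next h (L.lab x) (L.st x) a k = L.lab y then
          M.costProb h (L.st x) a k else 0 := by
        by_contra! hc
        have h1 := Finset.sum_nonpos fun k (_ : k ∈ Finset.univ) => hc k
        exact hpos.not_ge (mul_nonpos_of_nonpos_of_nonneg h1 hs.le)
      obtain ⟨k, hk⟩ := hk
      split_ifs at hk with hj
      · exact ⟨k, L.st y, hk, hs, hj ▸ hy⟩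
      · exact absurd hk (lt_irrefl _)
    · rintro ⟨k, s', hk, hs', rfl⟩
      refine mul_pos (Finset.sum_pos' (fun k _ => ?_) ⟨k, Finset.mem_univ _, ?_⟩) ?_
      · exact h0 k
      · simpa using hk
      · simpa using hs'
  rw [cur_lift, length_lift]
  exact key _ _ _ _ (L.lab_state _ _) (L.st_state _ _)

theorem isHist_lift {τ : M.Hist} (h : M.IsHist τ) : L.mdp.IsHist (L.lift τ) := by
  induction τ with
  | nil => trivial
  | cons x τ ih =>
    obtain ⟨h1, h2, h3, ⟨k, hk, hc⟩, hs⟩ := h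
    refine ⟨ih h1, by rw [length_lift]; exact h2, ?_, ⟨⟨0, zero_lt_one⟩, zero_lt_one, ?_⟩, ?_⟩
    · change x.act ∈ M.avail _ (L.st _)
      rwa [length_lift, cur_lift, st_state]
    · exact (L.stepCost_lift τ x.act).symm
    · refine (L.trans_lift_pos_iff τ x.act _).2 ⟨k, x.next, hk, hs, ?_⟩
      rw [label, hc, update_costVal]

theorem sum_costFrom_succ (i : Fin m) (π : L.mdp.Policy) (n : ℕ) (τ : L.mdp.Hist) :
    SR.sum.costFrom L.mdp i π (n + 1) τ = ∑ a : Fin M.nA, (π τ a).toReal * ((L.stepCost τ a i : ℝ) +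
      ∑ y, (L.trans τ.length (L.mdp.cur τ) a y : ℝ) *
        SR.sum.costFrom L.mdp i π n (⟨a, L.stepCost τ a, y⟩ :: τ)) := by
  refine (fold_add _).trans (Finset.sum_congr rfl fun a _ => congrArg _ ?_)
  refine (fold_add _).trans ((Fin.sum_univ_one _).trans ?_)
  refine (congrArg (· * _) Rat.cast_one).trans ((one_mul _).trans (congrArg _ ?_))
  exact fold_add _

theorem max_costFrom_succ_le_iff (i : Fin m) (π : L.mdp.Policy) (n : ℕ) (τ : L.mdp.Hist) {d : ℝ}
    (hd : 0 ≤ d) :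
    SR.max.costFrom L.mdp i π (n + 1) τ ≤ d ↔ ∀ a : Fin M.nA, 0 < (π τ a).toReal →
      (L.stepCost τ a i : ℝ) ≤ d ∧ ∀ y, 0 < L.trans τ.length (L.mdp.cur τ) a y →
        (L.stepCost τ a i : ℝ) +
          SR.max.costFrom L.mdp i π n (⟨a, L.stepCost τ a, y⟩ :: τ) ≤ d := by
  have hg : ∀ p x d' : ℝ, 0 ≤ d' → (SR.max.g p * x ≤ d' ↔ (0 < p → x ≤ d')) := by
    intro p x d' hd'
    by_cases hp : 0 < p <;> simp [SR.max, hp, hd']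
  refine (fold_max_le_iff _ _).trans ?_
  rw [and_iff_right hd]
  refine forall_congr' fun a => (hg _ _ _ hd).trans (imp_congr_right fun _ => ?_)
  refine (fold_max_le_iff _ _).trans ?_
  rw [and_iff_right hd]
  have h1 : SR.max.g ((1 : ℚ) : ℝ) = 1 := by rw [Rat.cast_one, SR.g_one]
  refine (Fin.forall_fin_one).trans ?_
  refine (iff_of_eq (congrArg (fun z => z * _ ≤ d) h1)).trans ?_
  rw [one_mul, ← le_sub_iff_add_le']
  refine (fold_max_le_iff _ _).trans ?_
  rw [sub_nonneg]
  refine and_congr_right fun h => forall_congr' fun y => ?_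
  rw [hg _ _ _ (sub_nonneg.2 h), le_sub_iff_add_le']
  refine imp_congr_left ?_
  exact Rat.cast_pos

variable {L}

/-- When the new cost is the conditional expectation of the increments of a potential `F`, the
expected new cost of a policy is the expected total increment of `F`. -/
theorem Agree.sum_costFrom {π' : L.mdp.Policy} {π : M.Policy} (hπ : L.Agree π' π) (i : Fin m)
    (F : M.Hist → ℝ)
    (hF : ∀ τ, M.Valid τ → τ.length < M.H → ∀ a,
      (L.cost τ.length (L.label τ) (M.cur τ) a i : ℝ) =
        ∑ k, (M.costProb τ.length (M.cur τ) a k : ℝ) * ∑ s', (M.trans τ.length (M.cur τ) a s' : ℝ) *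
          (F (⟨a, M.costVal τ.length (M.cur τ) a k, s'⟩ :: τ) - F τ))
    (n : ℕ) {τ : M.Hist} (hτ : M.Valid τ) (hn : τ.length + n = M.H) :
    SR.sum.costFrom L.mdp i π' n (L.lift τ) = M.expectFrom π F n τ - F τ := by
  induction n generalizing τ with
  | zero => simp [SR.costFrom, CaMDP.expectFrom]
  | succ n ih =>
    have h1 : F τ = ∑ a, (π τ a).toReal * F τ := by
      rw [← Finset.sum_mul, M.policy_sum_toReal, one_mul]
    rw [sum_costFrom_succ, CaMDP.expectFrom, hπ τ hτ, h1, ← Finset.sum_sub_distrib]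
    refine Finset.sum_congr rfl fun a _ => ?_
    rw [← mul_sub]
    congr 1
    have h2 : F τ = ∑ k, (M.costProb τ.length (M.cur τ) a k : ℝ) * F τ := by
      rw [← Finset.sum_mul, M.costProb_sum_real, one_mul]
    refine (congrArg (_ + ·) (L.sum_trans_lift τ a _)).trans ?_
    rw [stepCost_lift, hF τ hτ (by omega) a]
    conv_rhs => rw [h2]
    rw [← Finset.sum_add_distrib, ← Finset.sum_sub_distrib]
    refine Finset.sum_congr rfl fun k _ => ?_
    rw [← mul_add, ← mul_sub, ← Finset.sum_add_distrib]
    congr 1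
    have h3 : F τ = ∑ s', (M.trans τ.length (M.cur τ) a s' : ℝ) * F τ := by
      rw [← Finset.sum_mul, M.trans_sum_real, one_mul]
    conv_rhs => rw [h3]
    rw [← Finset.sum_sub_distrib]
    refine Finset.sum_congr rfl fun s' _ => ?_
    rw [ih (hτ.cons (by omega) a k s') (by simp; omega)]
    ring

/-- When each new cost dominates the potentials `φ` that it may lead to, the worst-case total cost
dominates the potentials of the complete histories. -/
theorem Agree.le_of_max_costFrom_le {π' : L.mdp.Policy} {π : M.Policy} (hπ : L.Agree π' π)
    (i : Fin m) (φ : M.Hist → ℝ)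
    (hc : ∀ τ, M.Valid τ → τ.length < M.H → ∀ a, 0 ≤ L.cost τ.length (L.label τ) (M.cur τ) a i)
    (hφ : ∀ τ, M.Valid τ → τ.length < M.H → ∀ a k, 0 < M.costProb τ.length (M.cur τ) a k → ∀ s',
      φ (⟨a, M.costVal τ.length (M.cur τ) a k, s'⟩ :: τ) ≤
        L.cost τ.length (L.label τ) (M.cur τ) a i)
    {d : ℝ} (hd : 0 ≤ d) (n : ℕ) {τ : M.Hist} (hτ : M.Valid τ) (hn : τ.length + n = M.H)
    (hφτ : φ τ ≤ d) (hle : SR.max.costFrom L.mdp i π' n (L.lift τ) ≤ d) :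
    ∀ σ ∈ (M.lawFrom π n τ).support, φ σ ≤ d := by
  induction n generalizing τ with
  | zero =>
    intro σ hσ
    simp only [CaMDP.lawFrom, PMF.support_pure, Set.mem_singleton_iff] at hσ
    exact hσ ▸ hφτ
  | succ n ih =>
    intro σ hσ
    obtain ⟨a, ha, k, hk, s', hs', hσ⟩ := (M.mem_support_lawFrom_succ π n τ σ).1 hσ
    rw [L.max_costFrom_succ_le_iff i π' n _ hd, hπ τ hτ] at hle
    obtain ⟨h1, h2⟩ := hle a ha
    have h3 := h2 _ ((L.trans_lift_pos_iff τ a _).2 ⟨k, s', hk, hs', rfl⟩)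
    rw [← lift_cons, stepCost_lift] at h3
    rw [stepCost_lift] at h1
    have h4 : (0 : ℝ) ≤ L.cost τ.length (L.label τ) (M.cur τ) a i := by
      exact_mod_cast hc τ hτ (by omega) a
    exact ih (hτ.cons (by omega) a k s') (by simp; omega)
      ((hφ τ hτ (by omega) a k hk s').trans h1) (by linarith) σ hσ

/-- If the potential never becomes positive, and new costs are only incurred on the way to
positive potentials, then the worst-case total cost vanishes. -/
theorem Agree.max_costFrom_le_zero {π' : L.mdp.Policy} {π : M.Policy} (hπ : L.Agree π' π)
    (i : Fin m) (φ : M.Hist → ℝ)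
    (hmono : ∀ τ, M.Valid τ → τ.length < M.H → ∀ a k s',
      φ τ ≤ φ (⟨a, M.costVal τ.length (M.cur τ) a k, s'⟩ :: τ))
    (hc : ∀ τ, M.Valid τ → τ.length < M.H → ∀ a, (∀ k, 0 < M.costProb τ.length (M.cur τ) a k →
      ∀ s', φ (⟨a, M.costVal τ.length (M.cur τ) a k, s'⟩ :: τ) ≤ 0) →
        L.cost τ.length (L.label τ) (M.cur τ) a i ≤ 0)
    (hind : ∀ τ a k s' s'', φ (⟨a, M.costVal τ.length (M.cur τ) a k, s'⟩ :: τ) =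
      φ (⟨a, M.costVal τ.length (M.cur τ) a k, s''⟩ :: τ))
    (n : ℕ) {τ : M.Hist} (hτ : M.Valid τ) (hn : τ.length + n = M.H)
    (hφ : ∀ σ ∈ (M.lawFrom π n τ).support, φ σ ≤ 0) :
    SR.max.costFrom L.mdp i π' n (L.lift τ) ≤ 0 := by
  have hle : ∀ n (τ : M.Hist), M.Valid τ → τ.length + n = M.H →
      ∀ σ ∈ (M.lawFrom π n τ).support, φ τ ≤ φ σ := by
    intro n
    induction n with
    | zero =>
      intro τ _ _ σ hσ
      simp only [CaMDP.lawFrom, PMF.support_pure, Set.mem_singleton_iff] at hσ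
      rw [hσ]
    | succ n ih =>
      intro τ hτ hn σ hσ
      obtain ⟨a, -, k, -, s', -, hσ⟩ := (M.mem_support_lawFrom_succ π n τ σ).1 hσ
      exact (hmono τ hτ (by omega) a k s').trans
        (ih _ (hτ.cons (by omega) a k s') (by simp; omega) σ hσ)
  induction n generalizing τ with
  | zero => exact le_rfl
  | succ n ih =>
    rw [L.max_costFrom_succ_le_iff i π' n _ le_rfl, hπ τ hτ]
    intro a ha
    have hnext : ∀ k, 0 < M.costProb τ.length (M.cur τ) a k → ∀ s',
        φ (⟨a, M.costVal τ.length (M.cur τ) a k, s'⟩ :: τ) ≤ 0 := by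
      intro k hk s'
      obtain ⟨s'', hs''⟩ := M.exists_trans_pos τ.length (M.cur τ) a
      obtain ⟨σ, hσ⟩ := M.exists_mem_support_lawFrom π n
        (⟨a, M.costVal τ.length (M.cur τ) a k, s''⟩ :: τ)
      rw [hind τ a k s' s'']
      exact (hle n _ (hτ.cons (by omega) a k s'') (by simp; omega) σ hσ).trans
        (hφ σ ((M.mem_support_lawFrom_succ π n τ σ).2 ⟨a, ha, k, hk, s'', hs'', hσ⟩))
    have hca : (L.cost τ.length (L.label τ) (M.cur τ) a i : ℝ) ≤ 0 := by
      exact_mod_cast hc τ hτ (by omega) a hnext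
    rw [stepCost_lift]
    refine ⟨hca, fun y hy => ?_⟩
    obtain ⟨k, s', hk, hs', rfl⟩ := (L.trans_lift_pos_iff τ a y).1 hy
    have h1 := ih (hτ.cons (by omega) a k s') (by simp; omega) fun σ hσ =>
      hφ σ ((M.mem_support_lawFrom_succ π n τ σ).2 ⟨a, ha, k, hk, s', hs', hσ⟩)
    rw [lift_cons, stepCost_lift] at h1
    linarith

end Labelling

/-! ### Representations of processes and histories -/

theorem enc_ofFn_rat {n : ℕ} (v : Fin n → ℚ) : enc (List.ofFn v) = .ofVec v := by
  simp only [enc, Data.ofVec, List.map_ofFn]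
  rfl

namespace CaMDP

variable {m : ℕ} (M : CaMDP m)

/-- The cost distribution as a list of probabilities and cost vectors. -/
def costList (h : ℕ) (s : Fin M.nS) (a : Fin M.nA) : List (ℚ × List ℚ) :=
  List.ofFn fun k : Fin (M.nC h s a) => (M.costProb h s a k, List.ofFn (M.costVal h s a k))

/-- The entry of the table at a time, state and action. -/
def entry (h : ℕ) (s : Fin M.nS) (a : Fin M.nA) : Entry :=
  (if a ∈ M.avail h s then 1 else 0, M.rew h s a, M.costList h s a, List.ofFn (M.trans h s a))

/-- The table of entries. -/
def table : List (List (List Entry)) :=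
  (List.range M.H).map fun h => List.ofFn fun s => List.ofFn fun a => M.entry h s a

/-- The representation of a process as a tuple of lists. -/
def raw : Raw :=
  (List.ofFn fun s : Fin M.nS => (s : ℕ), List.ofFn fun a : Fin M.nA => (a : ℕ), (M.s₀ : ℕ),
    M.table)

theorem enc_ofFn_val (n : ℕ) : enc (List.ofFn fun i : Fin n => (i : ℕ)) =
    .ofVec fun i : Fin n => ((i : ℕ) : ℚ) := by
  simp only [enc, Data.ofVec, List.map_ofFn]
  rfl

theorem enc_raw : enc M.raw = M.code := by
  have h : enc M.table = .ofList ((List.range M.H).map fun h =>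
      .ofList <| List.ofFn fun s : Fin M.nS => .ofList <| List.ofFn fun a : Fin M.nA =>
        enc (M.entry h s a)) := by
    simp only [enc, table, List.map_map, List.map_ofFn, Function.comp_def]
  rw [raw, enc_mk, enc_mk, enc_mk, enc_ofFn_val, enc_ofFn_val, h]
  simp only [entry, costList, enc_mk, enc_ofFn_rat]
  simp only [enc, List.map_ofFn, Function.comp_def, ← Data.ofVec.eq_1]
  rfl

/-- The representation of a history as a list of tuples. -/
def rawHist (τ : M.Hist) : RawHist :=
  τ.map fun x => ((x.act : ℕ), List.ofFn x.cost, (x.next : ℕ))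

theorem enc_rawHist (τ : M.Hist) : enc (M.rawHist τ) = M.histCode τ := by
  simp only [rawHist, histCode, enc, List.map_map, Function.comp_def, Data.ofVec, List.map_ofFn]

/-- The represented instance with budgets `θ.1` and tolerances `θ.2`. -/
def input (θ : (Fin m → ℚ) × (Fin m → ℚ)) (ε : ℚ) : Input :=
  (M.raw, (List.ofFn θ.1, List.ofFn θ.2), ε)

end CaMDP

/-! ### Lists of labels -/

theorem idx_eq_range {α : Type} (l : List α) : idx l = List.range l.length := by
  rw [idx, List.zipIdx_map_snd, List.range_eq_range']

theorem ofFn_val_eq_range (n : ℕ) : (List.ofFn fun i : Fin n => (i : ℕ)) = List.range n := by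
  apply List.ext_getElem <;> simp

theorem getD_ofFn {α : Type} {n : ℕ} (f : Fin n → α) (i : Fin n) (d : α) :
    (List.ofFn f).getD i d = f i := by
  simp [List.getD_eq_getElem?_getD]

theorem mem_vecs {m : ℕ} {r n : List ℕ} : n ∈ vecs m r ↔ n.length = m ∧ ∀ v ∈ n, v ∈ r := by
  induction m generalizing n with
  | zero => cases n <;> simp [vecs]
  | succ m ih =>
    simp only [vecs, List.mem_flatMap, List.mem_map]
    constructor
    · rintro ⟨v, hv, n', hn', rfl⟩
      obtain ⟨h1, h2⟩ := ih.1 hn'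
      exact ⟨by simp [h1], by simpa [hv] using h2⟩
    · rintro ⟨h1, h2⟩
      cases n with
      | nil => simp at h1
      | cons v n =>
        exact ⟨v, h2 v (.head _), n, ih.2 ⟨by simpa using h1, fun w hw => h2 w (.tail _ hw)⟩, rfl⟩

theorem nodup_vecs {r : List ℕ} (hr : r.Nodup) (m : ℕ) : (vecs m r).Nodup := by
  induction m with
  | zero => simp [vecs]
  | succ m ih =>
    rw [vecs, List.nodup_flatMap]
    refine ⟨fun v _ => ih.map fun _ _ h => (List.cons.inj h).2, hr.imp fun {v w} hvw => ?_⟩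
    rw [Function.onFun, List.disjoint_left]
    intro n hn hn'
    obtain ⟨n1, -, rfl⟩ := List.mem_map.1 hn
    obtain ⟨n2, -, h2⟩ := List.mem_map.1 hn'
    exact hvw (List.cons.inj h2).1.symm

theorem head?_vecs (m : ℕ) (r : List ℕ) : (vecs m (0 :: r)).head? = some (List.replicate m 0) := by
  induction m with
  | zero => rfl
  | succ m ih =>
    rw [vecs, List.flatMap_cons, List.head?_append, List.head?_map, ih]
    rfl

theorem ext_of_getD {m : ℕ} {n n' : List ℕ} (hn : n.length = m) (hn' : n'.length = m)
    (h : ∀ i : Fin m, n.getD i 0 = n'.getD i 0) : n = n' := by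
  refine List.ext_getElem (hn.trans hn'.symm) fun i hi hi' => ?_
  have := h ⟨i, hn ▸ hi⟩
  simpa [List.getD_eq_getElem?_getD, hi, hi'] using this

namespace Inst

variable {m : ℕ} {y : Inst}

theorem mem_labels {lab : List ℕ × ℕ} : lab ∈ y.labels m ↔
    lab.2 < y.1.allCosts.length + 1 ∧ lab.1.length = m ∧ ∀ v ∈ lab.1, v ∈ y.2 := by
  obtain ⟨n, k⟩ := lab
  simp only [labels, idx_eq_range, List.mem_flatMap, List.mem_map, List.mem_range,
    List.length_cons, mem_vecs, Prod.mk.injEq]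
  constructor
  · rintro ⟨k', h1, n', h2, rfl, rfl⟩
    exact ⟨h1, h2⟩
  · rintro ⟨h1, h2⟩
    exact ⟨k, h1, n, h2, rfl, rfl⟩

theorem nodup_labels (hy : y.2.Nodup) : (y.labels m).Nodup := by
  rw [labels, idx_eq_range, List.nodup_flatMap]
  refine ⟨fun k _ => (nodup_vecs hy m).map fun _ _ h => (Prod.mk.inj h).1,
    List.nodup_range.imp fun {v w} hvw => ?_⟩
  rw [Function.onFun, List.disjoint_left]
  intro n hn hn'
  obtain ⟨n1, -, rfl⟩ := List.mem_map.1 hn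
  obtain ⟨n2, -, h2⟩ := List.mem_map.1 hn'
  exact hvw (Prod.mk.inj h2).2.symm

theorem head?_labels {r : List ℕ} (hy : y.2 = 0 :: r) :
    (y.labels m).head? = some (List.replicate m 0, 0) := by
  rw [labels, idx_eq_range, List.length_cons, List.range_succ_eq_map, List.flatMap_cons,
    List.head?_append, List.head?_map, hy, head?_vecs]
  rfl

theorem match_iff {lab lab' : List ℕ × ℕ} (h : lab ∈ y.labels m) (h' : lab'.1.length = m) :
    (lab'.2 = lab.2 ∧ ∀ i : Fin m, lab.1.getD i 0 = lab'.1.getD i 0) ↔ lab' = lab := by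
  constructor
  · rintro ⟨h1, h2⟩
    exact Prod.ext (ext_of_getD h' (mem_labels.1 h).2.1 fun i => (h2 i).symm) h1
  · rintro rfl
    exact ⟨rfl, fun _ => rfl⟩

end Inst

namespace Input

variable {m : ℕ} (x : Input)

theorem length_advance (n c) : (x.advance m n c).length = m := List.length_ofFn

theorem advance_getD (n c) (i : Fin m) :
    (x.advance m n c).getD i 0 = min (x.cap m) (n.getD i 0 + x.incr i c) := getD_ofFn _ _ _

theorem advance_le (n c) : ∀ v ∈ x.advance m n c, v ≤ x.cap m := by
  intro v hv
  rw [advance, List.mem_ofFn'] at hv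
  obtain ⟨i, rfl⟩ := hv
  exact min_le_left _ _

theorem counts_getD (σ : RawHist) (i : Fin m) :
    (x.counts m σ).getD i 0 = min (x.cap m) (σ.map fun s => x.incr i s.2.1).sum := getD_ofFn _ _ _

theorem counts_nil : x.counts m [] = List.replicate m 0 := by
  rw [counts, ← List.ofFn_const]
  simp

theorem counts_cons (s : ℕ × List ℚ × ℕ) (σ : RawHist) :
    x.counts m (s :: σ) = x.advance m (x.counts m σ) s.2.1 := by
  rw [counts, advance]
  congr 1
  funext i
  rw [counts_getD, List.map_cons, List.sum_cons]
  omega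

end Input

/-! ### The labelling by rounded costs -/

namespace CaMDP

variable {m : ℕ} (M : CaMDP m) (K : Fin m → ConstraintKind) (θ : (Fin m → ℚ) × (Fin m → ℚ)) (ε : ℚ)

/-- The represented instance with the list of possible values of the counters. -/
def inst : Inst := (M.input θ ε, List.range ((M.input θ ε).cap m + 1))

theorem horizon_input : (M.input θ ε).horizon = M.H := by
  simp [Input.horizon, input, raw, table]

theorem mem_allCosts {c : List ℚ} : c ∈ (M.input θ ε).allCosts ↔
    ∃ h < M.H, ∃ s a k, List.ofFn (M.costVal h s a k) = c := by
  simp [Input.allCosts, input, raw, table, entry, costList, List.mem_ofFn', and_assoc]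

theorem nC_le_length_allCosts {h : ℕ} (hh : h < M.H) (s a) :
    M.nC h s a ≤ (M.input θ ε).allCosts.length := by
  have h1 : ∀ {α β : Type} (l : List α) (f : α → List β) (a : α), a ∈ l →
      (f a).length ≤ (l.flatMap f).length := fun l f a ha => by
    rw [List.flatMap_def]
    exact (List.sublist_flatten_of_mem (List.mem_map_of_mem ha)).length_le
  refine le_trans ?_ (h1 _ _ (List.ofFn fun s => List.ofFn fun a => M.entry h s a)
    (List.mem_map.2 ⟨h, List.mem_range.2 hh, rfl⟩))
  refine le_trans ?_ (h1 _ _ (List.ofFn fun a => M.entry h s a) (List.mem_ofFn.2 ⟨s, rfl⟩))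
  refine le_trans ?_ (h1 _ _ (M.entry h s a) (List.mem_ofFn.2 ⟨a, rfl⟩))
  simp [entry, costList]

theorem labels_pos : 0 < ((M.inst θ ε).labels m).length := by
  have h := Inst.head?_labels (m := m) (y := M.inst θ ε) List.range_succ_eq_map
  rw [List.length_pos_iff]
  intro h0
  simp [h0] at h

/-- The label that follows the counters `n` after the cost outcome `k`. -/
def nextLabel (n : List ℕ) (h : ℕ) (s : Fin M.nS) (a : Fin M.nA) (k : Fin (M.nC h s a)) :
    List ℕ × ℕ :=
  ((M.input θ ε).advance m n (List.ofFn (M.costVal h s a k)), k)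

theorem nextLabel_mem (n) {h : ℕ} (hh : h < M.H) (s a k) :
    M.nextLabel θ ε n h s a k ∈ (M.inst θ ε).labels m := by
  refine Inst.mem_labels.2 ⟨?_, Input.length_advance _ _ _, fun v hv => ?_⟩
  · exact (k.2.trans_le (M.nC_le_length_allCosts θ ε hh s a)).trans (Nat.lt_succ_self _)
  · exact List.mem_range.2 (Nat.lt_succ_of_le (Input.advance_le _ _ _ v hv))

/-- The counters and the last outcome that a label stands for. -/
def labelVal (j : Fin ((M.inst θ ε).labels m).length) : List ℕ × ℕ :=
  ((M.inst θ ε).labels m).get j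

theorem labelVal_mem (j) : M.labelVal θ ε j ∈ (M.inst θ ε).labels m := List.get_mem _ _

theorem labelVal_injective : Function.Injective (M.labelVal θ ε) :=
  List.nodup_iff_injective_get.1 (Inst.nodup_labels List.nodup_range)

/-- The position of a label, `0` if it does not occur in the list of labels. -/
def labelPos (lab : List ℕ × ℕ) : Fin ((M.inst θ ε).labels m).length :=
  if hl : lab ∈ (M.inst θ ε).labels m then ⟨_, List.idxOf_lt_length_iff.2 hl⟩
  else ⟨0, M.labels_pos θ ε⟩

theorem labelVal_labelPos {lab : List ℕ × ℕ} (h : lab ∈ (M.inst θ ε).labels m) :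
    M.labelVal θ ε (M.labelPos θ ε lab) = lab := by
  simp only [labelPos, dif_pos h]
  exact List.getElem_idxOf (List.idxOf_lt_length_iff.2 h)

/-- The labelling of the states by the rounded accumulated costs and the last cost outcome. At times
beyond the horizon the label is immaterial. -/
def labelling : Labelling M where
  J := ((M.inst θ ε).labels m).length
  init := ⟨0, M.labels_pos θ ε⟩
  next h j s a k := M.labelPos θ ε (M.nextLabel θ ε (M.labelVal θ ε j).1 h s a k)
  cost h j s a i := (M.input θ ε).newCost m i (K i) (M.labelVal θ ε j).1 (M.costList h s a)
  inj h hh j s a k k' hk := by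
    have h1 := M.labelVal_labelPos θ ε (M.nextLabel_mem θ ε (M.labelVal θ ε j).1 hh s a k)
    have h2 := M.labelVal_labelPos θ ε (M.nextLabel_mem θ ε (M.labelVal θ ε j).1 hh s a k')
    dsimp only at hk
    rw [hk, h2] at h1
    exact Fin.ext (Prod.mk.inj h1).2.symm

theorem labelVal_init : M.labelVal θ ε (M.labelling K θ ε).init = (List.replicate m 0, 0) := by
  have h := Inst.head?_labels (m := m) (y := M.inst θ ε) List.range_succ_eq_map
  rw [List.head?_eq_getElem?, List.getElem?_eq_getElem (M.labels_pos θ ε)] at h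
  exact Option.some.inj h

theorem labelVal_next {h : ℕ} (hh : h < M.H) (j s a k) :
    M.labelVal θ ε ((M.labelling K θ ε).next h j s a k) =
      M.nextLabel θ ε (M.labelVal θ ε j).1 h s a k := by
  exact M.labelVal_labelPos θ ε (M.nextLabel_mem θ ε _ hh s a k)

theorem cost_labelling (h j s a i) : (M.labelling K θ ε).cost h j s a i =
    (M.input θ ε).newCost m i (K i) (M.labelVal θ ε j).1 (M.costList h s a) := rfl

end CaMDP

/-! ### The reduction on representations computes the labelled process -/

theorem sum_zipIdx_ofFn {α R : Type} [AddCommMonoid R] {n : ℕ} (f : Fin n → α) (g : α × ℕ → R) :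
    (((List.ofFn f).zipIdx).map g).sum = ∑ k : Fin n, g (f k, k) := by
  have h : (List.ofFn f).zipIdx = List.ofFn fun k : Fin n => (f k, (k : ℕ)) := by
    apply List.ext_getElem <;> simp
  rw [h, List.map_ofFn, List.sum_ofFn]
  rfl

theorem Labelling.state_val {m : ℕ} {M : CaMDP m} (L : Labelling M) (j : Fin L.J) (s : Fin M.nS) :
    (L.state j s : ℕ) = s + M.nS * j := rfl

theorem Labelling.ofFn_states {m : ℕ} {M : CaMDP m} (L : Labelling M) {β : Type}
    (F : Fin (L.J * M.nS) → β) :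
    List.ofFn F = (List.finRange L.J).flatMap fun j => List.ofFn fun s => F (L.state j s) := by
  rw [List.ofFn_mul, List.flatMap_def, ← List.ofFn_eq_map]
  congr 2
  funext j
  congr 1
  funext s
  congr 1
  exact Fin.ext ((L.state_val j s).trans (by ring)).symm

namespace CaMDP

variable {m : ℕ} (M : CaMDP m) (K : Fin m → ConstraintKind) (θ : (Fin m → ℚ) × (Fin m → ℚ)) (ε : ℚ)

theorem labels_flatMap {β : Type} (g : List ℕ × ℕ → List β) :
    ((M.inst θ ε).labels m).flatMap g =
      (List.finRange ((M.inst θ ε).labels m).length).flatMap fun j => g (M.labelVal θ ε j) := by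
  conv_lhs => rw [← List.map_get_finRange ((M.inst θ ε).labels m)]
  rw [List.flatMap_map]
  rfl

theorem labelProb_eq {h : ℕ} (hh : h < M.H) (j j' : Fin (M.labelling K θ ε).J) (s : Fin M.nS)
    (a : Fin M.nA) :
    (M.inst θ ε).labelProb m (M.labelVal θ ε j).1 (M.costList h s a) (M.labelVal θ ε j') =
      ∑ k, if (M.labelling K θ ε).next h j s a k = j' then M.costProb h s a k else 0 := by
  rw [Inst.labelProb, costList, sum_zipIdx_ofFn]
  refine Finset.sum_congr rfl fun k _ => if_congr ?_ rfl rfl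
  refine (Inst.match_iff (lab' := M.nextLabel θ ε (M.labelVal θ ε j).1 h s a k)
    (M.labelVal_mem θ ε j') (Input.length_advance _ _ _)).trans ?_
  rw [← M.labelVal_next K θ ε hh]
  exact (M.labelVal_injective θ ε).eq_iff

theorem entry_mdp {h : ℕ} (hh : h < M.H) (j : Fin (M.labelling K θ ε).J) (s : Fin M.nS)
    (a : Fin M.nA) :
    (M.labelling K θ ε).mdp.entry h ((M.labelling K θ ε).state j s) a =
      (M.inst θ ε).newEntry K (M.labelVal θ ε j) (M.entry h s a) := by
  let L := M.labelling K θ ε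
  have h1 : (L.mdp.entry h (L.state j s) a).1 = (M.entry h s a).1 := by
    change (if a ∈ M.avail h (L.st _) then (1 : ℚ) else 0) = _
    rw [L.st_state]
    rfl
  have h2 : L.mdp.rew h (L.state j s) a = M.rew h s a := by
    change M.rew h (L.st _) a = _
    rw [L.st_state]
  have h3 : L.mdp.costList h (L.state j s) a =
      [((1 : ℚ), (M.input θ ε).newCosts K (M.labelVal θ ε j).1 (M.costList h s a))] := by
    change [((1 : ℚ), List.ofFn (L.cost h (L.lab _) (L.st _) a))] = _
    rw [L.lab_state, L.st_state]
    rfl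
  have h4 : List.ofFn (L.mdp.trans h (L.state j s) a) =
      ((M.inst θ ε).labels m).flatMap fun lab' => (List.ofFn (M.trans h s a)).map fun q =>
        (M.inst θ ε).labelProb m (M.labelVal θ ε j).1 (M.costList h s a) lab' * q := by
    rw [labels_flatMap]
    refine (L.ofFn_states _).trans ?_
    refine congrArg (fun f => List.flatMap f (List.finRange L.J)) (funext fun j' => ?_)
    rw [List.map_ofFn]
    refine congrArg List.ofFn (funext fun s' => ?_)
    rw [Function.comp_apply, M.labelProb_eq K θ ε hh]
    have key : ∀ x y, L.lab x = j → L.st x = s → L.lab y = j' → L.st y = s' →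
        L.trans h x a y = (∑ k, if L.next h j s a k = j' then M.costProb h s a k else 0) *
          M.trans h s a s' := by
      rintro x y rfl rfl rfl rfl
      rfl
    exact key _ _ (L.lab_state _ _) (L.st_state _ _) (L.lab_state _ _) (L.st_state _ _)
  exact Prod.ext h1 (Prod.ext h2 (Prod.ext h3 h4))

/-- The reduction on representations computes the labelled process. -/
theorem raw_mdp : (M.labelling K θ ε).mdp.raw = (M.inst θ ε).newRaw K := by
  set L := M.labelling K θ ε
  have h1 : (List.ofFn fun s : Fin L.mdp.nS => (s : ℕ)) =
      idx (((M.inst θ ε).labels m).flatMap fun _ => (M.inst θ ε).1.1.1) := by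
    rw [idx_eq_range, ofFn_val_eq_range, List.length_flatMap]
    congr 1
    change L.J * M.nS = _
    simp only [inst, input, raw, List.length_ofFn, List.map_const', List.sum_replicate,
      smul_eq_mul]
    rfl
  have h2 : ((L.mdp.s₀ : Fin (L.J * M.nS)) : ℕ) = M.s₀ := by
    change (L.state L.init M.s₀ : ℕ) = _
    rw [L.state_val]
    exact (congrArg _ (mul_zero _)).trans (add_zero _)
  have h3 : L.mdp.table = M.table.map fun R => ((M.inst θ ε).labels m).flatMap fun lab =>
      R.map fun A => A.map fun e => (M.inst θ ε).newEntry K lab e := by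
    rw [table, table, List.map_map]
    refine List.map_congr_left fun h hh => ?_
    refine (L.ofFn_states _).trans (Eq.trans ?_ (M.labels_flatMap θ ε _).symm)
    refine congrArg (fun f => List.flatMap f (List.finRange L.J)) (funext fun j => ?_)
    rw [List.map_ofFn]
    refine congrArg List.ofFn (funext fun s => ?_)
    rw [Function.comp_apply, List.map_ofFn]
    exact congrArg List.ofFn (funext fun a => M.entry_mdp K θ ε (List.mem_range.1 hh) j s a)
  rw [raw, h1, h2, h3]
  rfl

theorem entryAt_input {h : ℕ} (hh : h < M.H) (s : Fin M.nS) (a : Fin M.nA) :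
    (M.input θ ε).entryAt h s a = [M.entry h s a] := by
  simp [Input.entryAt, pick_eq, input, raw, table, hh]

theorem curState_rawHist (τ : M.Hist) : (M.input θ ε).curState (M.rawHist τ) = M.cur τ := by
  cases τ <;> rfl

theorem length_rawHist (τ : M.Hist) : (M.rawHist τ).length = τ.length := by
  simp [rawHist]

theorem labelVal_label {τ : M.Hist} (hτ : M.Valid τ) :
    M.labelVal θ ε ((M.labelling K θ ε).label τ) =
      ((M.input θ ε).counts m (M.rawHist τ), (M.input θ ε).lastOutcome m (M.rawHist τ)) := by
  induction τ with
  | nil =>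
    change M.labelVal θ ε (M.labelling K θ ε).init = _
    rw [labelVal_init, ← Input.counts_nil (M.input θ ε)]
    rfl
  | cons x τ ih =>
    obtain ⟨h1, h2, k, hk⟩ := hτ
    rw [Labelling.label, hk, Labelling.update_costVal, M.labelVal_next K θ ε h2, nextLabel, ih h1]
    refine Prod.ext ?_ ?_
    · change _ = (M.input θ ε).counts m (_ :: M.rawHist τ)
      rw [Input.counts_cons, ← hk]
    · change (k : ℕ) = (M.input θ ε).outcome m _ (M.rawHist τ)
      rw [Input.outcome, length_rawHist, curState_rawHist, entryAt_input _ _ _ h2]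
      rw [List.flatMap_cons, List.flatMap_nil, List.append_nil, entry, costList, sum_zipIdx_ofFn,
        Finset.sum_eq_single k]
      · simp only [hk]
        simp
      · intro k' _ hk'
        refine if_neg fun hc => hk' (M.costVal_injective _ _ _ (funext fun i => ?_))
        have := hc i
        rwa [getD_ofFn, getD_ofFn, hk] at this
      · simp

theorem labelIndex_labelVal (j) :
    (M.inst θ ε).labelIndex m (M.labelVal θ ε j).1 (M.labelVal θ ε j).2 = j := by
  have h : (M.inst θ ε).labels m = List.ofFn (M.labelVal θ ε) := (List.ofFn_get _).symm
  rw [Inst.labelIndex]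
  conv_lhs => rw [h]
  rw [sum_zipIdx_ofFn, Finset.sum_eq_single j]
  · simp
  · intro j' _ hj'
    refine if_neg fun hc => hj' (M.labelVal_injective θ ε (Eq.symm ?_))
    exact (Inst.match_iff (M.labelVal_mem θ ε j')
      (Inst.mem_labels.1 (M.labelVal_mem θ ε j)).2.1).1 ⟨hc.1.symm, hc.2⟩
  · simp

theorem stateIndex_rawHist {τ : M.Hist} (hτ : M.Valid τ) :
    (M.inst θ ε).stateIndex m (M.rawHist τ) =
      ((M.labelling K θ ε).state ((M.labelling K θ ε).label τ) (M.cur τ) : ℕ) := by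
  have h := M.labelVal_label K θ ε hτ
  have h1 := congrArg Prod.fst h
  have h2 := congrArg Prod.snd h
  dsimp only at h1 h2
  rw [Inst.stateIndex, Labelling.state_val]
  change (M.input θ ε).curState _ + M.raw.1.length * (M.inst θ ε).labelIndex m
    ((M.input θ ε).counts m _) ((M.input θ ε).lastOutcome m _) = _
  rw [← h1, ← h2, curState_rawHist, raw, List.length_ofFn]
  exact congrArg (fun n => (M.cur τ : ℕ) + M.nS * n) (M.labelIndex_labelVal θ ε _)

/-- The translation of represented histories computes the lift to the labelled process. -/
theorem rawHist_lift {τ : M.Hist} (hτ : M.Valid τ) :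
    (M.labelling K θ ε).mdp.rawHist ((M.labelling K θ ε).lift τ) =
      (M.inst θ ε).translate K (M.rawHist τ) := by
  induction τ with
  | nil => rfl
  | cons x τ ih =>
    have hx := M.stateIndex_rawHist K θ ε hτ
    obtain ⟨h1, h2, -⟩ := hτ
    have hc := congrArg Prod.fst (M.labelVal_label K θ ε h1)
    dsimp only at hc
    have hcost : ((M.input θ ε).entryAt (M.rawHist τ).length
          ((M.input θ ε).curState (M.rawHist τ)) x.act).flatMap (fun e =>
        (M.input θ ε).newCosts K ((M.input θ ε).counts m (M.rawHist τ)) e.2.2.1) =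
        List.ofFn ((M.labelling K θ ε).cost τ.length ((M.labelling K θ ε).label τ)
          (M.cur τ) x.act) := by
      rw [length_rawHist, curState_rawHist, entryAt_input _ _ _ h2, List.flatMap_cons,
        List.flatMap_nil, List.append_nil, ← hc]
      rfl
    change _ :: (M.labelling K θ ε).mdp.rawHist ((M.labelling K θ ε).lift τ) =
      (_, _, _) :: (M.inst θ ε).translate K (M.rawHist τ)
    rw [ih h1]
    congr 1
    refine Prod.ext rfl (Prod.ext hcost.symm hx.symm)

end CaMDP

/-! ### Rounding -/

namespace CaMDP

variable {m : ℕ} (M : CaMDP m) (K : Fin m → ConstraintKind) (θ : (Fin m → ℚ) × (Fin m → ℚ)) (ε : ℚ)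

theorem budget_input (i : Fin m) : (M.input θ ε).2.1.1.getD i 0 = θ.1 i := getD_ofFn _ _ _

theorem tolerance_input (i : Fin m) : (M.input θ ε).2.1.2.getD i 0 = θ.2 i := getD_ofFn _ _ _

theorem unit_input : (M.input θ ε).unit = ε / (2 * ((M.H : ℚ) + 1)) := by
  rw [Input.unit, horizon_input]
  rfl

variable {ε} in
theorem unit_pos (hε : 0 < ε) : 0 < (M.input θ ε).unit := by
  rw [unit_input]
  positivity

theorem horizon_mul_unit_le (hε : 0 < ε) : M.H * (M.input θ ε).unit ≤ ε / 2 := by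
  rw [unit_input, mul_div_assoc', div_le_div_iff₀ (by positivity) two_pos]
  nlinarith

theorem spread_nonneg (i : ℕ) : 0 ≤ (M.input θ ε).spread i := by
  refine List.sum_nonneg fun r hr => ?_
  obtain ⟨c, -, rfl⟩ := List.mem_map.1 hr
  exact abs_nonneg _

theorem spread_le_totalSpread (i : Fin m) :
    (M.input θ ε).spread i ≤ (M.input θ ε).totalSpread m := by
  rw [Input.totalSpread, List.sum_ofFn]
  exact Finset.single_le_sum (f := fun i : Fin m => (M.input θ ε).spread i)
    (fun j _ => M.spread_nonneg θ ε j) (Finset.mem_univ i)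

theorem abs_cost_sub_le {h : ℕ} (hh : h < M.H) (s a k) (i : Fin m) :
    |M.costVal h s a k i - (M.input θ ε).refCost i| ≤ (M.input θ ε).spread i := by
  have h1 : List.ofFn (M.costVal h s a k) ∈ (M.input θ ε).allCosts :=
    (M.mem_allCosts θ ε).2 ⟨h, hh, s, a, k, rfl⟩
  have h2 := List.mem_map_of_mem
    (f := fun c : List ℚ => |c.getD i 0 - (M.input θ ε).refCost i|) h1
  rw [getD_ofFn] at h2
  refine List.single_le_sum (fun r hr => ?_) _ h2
  obtain ⟨c, -, rfl⟩ := List.mem_map.1 hr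
  exact abs_nonneg _

theorem base_le_cost {h : ℕ} (hh : h < M.H) (s a k) (i : Fin m) :
    (M.input θ ε).base i ≤ M.costVal h s a k i := by
  have := (abs_le.1 (M.abs_cost_sub_le θ ε hh s a k i)).1
  rw [Input.base]
  linarith

theorem cost_le_base_add {h : ℕ} (hh : h < M.H) (s a k) (i : Fin m) :
    M.costVal h s a k i ≤ (M.input θ ε).base i + 2 * (M.input θ ε).spread i := by
  have := (abs_le.1 (M.abs_cost_sub_le θ ε hh s a k i)).2
  rw [Input.base]
  linarith

/-- The rounded excess of an outcome over the lower bound. -/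
def roundCost (i : Fin m) (c : Fin m → ℚ) : ℕ := (M.input θ ε).incr i (List.ofFn c)

theorem roundCost_eq (i : Fin m) (c : Fin m → ℚ) :
    M.roundCost θ ε i c = ⌊(c i - (M.input θ ε).base i) / (M.input θ ε).unit⌋₊ := by
  rw [roundCost, Input.incr, getD_ofFn]

variable {ε}

theorem unit_mul_roundCost_le (hε : 0 < ε) {h : ℕ} (hh : h < M.H) (s a k) (i : Fin m) :
    (M.input θ ε).unit * M.roundCost θ ε i (M.costVal h s a k) ≤
      M.costVal h s a k i - (M.input θ ε).base i := by
  have hu := M.unit_pos θ hε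
  have h1 := sub_nonneg.2 (M.base_le_cost θ ε hh s a k i)
  rw [roundCost_eq, mul_comm, ← le_div_iff₀ hu]
  exact Nat.floor_le (div_nonneg h1 hu.le)

theorem le_unit_mul_roundCost (hε : 0 < ε) (i : Fin m) (c : Fin m → ℚ) :
    c i - (M.input θ ε).base i ≤
      (M.input θ ε).unit * M.roundCost θ ε i c + (M.input θ ε).unit := by
  have hu := M.unit_pos θ hε
  have := (Nat.lt_floor_add_one ((c i - (M.input θ ε).base i) / (M.input θ ε).unit)).le
  rw [← roundCost_eq, div_le_iff₀ hu] at this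
  linarith

theorem roundCost_le (hε : 0 < ε) {h : ℕ} (hh : h < M.H) (s a k) (i : Fin m) :
    M.roundCost θ ε i (M.costVal h s a k) ≤
      ⌊2 * (M.input θ ε).totalSpread m / (M.input θ ε).unit⌋₊ := by
  have hu := M.unit_pos θ hε
  have h1 := M.cost_le_base_add θ ε hh s a k i
  have h2 := M.spread_le_totalSpread θ ε i
  rw [roundCost_eq]
  refine Nat.floor_le_floor (div_le_div_of_nonneg_right ?_ hu.le)
  linarith

variable (ε)

/-- The accumulated rounded costs of a history. -/
def roundSum (i : Fin m) (τ : M.Hist) : ℕ := (τ.map fun x => M.roundCost θ ε i x.cost).sum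

/-- The counters after a history. -/
def counters (τ : M.Hist) : List ℕ := (M.input θ ε).counts m (M.rawHist τ)

theorem counters_getD_eq_min (i : Fin m) (τ : M.Hist) :
    (M.counters θ ε τ).getD i 0 = min ((M.input θ ε).cap m) (M.roundSum θ ε i τ) := by
  rw [counters, Input.counts_getD, rawHist, List.map_map]
  rfl

theorem counters_cons (τ : M.Hist) (a : Fin M.nA) (k) (s' : Fin M.nS) :
    M.counters θ ε (⟨a, M.costVal τ.length (M.cur τ) a k, s'⟩ :: τ) =
      (M.input θ ε).advance m (M.counters θ ε τ)
        (List.ofFn (M.costVal τ.length (M.cur τ) a k)) :=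
  Input.counts_cons _ _ _

theorem counters_mono (τ : M.Hist) (x) (i : Fin m) :
    (M.counters θ ε τ).getD i 0 ≤ (M.counters θ ε (x :: τ)).getD i 0 := by
  rw [counters_getD_eq_min, counters_getD_eq_min, roundSum, roundSum, List.map_cons,
    List.sum_cons]
  omega

variable {M} in
theorem Valid.length_le {τ : M.Hist} (h : M.Valid τ) : τ.length ≤ M.H := by
  cases τ with
  | nil => exact Nat.zero_le _
  | cons x τ => exact h.2.1

variable {ε}

theorem roundSum_le (hε : 0 < ε) (i : Fin m) {τ : M.Hist} (hτ : M.Valid τ) :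
    M.roundSum θ ε i τ ≤
      τ.length * ⌊2 * (M.input θ ε).totalSpread m / (M.input θ ε).unit⌋₊ := by
  induction τ with
  | nil => exact Nat.zero_le _
  | cons x τ ih =>
    obtain ⟨h1, h2, k, hk⟩ := hτ
    have h3 := M.roundCost_le θ hε h2 (M.cur τ) x.act k i
    rw [roundSum, List.map_cons, List.sum_cons, List.length_cons, add_mul, one_mul, hk, add_comm]
    exact Nat.add_le_add (ih h1) h3

/-- The cap on the counters is immaterial. -/
theorem counters_getD (hε : 0 < ε) (i : Fin m) {τ : M.Hist} (hτ : M.Valid τ) :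
    (M.counters θ ε τ).getD i 0 = M.roundSum θ ε i τ := by
  rw [counters_getD_eq_min, min_eq_right]
  rw [Input.cap, horizon_input]
  exact (M.roundSum_le θ hε i hτ).trans (Nat.mul_le_mul_right _ hτ.length_le)

theorem roundSum_bounds (hε : 0 < ε) (i : Fin m) {τ : M.Hist} (hτ : M.Valid τ) :
    τ.length * (M.input θ ε).base i + (M.input θ ε).unit * M.roundSum θ ε i τ ≤ M.totalCost i τ ∧
    M.totalCost i τ ≤ τ.length * (M.input θ ε).base i +
      (M.input θ ε).unit * M.roundSum θ ε i τ + τ.length * (M.input θ ε).unit := by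
  induction τ with
  | nil => simp [roundSum, totalCost]
  | cons x τ ih =>
    obtain ⟨h1, h2, k, hk⟩ := hτ
    obtain ⟨h3, h4⟩ := ih h1
    have h5 := M.unit_mul_roundCost_le θ hε h2 (M.cur τ) x.act k i
    have h6 := M.le_unit_mul_roundCost θ hε i x.cost
    rw [← hk] at h5
    simp only [roundSum, totalCost, List.map_cons, List.sum_cons, List.length_cons] at h3 h4 ⊢
    push_cast at h3 h4 ⊢
    constructor <;> linarith

/-- At the end of a complete history, the rounded total cost is at most the total cost, and less by
at most half the accuracy. -/
theorem level_bounds (hε : 0 < ε) (i : Fin m) {τ : M.Hist} (hτ : M.Valid τ) (hl : τ.length = M.H) :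
    (M.input θ ε).level i (M.counters θ ε τ) ≤ M.totalCost i τ ∧
      M.totalCost i τ ≤ (M.input θ ε).level i (M.counters θ ε τ) + ε / 2 := by
  have h1 := M.roundSum_bounds θ hε i hτ
  have h2 := M.horizon_mul_unit_le θ ε hε
  rw [Input.level, horizon_input, M.counters_getD θ hε i hτ]
  rw [hl] at h1
  exact ⟨h1.1, by linarith⟩

/-! ### The constraints in terms of the labelled process -/

theorem level_mono (hε : 0 < ε) (i : Fin m) {n n' : List ℕ} (h : n.getD i 0 ≤ n'.getD i 0) :
    (M.input θ ε).level i n ≤ (M.input θ ε).level i n' := by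
  have hu := M.unit_pos θ hε
  rw [Input.level, Input.level]
  gcongr

theorem level_nil (i : Fin m) (ε : ℚ) :
    (M.input θ ε).level i (M.counters θ ε []) = M.H * (M.input θ ε).base i := by
  rw [Input.level, horizon_input, counters_getD_eq_min]
  simp [roundSum]

theorem exceeds_nil (i : Fin m) (ε : ℚ) :
    (M.input θ ε).exceeds i [] = (M.input θ ε).exceeds i (M.counters θ ε []) := by
  rw [Input.exceeds, Input.exceeds, level_nil, Input.level, horizon_input]
  simp

theorem exceeds_eq (i : Fin m) (n : List ℕ) (ε : ℚ) : (M.input θ ε).exceeds i n =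
    if θ.1 i < (M.input θ ε).level i n then 1 else 0 := by
  rw [Input.exceeds, budget_input]

theorem penalty_eq (i : Fin m) (n : List ℕ) (ε : ℚ) : (M.input θ ε).penalty i n =
    2 * max ((M.input θ ε).level i n - θ.1 i) 0 := by
  rw [Input.penalty, budget_input]

theorem penalty_nonneg (i : Fin m) (n : List ℕ) (ε : ℚ) : 0 ≤ (M.input θ ε).penalty i n := by
  rw [penalty_eq]
  positivity

theorem labelVal_label_fst (ε : ℚ) {τ : M.Hist} (hτ : M.Valid τ) :
    (M.labelVal θ ε ((M.labelling K θ ε).label τ)).1 = M.counters θ ε τ :=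
  congrArg Prod.fst (M.labelVal_label K θ ε hτ)

theorem newCost_expectation (ε : ℚ) (i : Fin m) (n : List ℕ) (h s a) :
    (M.input θ ε).newCost m i .expectation n (M.costList h s a) =
      ∑ k, M.costProb h s a k * M.costVal h s a k i := by
  simp only [Input.newCost, costList, List.map_ofFn, List.sum_ofFn, Function.comp_apply, getD_ofFn]

theorem newCost_chance (ε : ℚ) (i : Fin m) (n : List ℕ) (h s a) :
    (M.input θ ε).newCost m i .chance n (M.costList h s a) =
      ∑ k, M.costProb h s a k * ((M.input θ ε).exceeds i
        ((M.input θ ε).advance m n (List.ofFn (M.costVal h s a k))) -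
          (M.input θ ε).exceeds i n) := by
  simp only [mul_sub, Finset.sum_sub_distrib, ← Finset.sum_mul, M.costProb_sum, one_mul]
  simp only [Input.newCost, costList, List.map_ofFn, List.sum_ofFn, Function.comp_apply]

theorem newCost_almostSure (ε : ℚ) (i : Fin m) (n : List ℕ) (h s a) :
    (M.input θ ε).newCost m i .almostSure n (M.costList h s a) =
      ∑ k, if 0 < M.costProb h s a k then (M.input θ ε).penalty i
        ((M.input θ ε).advance m n (List.ofFn (M.costVal h s a k))) else 0 := by
  simp only [Input.newCost, costList, List.map_ofFn, List.sum_ofFn, Function.comp_apply]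

theorem sum_costProb_sum_trans (h s a) (d : Fin (M.nC h s a) → ℝ) :
    ∑ k, (M.costProb h s a k : ℝ) * ∑ s', (M.trans h s a s' : ℝ) * d k =
      ∑ k, (M.costProb h s a k : ℝ) * d k := by
  simp only [← Finset.sum_mul, M.trans_sum_real, one_mul]

variable {K}

variable {M θ} {π' : (M.labelling K θ ε).mdp.Policy} {π : M.Policy}
  {i : Fin m}

/-- The potential is the accumulated cost itself; no rounding is involved. -/
theorem expectation_cost_eq (hπ : (M.labelling K θ ε).Agree π' π) (hi : K i = .expectation) :
    SR.sum.cost (M.labelling K θ ε).mdp i π' = M.expect π fun τ => (M.totalCost i τ : ℝ) := by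
  have h := hπ.sum_costFrom i (fun τ => (M.totalCost i τ : ℝ)) (fun τ hτ hl a => by
    have hd : ∀ (k) (s' : Fin M.nS),
        (M.totalCost i (⟨a, M.costVal τ.length (M.cur τ) a k, s'⟩ :: τ) : ℝ) -
          M.totalCost i τ = M.costVal τ.length (M.cur τ) a k i := fun k s' => by
      simp [totalCost]
    simp only [hd, sum_costProb_sum_trans]
    rw [cost_labelling, hi, newCost_expectation]
    push_cast
    rfl) M.H (τ := []) trivial (by simp)
  rw [expect_eq_expectFrom]
  refine h.trans ?_
  simp [totalCost]

/-- The potential is the indicator of a rounded total over budget. -/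
theorem chance_cost_eq (hπ : (M.labelling K θ ε).Agree π' π) (hi : K i = .chance) :
    SR.sum.cost (M.labelling K θ ε).mdp i π' =
      M.expectFrom π (fun τ => ((M.input θ ε).exceeds i (M.counters θ ε τ) : ℝ)) M.H [] -
        (M.input θ ε).exceeds i (M.counters θ ε []) := by
  refine hπ.sum_costFrom i (fun τ => ((M.input θ ε).exceeds i (M.counters θ ε τ) : ℝ))
    (fun τ hτ hl a => ?_) M.H (τ := []) trivial (by simp)
  simp only [counters_cons, sum_costProb_sum_trans]
  rw [cost_labelling, hi, newCost_chance, M.labelVal_label_fst K θ ε hτ]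
  push_cast
  rfl

theorem chance_cost_le (hπ : (M.labelling K θ ε).Agree π' π) (hε : 0 < ε) (hi : K i = .chance)
    (h : M.prob π {τ | θ.1 i < M.totalCost i τ} ≤ (θ.2 i : ℝ)) :
    SR.sum.cost (M.labelling K θ ε).mdp i π' ≤
      ((θ.2 i - (M.input θ ε).exceeds i [] : ℚ) : ℝ) := by
  classical
  rw [chance_cost_eq hπ hi, exceeds_nil]
  push_cast
  rw [prob_eq_expectFrom] at h
  gcongr
  refine le_trans ?_ h
  refine expectFrom_mono M M.H trivial (by simp) fun σ hσ hl => ?_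
  have h1 := (M.level_bounds θ hε i hσ hl).1
  rw [exceeds_eq]
  by_cases h2 : θ.1 i < (M.input θ ε).level i (M.counters θ ε σ)
  · rw [if_pos h2, if_pos (show σ ∈ {τ | θ.1 i < M.totalCost i τ} from h2.trans_le h1)]
    simp
  · rw [if_neg h2]
    split_ifs <;> simp

theorem chance_of_cost_le (hπ : (M.labelling K θ ε).Agree π' π) (hε : 0 < ε) (hi : K i = .chance)
    (h : SR.sum.cost (M.labelling K θ ε).mdp i π' ≤
      ((θ.2 i - (M.input θ ε).exceeds i [] : ℚ) : ℝ) + (ε : ℝ)) :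
    M.prob π {τ | θ.1 i + ε < M.totalCost i τ} ≤ ((θ.2 i + ε : ℚ) : ℝ) := by
  classical
  rw [chance_cost_eq hπ hi, exceeds_nil] at h
  push_cast at h ⊢
  rw [prob_eq_expectFrom]
  refine le_trans ?_ (by linarith : M.expectFrom π
    (fun τ => ((M.input θ ε).exceeds i (M.counters θ ε τ) : ℝ)) M.H [] ≤ _)
  refine expectFrom_mono M M.H trivial (by simp) fun σ hσ hl => ?_
  have h1 := (M.level_bounds θ hε i hσ hl).2
  rw [exceeds_eq]
  by_cases h2 : θ.1 i + ε < M.totalCost i σ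
  · rw [if_pos (show σ ∈ {τ | θ.1 i + ε < M.totalCost i τ} from h2), if_pos (by linarith)]
    simp
  · rw [if_neg (show σ ∉ {τ | θ.1 i + ε < M.totalCost i τ} from h2)]
    split_ifs <;> simp

/-- Rounding down keeps a feasible policy within budget, where all penalties vanish. -/
theorem almostSure_cost_le (hπ : (M.labelling K θ ε).Agree π' π) (hε : 0 < ε)
    (hi : K i = .almostSure) (h : M.prob π {τ | M.totalCost i τ ≤ θ.1 i} = 1) :
    SR.max.cost (M.labelling K θ ε).mdp i π' ≤ 0 := by
  rw [prob_eq_one_iff] at h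
  refine hπ.max_costFrom_le_zero i
    (fun τ => ((M.input θ ε).penalty i (M.counters θ ε τ) : ℝ)) (fun τ hτ hl a k s' => ?_)
    (fun τ hτ hl a hk => ?_) (fun τ a k s' s'' => ?_) M.H (τ := []) trivial (by simp)
    fun σ hσ => ?_
  · rw [penalty_eq, penalty_eq]
    have := M.level_mono θ hε i (M.counters_mono θ ε τ
      ⟨a, M.costVal τ.length (M.cur τ) a k, s'⟩ i)
    exact_mod_cast mul_le_mul_of_nonneg_left (max_le_max (sub_le_sub_right this _) le_rfl)
      two_pos.le
  · rw [cost_labelling, hi, newCost_almostSure, M.labelVal_label_fst K θ ε hτ]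
    refine Finset.sum_nonpos fun k _ => ?_
    split_ifs with hp
    · have := hk k hp M.s₀
      rw [counters_cons] at this
      exact_mod_cast this
    · exact le_rfl
  · simp only [counters_cons]
  · obtain ⟨hv, hl⟩ := valid_of_mem_support M M.H (τ := []) trivial (by simp) hσ
    have h1 := (M.level_bounds θ hε i hv hl).1
    have h2 : M.totalCost i σ ≤ θ.1 i := h σ hσ
    rw [penalty_eq, max_eq_right (by linarith), mul_zero, Rat.cast_zero]

/-- Each new cost is at least the penalty of the counters that follow, so every penalty is at most
`ε`, and the rounded total over budget by at most `ε / 2`. The assumption on the budget concerns the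
penalty of the initial counters, which no cost accounts for. -/
theorem almostSure_of_cost_le (hπ : (M.labelling K θ ε).Agree π' π) (hε : 0 < ε)
    (hi : K i = .almostSure) (hB : M.H * (M.input θ ε).base i ≤ θ.1 i)
    (h : SR.max.cost (M.labelling K θ ε).mdp i π' ≤ (ε : ℝ)) :
    M.prob π {τ | M.totalCost i τ ≤ θ.1 i + ε} = 1 := by
  rw [prob_eq_one_iff]
  have hε' : (0 : ℝ) ≤ ε := by exact_mod_cast hε.le
  have hpen := hπ.le_of_max_costFrom_le i
    (fun τ => ((M.input θ ε).penalty i (M.counters θ ε τ) : ℝ)) (fun τ hτ hl a => ?_)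
    (fun τ hτ hl a k hk s' => ?_) hε' M.H (τ := []) trivial (by simp) ?_ h
  · intro σ hσ
    obtain ⟨hv, hl⟩ := valid_of_mem_support M M.H (τ := []) trivial (by simp) hσ
    have h1 := (M.level_bounds θ hε i hv hl).2
    have h2 : (M.input θ ε).penalty i (M.counters θ ε σ) ≤ ε := by exact_mod_cast hpen σ hσ
    rw [penalty_eq] at h2
    have h3 := le_max_left ((M.input θ ε).level i (M.counters θ ε σ) - θ.1 i) 0
    change M.totalCost i σ ≤ θ.1 i + ε
    linarith
  · rw [cost_labelling, hi, newCost_almostSure]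
    refine Finset.sum_nonneg fun k _ => ?_
    split_ifs
    · exact M.penalty_nonneg θ i _ ε
    · exact le_rfl
  · rw [cost_labelling, hi, newCost_almostSure, M.labelVal_label_fst K θ ε hτ, counters_cons]
    have := Finset.single_le_sum (f := fun k => if 0 < M.costProb τ.length (M.cur τ) a k then
      (M.input θ ε).penalty i ((M.input θ ε).advance m (M.counters θ ε τ)
        (List.ofFn (M.costVal τ.length (M.cur τ) a k))) else 0) (fun k _ => by
          split_ifs
          · exact M.penalty_nonneg θ i _ ε
          · exact le_rfl) (Finset.mem_univ k)
    rw [if_pos hk] at this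
    exact_mod_cast this
  · rw [penalty_eq, level_nil, max_eq_right (by linarith), mul_zero, Rat.cast_zero]
    exact hε'

end CaMDP

/-! ### Bounds for the reduced instance -/

namespace CaMDP

variable {m : ℕ} {M : CaMDP m} {K : Fin m → ConstraintKind} {θ : (Fin m → ℚ) × (Fin m → ℚ)} {ε : ℚ}
  {R : ℕ}

theorem spread_le (hR : M.CostRangeLE R) (i : Fin m) :
    (M.input θ ε).spread i ≤ (M.input θ ε).allCosts.length * (R : ℚ) := by
  have h1 := List.sum_le_card_nsmul ((M.input θ ε).allCosts.map fun c : List ℚ =>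
    |c.getD i 0 - (M.input θ ε).refCost i|) (R : ℚ) fun r hr => by
      obtain ⟨c, hc, rfl⟩ := List.mem_map.1 hr
      have hne : (M.input θ ε).allCosts.headD [] ∈ (M.input θ ε).allCosts := by
        cases h : (M.input θ ε).allCosts with
        | nil => simp [h] at hc
        | cons b l => exact .head _
      obtain ⟨h, hh, s, a, k, rfl⟩ := (M.mem_allCosts θ ε).1 hc
      obtain ⟨h', hh', s', a', k', hk'⟩ := (M.mem_allCosts θ ε).1 hne
      rw [Input.refCost, ← hk', getD_ofFn, getD_ofFn, abs_le]
      have h1 := hR i h hh s a k h' hh' s' a' k'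
      have h2 := hR i h' hh' s' a' k' h hh s a k
      exact ⟨by linarith, h1⟩
  rw [List.length_map, nsmul_eq_mul] at h1
  exact h1

theorem totalSpread_le (hR : M.CostRangeLE R) :
    (M.input θ ε).totalSpread m ≤ ((m * (M.input θ ε).allCosts.length * R : ℕ) : ℚ) := by
  rw [Input.totalSpread, List.sum_ofFn]
  refine (Finset.sum_le_card_nsmul _ _ _ fun i _ => spread_le hR i).trans ?_
  simp [mul_assoc]

theorem totalSpread_nonneg : 0 ≤ (M.input θ ε).totalSpread m := by
  rw [Input.totalSpread, List.sum_ofFn]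
  exact Finset.sum_nonneg fun i _ => M.spread_nonneg θ ε i

theorem cap_le (hε : 0 < ε) (hR : M.CostRangeLE R) : (M.input θ ε).cap m ≤
    M.H * (4 * (m * (M.input θ ε).allCosts.length * R) * (M.H + 1) * ⌈1 / ε⌉₊) := by
  rw [Input.cap, horizon_input]
  refine Nat.mul_le_mul_left _ (Nat.floor_le_of_le ?_)
  have h1 := totalSpread_le (θ := θ) (ε := ε) hR
  have h2 := Nat.le_ceil (1 / ε)
  have h3 := totalSpread_nonneg (M := M) (θ := θ) (ε := ε)
  have h4 : 2 * (M.input θ ε).totalSpread m / (M.input θ ε).unit =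
      4 * (M.input θ ε).totalSpread m * (M.H + 1) * (1 / ε) := by
    rw [unit_input]
    field_simp
    ring
  rw [h4]
  push_cast at h1 ⊢
  gcongr

theorem unit_mul_cap_le (hε : 0 < ε) : (M.input θ ε).unit * (M.input θ ε).cap m ≤
    M.H * (2 * (M.input θ ε).totalSpread m) := by
  have hu := M.unit_pos θ hε
  rw [Input.cap, horizon_input]
  have h := Nat.floor_le (a := 2 * (M.input θ ε).totalSpread m / (M.input θ ε).unit)
    (div_nonneg (mul_nonneg two_pos.le totalSpread_nonneg) hu.le)
  rw [le_div_iff₀ hu] at h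
  push_cast
  calc _ = (M.H : ℚ) * (⌊2 * (M.input θ ε).totalSpread m / (M.input θ ε).unit⌋₊ *
        (M.input θ ε).unit) := by ring
    _ ≤ _ := by gcongr

theorem exceeds_mem_Icc (i : Fin m) (n : List ℕ) : 0 ≤ (M.input θ ε).exceeds i n ∧
    (M.input θ ε).exceeds i n ≤ 1 := by
  rw [exceeds_eq]
  split_ifs <;> simp

theorem penalty_le (hε : 0 < ε) (i : Fin m) (hB : M.H * (M.input θ ε).base i ≤ θ.1 i) (n : List ℕ)
    (hn : n.getD i 0 ≤ (M.input θ ε).cap m) :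
    (M.input θ ε).penalty i n ≤ 4 * M.H * (M.input θ ε).totalSpread m := by
  have hu := M.unit_pos θ hε
  have h1 : (M.input θ ε).unit * (n.getD i 0 : ℕ) ≤
      (M.input θ ε).unit * (M.input θ ε).cap m := by gcongr
  have h2 := unit_mul_cap_le (M := M) (θ := θ) hε
  have h3 := totalSpread_nonneg (M := M) (θ := θ) (ε := ε)
  rw [penalty_eq, Input.level, horizon_input]
  have h4 : max (M.H * (M.input θ ε).base i + (M.input θ ε).unit * (n.getD i 0 : ℕ) - θ.1 i) 0 ≤
      M.H * (2 * (M.input θ ε).totalSpread m) :=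
    max_le (by linarith) (by positivity)
  linarith

theorem plausible_input : (M.input θ ε).Plausible K ↔
    ∀ i : Fin m, K i = .almostSure → M.H * (M.input θ ε).base i ≤ θ.1 i := by
  simp only [Input.Plausible, horizon_input, budget_input]

theorem cost_labelling_nonneg {i : Fin m} (hi : K i = .almostSure) (h j s a) :
    0 ≤ (M.labelling K θ ε).cost h j s a i := by
  rw [cost_labelling, hi, newCost_almostSure]
  refine Finset.sum_nonneg fun k _ => ?_
  split_ifs
  · exact M.penalty_nonneg θ i _ ε
  · exact le_rfl

/-- The costs of the reduced process in one coordinate lie in an interval of polynomial length. -/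
theorem exists_cost_labelling_bounds (hε : 0 < ε) (hR : M.CostRangeLE R)
    (hpl : (M.input θ ε).Plausible K) (i : Fin m) : ∃ lo : ℚ, ∀ h < M.H, ∀ j s a,
      lo ≤ (M.labelling K θ ε).cost h j s a i ∧ (M.labelling K θ ε).cost h j s a i ≤
        lo + ((2 + (2 + 4 * (M.input θ ε).allCosts.length * M.H) *
          (m * (M.input θ ε).allCosts.length * R) : ℕ) : ℚ) := by
  have hT := totalSpread_le (θ := θ) (ε := ε) hR
  have hT0 := totalSpread_nonneg (M := M) (θ := θ) (ε := ε)
  set T : ℕ := m * (M.input θ ε).allCosts.length * R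
  set A : ℕ := (M.input θ ε).allCosts.length
  have hp : ∀ h s a k, (0 : ℚ) ≤ M.costProb h s a k := M.costProb_nonneg
  rcases hi : K i with _ | _ | _
  · refine ⟨(M.input θ ε).base i, fun h hh j s a => ?_⟩
    rw [cost_labelling, hi, newCost_expectation]
    have h1 : ∀ c : ℚ, ∑ k, M.costProb h s a k * c = c := fun c => by
      rw [← Finset.sum_mul, M.costProb_sum, one_mul]
    constructor
    · rw [← h1 ((M.input θ ε).base i)]
      exact Finset.sum_le_sum fun k _ =>
        mul_le_mul_of_nonneg_left (M.base_le_cost θ ε hh s a k i) (hp _ _ _ _)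
    · refine (Finset.sum_le_sum fun k _ =>
        mul_le_mul_of_nonneg_left (M.cost_le_base_add θ ε hh s a k i) (hp _ _ _ _)).trans ?_
      rw [h1]
      have h2 := M.spread_le_totalSpread θ ε i
      have h3 : (0 : ℚ) ≤ 4 * A * M.H * T := by positivity
      push_cast
      linarith
  · refine ⟨0, fun h hh j s a => ⟨cost_labelling_nonneg hi h j s a, ?_⟩⟩
    rw [cost_labelling, hi, newCost_almostSure]
    have hB := plausible_input.1 hpl i hi
    have h1 : ∀ k ∈ Finset.univ, (if 0 < M.costProb h s a k then (M.input θ ε).penalty i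
        ((M.input θ ε).advance m (M.labelVal θ ε j).1 (List.ofFn (M.costVal h s a k))) else 0) ≤
          4 * M.H * (T : ℚ) := fun k _ => by
      have h2 : 4 * M.H * (M.input θ ε).totalSpread m ≤ 4 * M.H * (T : ℚ) := by gcongr
      split_ifs
      · refine (penalty_le hε i hB _ ?_).trans h2
        rw [Input.advance_getD]
        exact min_le_left _ _
      · positivity
    refine (Finset.sum_le_card_nsmul _ _ _ h1).trans ?_
    have h2 : (M.nC h s a : ℚ) ≤ A := by exact_mod_cast M.nC_le_length_allCosts θ ε hh s a
    have h3 : (M.nC h s a : ℚ) * (4 * M.H * T) ≤ A * (4 * M.H * T) := by gcongr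
    have h4 : (0 : ℚ) ≤ T := by positivity
    rw [Finset.card_univ, Fintype.card_fin, nsmul_eq_mul]
    push_cast
    linarith
  · refine ⟨-1, fun h hh j s a => ?_⟩
    rw [cost_labelling, hi, newCost_chance]
    have h1 : ∀ c : ℚ, ∑ k, M.costProb h s a k * c = c := fun c => by
      rw [← Finset.sum_mul, M.costProb_sum, one_mul]
    constructor
    · conv_lhs => rw [← h1 (-1)]
      refine Finset.sum_le_sum fun k _ => mul_le_mul_of_nonneg_left ?_ (hp _ _ _ _)
      have h2 := exceeds_mem_Icc (M := M) (θ := θ) (ε := ε) i (M.labelVal θ ε j).1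
      have h3 := exceeds_mem_Icc (M := M) (θ := θ) (ε := ε) i
        ((M.input θ ε).advance m (M.labelVal θ ε j).1 (List.ofFn (M.costVal h s a k)))
      linarith
    · have h4 : (0 : ℚ) ≤ ((2 + 4 * A * M.H) * T : ℕ) := by positivity
      refine le_trans ?_ (show (1 : ℚ) ≤ _ by push_cast at h4 ⊢; linarith)
      conv_rhs => rw [← h1 1]
      refine Finset.sum_le_sum fun k _ => mul_le_mul_of_nonneg_left ?_ (hp _ _ _ _)
      have h2 := exceeds_mem_Icc (M := M) (θ := θ) (ε := ε) i (M.labelVal θ ε j).1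
      have h3 := exceeds_mem_Icc (M := M) (θ := θ) (ε := ε) i
        ((M.input θ ε).advance m (M.labelVal θ ε j).1 (List.ofFn (M.costVal h s a k)))
      linarith

theorem costRangeLE_mdp (hε : 0 < ε) (hR : M.CostRangeLE R) (hpl : (M.input θ ε).Plausible K) :
    (M.labelling K θ ε).mdp.CostRangeLE
      (2 + (2 + 4 * (M.input θ ε).allCosts.length * M.H) *
        (m * (M.input θ ε).allCosts.length * R)) := by
  intro i h hh x a k h' hh' x' a' k'
  obtain ⟨lo, hlo⟩ := exists_cost_labelling_bounds hε hR hpl i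
  have h1 := (hlo h hh ((M.labelling K θ ε).lab x) ((M.labelling K θ ε).st x) a).2
  have h2 := (hlo h' hh' ((M.labelling K θ ε).lab x') ((M.labelling K θ ε).st x') a').1
  refine (sub_le_sub h1 h2).trans ?_
  rw [add_sub_cancel_left]

theorem costVal_mdp_mem_dom (h x a k) (i : Fin m) :
    ((M.labelling K θ ε).mdp.costVal h x a k i : ℝ) ∈ (K i).sr.dom := by
  rcases hi : K i with _ | _ | _
  · trivial
  · change (0 : ℝ) ≤ ((M.labelling K θ ε).cost h ((M.labelling K θ ε).lab x)
      ((M.labelling K θ ε).st x) a i : ℚ)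
    exact_mod_cast cost_labelling_nonneg hi _ _ _ _
  · trivial

/-! ### Feasibility -/

variable (M K θ ε) in
/-- The budgets of the reduced instance. -/
def newBudget (i : Fin m) : ℚ :=
  match K i with
  | .expectation => θ.1 i
  | .almostSure => 0
  | .chance => θ.2 i - (M.input θ ε).exceeds i []

theorem newBudgets_input : (M.input θ ε).newBudgets K = List.ofFn (M.newBudget K θ ε) := by
  simp only [Input.newBudgets, budget_input, tolerance_input]
  rfl

variable {π' : (M.labelling K θ ε).mdp.Policy} {π : M.Policy}

/-- Feasible policies remain feasible in the reduced instance. -/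
theorem cost_le_of_holds (hπ : (M.labelling K θ ε).Agree π' π) (hε : 0 < ε) (i : Fin m)
    (h : (K i).Holds M i (θ.1 i + 0) (θ.2 i + 0) π) :
    (K i).sr.cost (M.labelling K θ ε).mdp i π' ≤ (M.newBudget K θ ε i : ℝ) + ((0 : ℚ) : ℝ) := by
  rw [add_zero, add_zero] at h
  rw [Rat.cast_zero, add_zero, newBudget]
  rcases hi : K i with _ | _ | _ <;> rw [hi] at h
  · exact (expectation_cost_eq hπ hi).trans_le h
  · exact (almostSure_cost_le hπ hε hi h).trans_eq Rat.cast_zero.symm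
  · exact chance_cost_le hπ hε hi h

/-- Policies that are feasible up to `ε` in the reduced instance are feasible up to `ε`. -/
theorem holds_of_cost_le (hπ : (M.labelling K θ ε).Agree π' π) (hε : 0 < ε)
    (hpl : (M.input θ ε).Plausible K) (i : Fin m)
    (h : (K i).sr.cost (M.labelling K θ ε).mdp i π' ≤ (M.newBudget K θ ε i : ℝ) + (ε : ℝ)) :
    (K i).Holds M i (θ.1 i + ε) (θ.2 i + ε) π := by
  rw [newBudget] at h
  rcases hi : K i with _ | _ | _ <;> rw [hi] at h
  · refine (expectation_cost_eq hπ hi).symm.trans_le (h.trans_eq ?_)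
    push_cast
    rfl
  · refine almostSure_of_cost_le hπ hε hi (plausible_input.1 hpl i hi) (h.trans_eq ?_)
    rw [Rat.cast_zero, zero_add]
  · exact chance_of_cost_le hπ hε hi h

/-- The rounded total of any history is at least `H` times the lower bound of the costs, so feasibility
forces plausibility. -/
theorem plausible_of_holds (hε : 0 < ε)
    (h : ∀ i, (K i).Holds M i (θ.1 i + 0) (θ.2 i + 0) π) : (M.input θ ε).Plausible K := by
  rw [plausible_input]
  intro i hi
  have h1 := h i
  rw [hi, add_zero] at h1
  have h2 := (prob_eq_one_iff M π _).1 h1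
  obtain ⟨σ, hσ⟩ := M.exists_mem_support_lawFrom π M.H []
  obtain ⟨hv, hl⟩ := valid_of_mem_support M M.H (τ := []) trivial (by simp) hσ
  have h3 : M.totalCost i σ ≤ θ.1 i := h2 σ hσ
  have h4 := (M.level_bounds θ hε i hv hl).1
  have h5 := M.level_mono θ hε i (n := M.counters θ ε []) (n' := M.counters θ ε σ)
    (by rw [counters_getD_eq_min]; simp [roundSum])
  rw [level_nil] at h5
  linarith

end CaMDP

/-! ### The size of the output of a program -/

/-- Every program reads its input, at a charge of its size. -/
theorem Run.size_lt {P : Prog} {x y : Data} {t : ℕ} (h : Run P x y t) : x.size < t := by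
  induction h <;> omega

/-- The size of the output is at most linear in the running time. -/
theorem Prog.exists_size_le (P : Prog) : ∃ c, ∀ x y t, Run P x y t → y.size ≤ c * t := by
  induction P with
  | op o =>
    obtain ⟨c, hc⟩ := o.size_apply_le
    refine ⟨2 + c, fun x y t h => ?_⟩
    cases h
    have := hc x
    nlinarith
  | pair P Q hP hQ =>
    obtain ⟨c, hc⟩ := hP
    obtain ⟨d, hd⟩ := hQ
    refine ⟨1 + c + d, fun x y t h => ?_⟩
    cases h with
    | pair h1 h2 =>
      have h1 := hc _ _ _ h1
      have h2 := hd _ _ _ h2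
      rw [Data.size]
      nlinarith
  | comp P Q hP hQ =>
    obtain ⟨c, hc⟩ := hQ
    refine ⟨c, fun x y t h => ?_⟩
    cases h with
    | comp h1 h2 => exact (hc _ _ _ h2).trans (Nat.mul_le_mul_left c (by omega))
  | ite C P Q hC hP hQ =>
    obtain ⟨c, hc⟩ := hP
    obtain ⟨d, hd⟩ := hQ
    refine ⟨c + d, fun x y t h => ?_⟩
    cases h with
    | ite_pos h1 _ h2 =>
      exact (hc _ _ _ h2).trans (Nat.mul_le_mul (by omega) (by omega))
    | ite_neg h1 _ h2 =>
      exact (hd _ _ _ h2).trans (Nat.mul_le_mul (by omega) (by omega))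
  | _ C P hC hP =>
    refine ⟨1, fun x y t h => ?_⟩
    generalize hW : Prog.while C P = W at h
    induction h with
    | while_stop h1 _ =>
      have := h1.size_lt
      omega
    | while_step h1 _ h2 h3 _ _ ih =>
      have := ih hW
      omega
    | _ => cases hW

/-! ### Tabulating the values of the counters -/

/-- The list of the numbers up to `W` is computed in time polynomial in `W` (and not only in the
bit size of `W`). -/
theorem exists_prog_range {α : Type} [Enc α] : ∃ (P : Prog) (p : Polynomial ℕ), ∀ (x : α) (W : ℕ),
    RunLe P (enc (x, W)) (enc (x, List.range (W + 1))) (p.eval ((enc x).size + W)) := by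
  obtain ⟨PI, pi, hI⟩ := PT.exists_runLe
    (f := fun a : α × ℕ => (a.1, a.2 + 1, ([] : List ℕ))) (by fun_prop)
  obtain ⟨PO, po, hO⟩ := PT.exists_runLe
    (f := fun a : α × ℕ × List ℕ => (a.1, a.2.2)) (by fun_prop)
  obtain ⟨PC, pc, hC⟩ := PT.exists_runLe (f := fun a : α × ℕ × List ℕ => a.2.1) (by fun_prop)
  obtain ⟨PS, ps, hS⟩ := PT.exists_runLe
    (f := fun a : α × ℕ × List ℕ => (a.1, ⌊(a.2.1 : ℚ) - 1⌋₊, ⌊(a.2.1 : ℚ) - 1⌋₊ :: a.2.2))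
    (by fun_prop)
  let S : Polynomial ℕ := 7 + 2 * .X + (.X + 1) * (.X + 4)
  let B : Polynomial ℕ := (pc + ps + po).comp S
  refine ⟨.comp PI (.comp (.while PC PS) PO),
    3 + pi.comp S + (.X + 2) * (2 * B + 1) + B, fun x W => ?_⟩
  -- The list is built from its end: after `i` passes it holds the last `i` numbers.
  let v : ℕ → α × ℕ × List ℕ := fun i => (x, W + 1 - i, List.range' (W + 1 - i) i)
  set n := (enc x).size + W with hn
  have hSe : S.eval n = 7 + 2 * n + (n + 1) * (n + 4) := by simp [S]
  have hv : ∀ i ≤ W + 1, (enc (v i)).size ≤ S.eval n := fun i hi => by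
    have h1 := size_nat_le (W + 1 - i)
    have h2 := size_list_le (l := List.range' (W + 1 - i) i) (k := W + 1) (B := W + 3)
      (by simpa using hi) fun a ha => by
        have h3 := size_nat_le a
        have h4 := List.mem_range'_1.1 ha
        omega
    have h3 : (W + 1) * (W + 3 + 1) ≤ (n + 1) * (n + 4) :=
      Nat.mul_le_mul (by omega) (by omega)
    simp only [v, enc_mk, Data.size]
    omega
  have hB : ∀ q ∈ [pc, ps, po], ∀ i ≤ W + 1, q.eval (enc (v i)).size ≤ B.eval n := by
    intro q hq i hi
    have h := poly_eval_mono q (hv i hi)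
    have h' : B.eval n = pc.eval (S.eval n) + ps.eval (S.eval n) + po.eval (S.eval n) := by
      simp [B]
    simp only [List.mem_cons, List.not_mem_nil, or_false] at hq
    rcases hq with rfl | rfl | rfl <;> omega
  have hW := RunLe.while (C := PC) (P := PS) (B := B.eval n) (W + 1) (fun i => enc (v i))
    (fun i hi => ⟨_, (hC (v i)).1.mono (hB _ (by simp) i hi.le), ?_⟩) (fun i hi => ?_)
    ⟨_, (hC (v (W + 1))).1.mono (hB _ (by simp) _ le_rfl), ?_⟩
  · have hfirst : enc (x, W + 1, ([] : List ℕ)) = enc (v 0) := rfl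
    have hlast : enc ((v (W + 1)).1, (v (W + 1)).2.2) = enc (x, List.range (W + 1)) := by
      simp only [v, Nat.sub_self, List.range_eq_range']
    have h1 := (hI (x, W)).1
    have h2 := (hO (v (W + 1))).1.mono (hB _ (by simp) _ le_rfl)
    rw [hlast] at h2
    rw [hfirst] at h1
    refine (RunLe.comp h1 (.comp hW h2)).mono ?_
    have h3 : (enc (x, W)).size ≤ S.eval n := by
      have := size_nat_le W
      rw [enc_mk, Data.size]
      nlinarith
    have h4 := poly_eval_mono pi h3
    have h5 : (W + 1 + 1) * (2 * B.eval n + 1) ≤ (n + 2) * (2 * B.eval n + 1) :=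
      Nat.mul_le_mul_right _ (by omega)
    simp only [Polynomial.eval_add, Polynomial.eval_mul, Polynomial.eval_comp, Polynomial.eval_X,
      Polynomial.eval_one, Polynomial.eval_ofNat] at h4 h5 ⊢
    omega
  · have h : 0 < W + 1 - i := by omega
    change (0 : ℚ) < ((W + 1 - i : ℕ) : ℚ)
    exact_mod_cast h
  · have h1 : ⌊(((v i).2.1 : ℕ) : ℚ) - 1⌋₊ = W + 1 - (i + 1) := by
      rw [Nat.floor_sub_one, Nat.floor_natCast]
      simp only [v]
      omega
    have h2 := (hS (v i)).1.mono (hB _ (by simp) i hi.le)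
    rw [h1] at h2
    have h3 : List.range' (W + 1 - (i + 1)) (i + 1) =
        (W + 1 - (i + 1)) :: List.range' (W + 1 - i) i := by
      rw [List.range'_succ]
      congr 2
      omega
    simp only [v, h3] at h2 ⊢
    exact h2
  · change ¬ (0 : ℚ) < ((W + 1 - (W + 1) : ℕ) : ℚ)
    simp

/-! ### Polynomial bounds over all instances -/

/-- The quantity `f` is bounded by a polynomial in the quantity `N`. -/
def PolyBounded {ι : Type} (N f : ι → ℕ) : Prop := ∃ p : Polynomial ℕ, ∀ i, f i ≤ p.eval (N i)

namespace PolyBounded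

variable {ι κ : Type} {N f g : ι → ℕ}

theorem mono (hg : PolyBounded N g) (h : ∀ i, f i ≤ g i) : PolyBounded N f := by
  obtain ⟨p, hp⟩ := hg
  exact ⟨p, fun i => (h i).trans (hp i)⟩

theorem of_le (h : ∀ i, f i ≤ N i) : PolyBounded N f := ⟨.X, by simpa using h⟩

theorem const (c : ℕ) : PolyBounded N fun _ => c := ⟨.C c, by simp⟩

theorem add (hf : PolyBounded N f) (hg : PolyBounded N g) : PolyBounded N fun i => f i + g i := by
  obtain ⟨p, hp⟩ := hf
  obtain ⟨q, hq⟩ := hg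
  exact ⟨p + q, fun i => by simpa using add_le_add (hp i) (hq i)⟩

theorem mul (hf : PolyBounded N f) (hg : PolyBounded N g) : PolyBounded N fun i => f i * g i := by
  obtain ⟨p, hp⟩ := hf
  obtain ⟨q, hq⟩ := hg
  exact ⟨p * q, fun i => by simpa using Nat.mul_le_mul (hp i) (hq i)⟩

theorem eval (p : Polynomial ℕ) (hf : PolyBounded N f) :
    PolyBounded N fun i => p.eval (f i) := by
  obtain ⟨q, hq⟩ := hf
  exact ⟨p.comp q, fun i => by simpa using poly_eval_mono p (hq i)⟩

theorem precomp {N' : κ → ℕ} (hf : PolyBounded N f) (φ : κ → ι) (h : ∀ j, N (φ j) ≤ N' j) :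
    PolyBounded N' fun j => f (φ j) := by
  obtain ⟨p, hp⟩ := hf
  exact ⟨p, fun j => (hp _).trans (poly_eval_mono p (h j))⟩

end PolyBounded

/-- A process with budgets, tolerances, an accuracy and a bound on the range of the costs. -/
structure Problem (m : ℕ) where
  /-- the process -/
  M : CaMDP m
  /-- the budgets and the tolerances -/
  θ : (Fin m → ℚ) × (Fin m → ℚ)
  /-- the accuracy -/
  ε : ℚ
  /-- the bound on the range of the costs -/
  R : ℕ
  ε_pos : 0 < ε
  range_le : M.CostRangeLE R

namespace Problem

variable {m : ℕ} (K : Fin m → ConstraintKind) (I : Problem m)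

/-- The represented instance. -/
def input : Input := I.M.input I.θ I.ε

/-- The represented instance with the possible values of the counters. -/
def inst : Inst := I.M.inst I.θ I.ε

/-- The quantity in which the running time is to be polynomial. -/
def param : ℕ := (enc I.input).size + ⌈1 / I.ε⌉₊ + I.R

/-- A bound on the range of the costs of the reduced process. -/
def newRange : ℕ := 2 + (2 + 4 * I.input.allCosts.length * I.M.H) *
  (m * I.input.allCosts.length * I.R)

/-- The quantity in which the running time on the reduced instance is polynomial. -/
def newParam : ℕ := (enc (I.inst.reduce K)).size + ⌈1 / I.ε⌉₊ + I.newRange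

theorem polyBounded_size : PolyBounded (param (m := m)) fun I => (enc I.input).size :=
  .of_le fun I => by unfold param; omega

theorem polyBounded_value {β : Type} [Enc β] {f : Input → β} (hf : PT f) :
    PolyBounded (param (m := m)) fun I => (enc (f I.input)).size := by
  obtain ⟨q, hq⟩ := hf.exists_size_le
  exact (polyBounded_size.eval q).mono fun I => hq _

theorem polyBounded_costs : PolyBounded (param (m := m)) fun I => I.input.allCosts.length :=
  (polyBounded_value (PT.allCosts PT.id)).mono fun I =>
    (Nat.le_succ _).trans (length_le_size I.input.allCosts)

theorem polyBounded_horizon : PolyBounded (param (m := m)) fun I => I.M.H :=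
  (polyBounded_value (f := fun x => x.1.2.2.2) (by fun_prop)).mono fun I => by
    rw [← I.M.horizon_input I.θ I.ε]
    exact (Nat.le_succ _).trans (length_le_size I.input.1.2.2.2)

theorem polyBounded_accuracy : PolyBounded (param (m := m)) fun I => ⌈1 / I.ε⌉₊ :=
  .of_le fun I => by unfold param; omega

theorem polyBounded_range : PolyBounded (param (m := m)) fun I => I.R :=
  .of_le fun I => by unfold param; omega

theorem polyBounded_cap : PolyBounded (param (m := m)) fun I => I.input.cap m :=
  (polyBounded_horizon.mul (((((PolyBounded.const 4).mul (((PolyBounded.const m).mul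
    polyBounded_costs).mul polyBounded_range))).mul (polyBounded_horizon.add (.const 1))).mul
      polyBounded_accuracy)).mono fun I => CaMDP.cap_le I.ε_pos I.range_le

theorem polyBounded_size_inst : PolyBounded (param (m := m)) fun I => (enc I.inst).size := by
  refine ((PolyBounded.const 1).add (polyBounded_size.add ((PolyBounded.const 2).add
    ((polyBounded_cap.add (.const 1)).mul (polyBounded_cap.add (.const 3)))))).mono fun I => ?_
  have h : (enc (List.range (I.input.cap m + 1))).size ≤
      2 + (I.input.cap m + 1) * (I.input.cap m + 3) :=
    size_list_le (by simp) fun a ha => by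
      have h3 := size_nat_le a
      have h4 := List.mem_range.1 ha
      omega
  change (enc (I.input, List.range (I.input.cap m + 1))).size ≤ _
  rw [enc_mk, Data.size]
  omega

theorem polyBounded_newRange : PolyBounded (param (m := m)) newRange :=
  (PolyBounded.const 2).add (((PolyBounded.const 2).add (((PolyBounded.const 4).mul
    polyBounded_costs).mul polyBounded_horizon)).mul
      (((PolyBounded.const m).mul polyBounded_costs).mul polyBounded_range))

theorem polyBounded_newParam : PolyBounded param (newParam K) := by
  obtain ⟨q, hq⟩ := (PT.reduce K (α := Inst) PT.id).exists_size_le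
  exact (((polyBounded_size_inst.eval q).mono fun I => hq I.inst).add
    polyBounded_accuracy).add polyBounded_newRange

end Problem

/-! ### The programs of the reduction -/

/-- The algorithm: tabulate the values of the counters (`PW` computes the largest one, `PU` the
list), test plausibility (`PC`), reduce (`PR`), and call the bicriteria (`A`). A description of a
policy is paired with the instance, from which its evaluator recomputes the labels. -/
def reductionProg (PW PU PC PR A : Prog) : Prog :=
  .comp (.comp (.pair (.op .id) PW) PU) <|
    .ite PC
      (.comp (.pair (.op .id) (.comp PR A)) <|
        .ite (.comp (.op .snd) (.op .isPair))
          (.pair (.op (.const 1)) (.pair (.comp (.op .snd) (.op .snd)) (.op .fst)))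
          (.op (.const 0)))
      (.op (.const 0))

/-- The evaluator: translate the history (`PH`) and evaluate the policy of the reduced process. -/
def translationProg (PH ev : Prog) : Prog :=
  .comp (.pair (.comp (.op .fst) (.op .fst))
    (.comp (.pair (.comp (.op .fst) (.op .snd)) (.op .snd)) PH)) ev

section Runs

variable {PW PU PC PR A PH ev : Prog} {x W y v z out w τ τ' q : Data} {a b c d t : ℕ}

theorem runLe_translationProg (hH : RunLe PH (.pair y τ) τ' a)
    (hev : RunLe ev (.pair w τ') q b) :
    RunLe (translationProg PH ev) (.pair (.pair w y) τ) q
      (20 + 10 * (w.size + y.size + τ.size) + a + b) := by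
  refine (RunLe.comp (.pair (.comp (.op rfl) (.op rfl))
    (.comp (.pair (.comp (.op rfl) (.op rfl)) (.op rfl)) hH)) hev).mono ?_
  simp only [Data.size, Op.apply]
  omega

theorem runLe_reductionProg_of_not_pos (hW : RunLe PW x W a)
    (hU : RunLe PU (.pair x W) y b) (hC : RunLe PC y v c) (hv : ¬ v.Pos) :
    RunLe (reductionProg PW PU PC PR A) x (.num 0) (10 + x.size + a + b + c + y.size) := by
  refine (RunLe.comp (.comp (.pair (.op rfl) hW) hU) (.ite_neg hC hv (.op rfl))).mono ?_
  omega

theorem runLe_reductionProg_num (hW : RunLe PW x W a)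
    (hU : RunLe PU (.pair x W) y b) (hC : RunLe PC y v c) (hv : v.Pos) (hR : RunLe PR y z d) (hA : RunLe A z (.num 0) t) :
    RunLe (reductionProg PW PU PC PR A) x (.num 0)
      (30 + x.size + a + b + c + 10 * y.size + d + t) := by
  refine (RunLe.comp (.comp (.pair (.op rfl) hW) hU) (.ite_pos hC hv
    (.comp (.pair (.op rfl) (.comp hR hA)) (.ite_neg (.comp (.op rfl) (.op rfl)) ?_
      (.op rfl))))).mono ?_
  · exact lt_irrefl _
  · simp [Op.apply, Data.size]
    omega

theorem runLe_reductionProg_pair (hW : RunLe PW x W a)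
    (hU : RunLe PU (.pair x W) y b) (hC : RunLe PC y v c) (hv : v.Pos) (hR : RunLe PR y z d)
    (hA : RunLe A z (.pair (.num 1) w) t) :
    RunLe (reductionProg PW PU PC PR A) x (.pair (.num 1) (.pair w y))
      (60 + x.size + a + b + c + 10 * y.size + 10 * w.size + d + t) := by
  refine (RunLe.comp (.comp (.pair (.op rfl) hW) hU) (.ite_pos hC hv
    (.comp (.pair (.op rfl) (.comp hR hA)) (.ite_pos (.comp (.op rfl) (.op rfl)) ?_
      (.pair (.op rfl) (.pair (.comp (.op rfl) (.op rfl)) (.op rfl))))))).mono ?_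
  · exact one_pos
  · simp [Op.apply, Data.size]
    omega

end Runs

namespace Problem

variable {m : ℕ} (K : Fin m → ConstraintKind) (cls : PolicyClass) (I : Problem m)

/-- The instance of the constrained problem as a datum. -/
def datum : Data :=
  .pair I.M.code (.pair (.pair (.ofVec I.θ.1) (.ofVec I.θ.2)) (.num I.ε))

theorem enc_input : enc I.input = I.datum := by
  rw [datum, ← CaMDP.enc_raw, ← enc_ofFn_rat, ← enc_ofFn_rat]
  rfl

/-- The labels of the reduced process. -/
def labelling : Labelling I.M := I.M.labelling K I.θ I.ε

theorem enc_reduce : enc (I.inst.reduce K) = .pair (I.labelling K).mdp.code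
    (.pair (.ofVec (I.M.newBudget K I.θ I.ε)) (.num I.ε)) := by
  rw [labelling, ← CaMDP.enc_raw, CaMDP.raw_mdp, ← enc_ofFn_rat, ← CaMDP.newBudgets_input]
  rfl

/-- The constraints relaxed by `ε`. -/
def Sat (ε : ℚ) (π : I.M.Policy) : Prop :=
  ∀ i, (K i).Holds I.M i (I.θ.1 i + ε) (I.θ.2 i + ε) π

/-- The constraints of the reduced instance relaxed by `ε`. -/
def NewSat (ε : ℚ) (π : (I.labelling K).mdp.Policy) : Prop :=
  ∀ i, (K i).sr.cost (I.labelling K).mdp i π ≤ (I.M.newBudget K I.θ I.ε i : ℝ) + (ε : ℝ)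

variable {K I}

theorem newSat_lower {π : I.M.Policy} (h : I.Sat K 0 π) :
    I.NewSat K 0 fun τ => π ((I.labelling K).lower τ) := fun i =>
  CaMDP.cost_le_of_holds ((I.labelling K).agree_comp_lower π) I.ε_pos i (h i)

theorem sat_lift (hpl : I.input.Plausible K) {π : (I.labelling K).mdp.Policy}
    (h : I.NewSat K I.ε π) : I.Sat K I.ε fun τ => π ((I.labelling K).lift τ) := fun i =>
  CaMDP.holds_of_cost_le ((I.labelling K).agree_comp_lift π) I.ε_pos hpl i (h i)

/-- The reduced problem has at least the optimal value of the given one. -/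
theorem optValue_le : I.M.optValue cls (I.Sat K 0) ≤
    (I.labelling K).mdp.optValue cls (I.NewSat K 0) := by
  refine iSup₂_le fun π hπ => ?_
  rw [← ((I.labelling K).agree_comp_lower π).value_eq]
  exact le_iSup₂ (f := fun (π : (I.labelling K).mdp.Policy) _ =>
    (((I.labelling K).mdp.value π : ℝ) : EReal)) _
      ⟨(I.labelling K).inClass_comp_lower hπ.1, newSat_lower hπ.2⟩

end Problem

/-- One call of the bicriteria, on the reduced instance, solves the constrained problem. The policy
is described by the description of the policy of the reduced process together with the instance. -/
theorem polyTimeConstrained_of_bicriteria (cls : PolicyClass) {m : ℕ}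
    (K : Fin m → ConstraintKind) (E : Set ℚ) (hE : ∀ ε ∈ E, 0 < ε)
    (hbi : PolyTimeBicriteria cls (fun i => (K i).sr) E) : PolyTimeConstrained cls K E := by
  obtain ⟨A, ev, pA, hA⟩ := hbi
  obtain ⟨PW, pW, hW⟩ := (PT.cap (α := Input) PT.id m).exists_runLe
  obtain ⟨PU, pU, hU⟩ := exists_prog_range (α := Input)
  obtain ⟨e, he, hplaus⟩ := PTPred.plausible (α := Inst) K (x := Prod.fst) (.fst .id)
  obtain ⟨PC, pC, hC⟩ := he.exists_runLe
  obtain ⟨PR, pR, hR⟩ := (PT.reduce K (α := Inst) PT.id).exists_runLe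
  obtain ⟨PH, pH, hH⟩ := (PT.translate K (α := Inst × RawHist) (.fst .id) (.snd .id)).exists_runLe
  obtain ⟨cA, hcA⟩ := A.exists_size_le
  -- Time of the algorithm. The description that the bicriteria outputs is copied, and its size is
  -- bounded by the running time.
  have hbound : PolyBounded Problem.param fun I : Problem m =>
      60 + (enc I.input).size + pW.eval (enc I.input).size +
        pU.eval ((enc I.input).size + I.input.cap m) + pC.eval (enc I.inst).size +
        10 * (enc I.inst).size + 10 * (cA * pA.eval (I.newParam K)) +
        pR.eval (enc I.inst).size + pA.eval (I.newParam K) := by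
    have h1 := Problem.polyBounded_size (m := m)
    have h2 := Problem.polyBounded_size_inst (m := m)
    have h3 := (Problem.polyBounded_newParam K).eval pA
    have h4 := (h1.add Problem.polyBounded_cap).eval pU
    exact ((((((((PolyBounded.const 60).add h1).add (h1.eval pW)).add h4).add (h2.eval pC)).add
      ((PolyBounded.const 10).mul h2)).add ((PolyBounded.const 10).mul
        ((PolyBounded.const cA).mul h3))).add (h2.eval pR)).add h3
  -- Time of the evaluator on a history of size `n`.
  have hbound' : PolyBounded (fun j : Problem m × ℕ => j.1.param + j.2) fun j =>
      20 + 10 * (cA * pA.eval (j.1.newParam K) + (enc j.1.inst).size + j.2) +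
        pH.eval (1 + (enc j.1.inst).size + j.2) +
        pA.eval (j.1.newParam K + pH.eval (1 + (enc j.1.inst).size + j.2)) := by
    have h1 := (Problem.polyBounded_newParam K).precomp (N' := fun j => j.1.param + j.2)
      (Prod.fst : Problem m × ℕ → _) fun j => Nat.le_add_right _ _
    have h2 := (Problem.polyBounded_size_inst (m := m)).precomp (N' := fun j => j.1.param + j.2)
      (Prod.fst : Problem m × ℕ → _) fun j => Nat.le_add_right _ _
    have h3 : PolyBounded (fun j : Problem m × ℕ => j.1.param + j.2) Prod.snd :=
      .of_le fun j => Nat.le_add_left _ _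
    have h4 := (((PolyBounded.const 1).add h2).add h3).eval pH
    exact (((PolyBounded.const 20).add ((PolyBounded.const 10).mul
      ((((PolyBounded.const cA).mul (h1.eval pA)).add h2).add h3))).add h4).add
        ((h1.add h4).eval pA)
  obtain ⟨p, hp⟩ := hbound
  obtain ⟨p', hp'⟩ := hbound'
  refine ⟨reductionProg PW PU PC PR A, translationProg PH ev, p + p', ?_⟩
  intro M θ ε R _ hε hrange x N
  let I : Problem m := ⟨M, θ, ε, R, hE ε hε, hrange⟩
  have hx : enc I.input = x := I.enc_input
  have hN : I.param = N := by rw [Problem.param, hx]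
  specialize hp I
  simp only [hN, hx] at hp
  have hrun1 := (hW I.input).1
  have hrun2 := hU I.input (I.input.cap m)
  have hrun3 := (hC I.inst).1
  have hrun4 := (hR I.inst).1
  have hout : ∀ out t, RunLe (reductionProg PW PU PC PR A) x out t → t ≤ p.eval N →
      ∃ t, Run (reductionProg PW PU PC PR A) x out t ∧ t ≤ (p + p').eval N := by
    rintro out t ⟨s, hs, h⟩ ht
    exact ⟨s, h, by rw [Polynomial.eval_add]; omega⟩
  by_cases hpl : I.input.Plausible K
  swap
  · have hv : ¬ (enc (e I.inst)).Pos := fun h => hpl ((hplaus I.inst).2 h)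
    obtain ⟨t, h1, h2⟩ := hout _ _ (hx ▸ runLe_reductionProg_of_not_pos hrun1 hrun2 hrun3 hv)
      (by change _ + (enc I.inst).size ≤ _; omega)
    refine ⟨_, t, h1, h2, .inl ⟨rfl, ?_⟩⟩
    rintro ⟨π, -, hπ⟩
    exact hpl (CaMDP.plausible_of_holds I.ε_pos hπ)
  have hv : (enc (e I.inst)).Pos := (hplaus I.inst).1 hpl
  obtain ⟨out, t, hrun, ht, hcase⟩ := hA (I.labelling K).mdp (M.newBudget K θ ε) ε I.newRange
    (fun h _ s a k i => CaMDP.costVal_mdp_mem_dom h s a k i) hε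
    (CaMDP.costRangeLE_mdp I.ε_pos hrange hpl)
  have hz := I.enc_reduce K
  rw [← hz] at hrun ht hcase
  change t ≤ pA.eval (I.newParam K) at ht
  have hsize := (hcA _ _ _ hrun).trans (Nat.mul_le_mul_left cA ht)
  rcases hcase with ⟨rfl, hinf⟩ | ⟨w, rfl, π, hcls, heval, hsat, hval⟩
  · obtain ⟨t, h1, h2⟩ := hout _ _ (hx ▸ runLe_reductionProg_num hrun1 hrun2 hrun3 hv hrun4
      ⟨_, ht, hrun⟩) (by change _ + 10 * (enc I.inst).size + _ + _ ≤ _; omega)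
    refine ⟨_, t, h1, h2, .inl ⟨rfl, ?_⟩⟩
    rintro ⟨π, hcls, hπ⟩
    exact hinf ⟨_, (I.labelling K).inClass_comp_lower hcls, Problem.newSat_lower hπ⟩
  · have hw : w.size ≤ cA * pA.eval (I.newParam K) := by
      rw [Data.size] at hsize
      omega
    obtain ⟨t, h1, h2⟩ := hout _ _ (hx ▸ runLe_reductionProg_pair hrun1 hrun2 hrun3 hv hrun4
      ⟨_, ht, hrun⟩)
      (by change _ + 10 * (enc I.inst).size + _ + _ + _ ≤ _; omega)
    refine ⟨_, t, h1, h2, .inr ⟨_, rfl, fun τ => π ((I.labelling K).lift τ),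
      (I.labelling K).inClass_comp_lift hcls, fun τ hτ hl => ?_, Problem.sat_lift hpl hsat, ?_⟩⟩
    · obtain ⟨q, s, hq, hs, hπq⟩ := heval _ ((I.labelling K).isHist_lift hτ)
        (by rw [(I.labelling K).length_lift]; exact hl)
      have htr := M.rawHist_lift K θ ε (.of_isHist M hτ)
      have hτ' : enc (I.inst.translate K (M.rawHist τ)) =
          (I.labelling K).mdp.histCode ((I.labelling K).lift τ) := by
        rw [← CaMDP.enc_rawHist]
        exact (congrArg enc htr).symm
      obtain ⟨h3, h4⟩ := hH (I.inst, M.rawHist τ)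
      dsimp only at h3 h4
      rw [hτ', enc_mk, CaMDP.enc_rawHist] at h3 h4
      obtain ⟨t', ht', h5⟩ := runLe_translationProg h3 ⟨s, hs, hq⟩
      refine ⟨q, t', h5, ?_, hπq⟩
      have h6 := hp' (I, (M.histCode τ).size)
      simp only [hN] at h6
      simp only [Polynomial.eval_add]
      refine ht'.trans (le_trans ?_ (h6.trans (Nat.le_add_left _ _)))
      have h7 := poly_eval_mono pA (Nat.add_le_add_left h4 (I.newParam K))
      simp only [Data.size] at h4 h7 ⊢
      change _ + pA.eval (I.newParam K + _) ≤ _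
      omega
    · refine ((Problem.optValue_le cls (I := I) (K := K)).trans hval).trans_eq ?_
      rw [((I.labelling K).agree_comp_lift π).value_eq]

end CRL

theorem mainTheorem2 (cls : CRL.PolicyClass) (m : ℕ) (K : Fin m → CRL.ConstraintKind)
    (E : Set ℚ) (hE : ∀ ε ∈ E, 0 < ε)
    (hbi : CRL.PolyTimeBicriteria cls (fun i => (K i).sr) E) :
    CRL.PolyTimeConstrained cls K E :=
  CRL.polyTimeConstrained_of_bicriteria cls K E hE hbi
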